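/- Let $N\ge 2$ and let $\Omega\subset\mathbb R^N$ be a bounded domain with $C^{1,1}$ boundary $\Gamma$, given with a finite system of local coordinates $\{(U_r,y_r,\varphi_r)\}_{r=1}^M$ and numbers $\alpha,\beta>0$: the open sets $U_r$ cover $\Gamma$, $y_r=(y_r',y_{rN})$ are coordinates obtained by a rigid motion, $\varphi_r\in C^{1,1}(\Delta_r)$ with $\Delta_r=\{|y_r'|<\alpha\}$, and $\Gamma\cap U_r$, $\Omega\cap U_r$, $\overline\Omega^c\cap U_r$ are, respectively, the sets of points with $y_r'\in\Delta_r$ and $y_{rN}=\varphi_r(y_r')$, $\varphi_r(y_r')<y_{rN}<\varphi_r(y_r')+\beta$, $\varphi_r(y_r')-\beta<y_{rN}<\varphi_r(y_r')$. Let $d$ be the signed distance to $\Gamma$ (negative in $\Omega$), $\Gamma(\delta)=\{x:|d(x)|<\delta\}$ and $n=\nabla d|_\Gamma$ the outer unit normal. For $\sigma,h>0$ let $\mathbb T_{\sigma,h}$ be the set of finite conforming triangulations $\mathcal T_h$ by closed nondegenerate $N$-simplices $T$ with $h_T:=\operatorname{diam}T\le h$ and $h_T\le\sigma\rho_T$,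 where $\rho_T$ is the diameter of the inscribed ball of $T$, which satisfy the following. Let $\overline\Omega_h=\bigcup_{T\in\mathcal T_h}T$, let $\mathcal S_h$ be the set of $(N-1)$-faces of simplices of $\mathcal T_h$ that are contained in $\partial\overline\Omega_h$, and let $\Gamma_h=\bigcup_{S\in\mathcal S_h}S$; then the vertices of every $S\in\mathcal S_h$ lie on $\Gamma$, and for each $r$ the set $\Gamma_h\cap U_r$ is, in the coordinates $y_r$, the graph over $\Delta_r$ of a continuous function. **Theorem.** There are $\delta>0$ and a map $\pi$ such that for each $x\in\Gamma(\delta)$ the point $y=\pi(x)$ is the unique $y\in\Gamma$ with $x=y+d(x)\,n(y)$. There are moreover $K_0>0$, depending only on $N$ and $\Omega$ (with its local coordinates), and for each $p\in[1,\infty]$ a constant $C>0$, depending only on $p$, $N$ and $\Omega$ (with its local coordinates), such that for all $\sigma,K>0$ there is $h_1>0$ with the following property. Let $0<h<h_1$ and $\mathcal T_h\in\mathbb T_{\sigma,h}$. Then $\Gamma_h\subset\Gamma(K_0h^2)$. Moreover, if $\Gamma_h\subset\Gamma(Kh^2)$ (in particular, if $K=K_0$) and $\delta_1\in[Kh^2,2Kh^2]$,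 then $\delta_1<\delta$, and for every $p\in[1,\infty]$ each $f\in W^{1,p}(\Gamma(\delta_1))$ has traces on $\Gamma_h$ and on $\Gamma$, and $$\|f-f\circ\pi\|_{L^p(\Gamma_h)}\le C\,\delta_1^{1-1/p}\,\|f\|_{W^{1,p}(\Gamma(\delta_1))},$$ where $f$ denotes its trace on $\Gamma_h$ in the first term and $f\circ\pi$ is the composition of its trace on $\Gamma$ with $\pi$; here $1/\infty=0$ and $\|f\|_{W^{1,p}}=\|f\|_{L^p}+\|\nabla f\|_{L^p}$. -/

import Mathlib

open Set Filter Topology MeasureTheory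
open scoped ENNReal NNReal ContDiff

noncomputable section

/-- Euclidean space of dimension `n`. -/
abbrev Euc (n : ℕ) := EuclideanSpace ℝ (Fin n)

/-! ### The domain, its signed distance function and the orthogonal projection

Throughout, the ambient dimension is `N = m + 1`. -/

/-- A system of local coordinates exhibiting the boundary of `Ω` as a `C^{1,1}` hypersurface.
The `r`-th coordinates `y = A r x` are obtained by a rigid motion and are split as
`y = (y', y_N)`, with `y' = (A r x).fst` and `y_N = (A r x).snd`. -/
structure C11Atlas {m : ℕ} (Ω : Set (Euc (m + 1))) where
  M : ℕ
  U : Fin M → Set (Euc (m + 1))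
  A : Fin M → Euc (m + 1) ≃ᵃⁱ[ℝ] WithLp 2 (Euc m × ℝ)
  φ : Fin M → Euc m → ℝ
  α : ℝ
  β : ℝ
  α_pos : 0 < α
  β_pos : 0 < β
  isOpen_U : ∀ r, IsOpen (U r)
  frontier_subset : frontier Ω ⊆ ⋃ r, U r
  differentiableOn : ∀ r, DifferentiableOn ℝ (φ r) (Metric.ball 0 α)
  lipschitz_fderiv : ∀ r, ∃ L : ℝ≥0, LipschitzOnWith L (fderiv ℝ (φ r)) (Metric.ball 0 α)
  frontier_inter : ∀ r, frontier Ω ∩ U r =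
    {x | (A r x).fst ∈ Metric.ball 0 α ∧ (A r x).snd = φ r (A r x).fst}
  domain_inter : ∀ r, Ω ∩ U r =
    {x | (A r x).fst ∈ Metric.ball 0 α ∧
      φ r (A r x).fst < (A r x).snd ∧ (A r x).snd < φ r (A r x).fst + β}
  exterior_inter : ∀ r, (closure Ω)ᶜ ∩ U r =
    {x | (A r x).fst ∈ Metric.ball 0 α ∧
      φ r (A r x).fst - β < (A r x).snd ∧ (A r x).snd < φ r (A r x).fst}

open Classical in
/-- The signed distance to the boundary of `Ω`, negative inside `Ω`. -/
def sgnDist {n : ℕ} (Ω : Set (Euc n)) (x : Euc n) : ℝ :=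
  if x ∈ Ω then -Metric.infDist x (frontier Ω) else Metric.infDist x (frontier Ω)

/-- The tubular neighbourhood `Γ(δ)` of the boundary `Γ` of `Ω`. -/
def tube {n : ℕ} (Ω : Set (Euc n)) (δ : ℝ) : Set (Euc n) :=
  {x | |sgnDist Ω x| < δ}

/-- The outer unit normal on the boundary of `Ω`, as the gradient of the signed distance. -/
def outerNormal {n : ℕ} (Ω : Set (Euc n)) (y : Euc n) : Euc n :=
  gradient (sgnDist Ω) y

/-- `y` is an orthogonal projection of `x` onto the boundary of `Ω`:
`x = y + d(x) n(y)` with `y ∈ Γ`. -/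
def IsOrthProj {n : ℕ} (Ω : Set (Euc n)) (x y : Euc n) : Prop :=
  y ∈ frontier Ω ∧ x = y + sgnDist Ω x • outerNormal Ω y

/-! ### Triangulations -/

/-- A finite conforming triangulation by nondegenerate closed `(m+1)`-simplices; a simplex is
given by its set of vertices. Two simplices meet in the (possibly empty) face spanned by their
common vertices. -/
structure Triangulation (m : ℕ) where
  cells : Finset (Finset (Euc (m + 1)))
  card_eq : ∀ s ∈ cells, s.card = m + 2
  affineIndependent : ∀ s ∈ cells, AffineIndependent ℝ (fun v : s => (v : Euc (m + 1)))
  inter_eq : ∀ s ∈ cells, ∀ t ∈ cells,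
    convexHull ℝ (s : Set (Euc (m + 1))) ∩ convexHull ℝ (t : Set (Euc (m + 1))) =
      convexHull ℝ ((s : Set (Euc (m + 1))) ∩ (t : Set (Euc (m + 1))))

namespace Triangulation

variable {m : ℕ}

/-- The closed polyhedral set that is triangulated. -/
def body (T : Triangulation m) : Set (Euc (m + 1)) :=
  ⋃ s ∈ T.cells, convexHull ℝ (s : Set (Euc (m + 1)))

/-- The boundary mesh (as vertex sets): the `m`-dimensional faces of the cells that lie on the
boundary of the triangulated set. -/
def boundaryMesh (T : Triangulation m) : Set (Finset (Euc (m + 1))) :=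
  {F | F.card = m + 1 ∧ (∃ s ∈ T.cells, F ⊆ s) ∧
    convexHull ℝ (F : Set (Euc (m + 1))) ⊆ frontier T.body}

/-- The discrete boundary `Γ_h`, the union of the boundary mesh. -/
def discreteBoundary (T : Triangulation m) : Set (Euc (m + 1)) :=
  ⋃ F ∈ T.boundaryMesh, convexHull ℝ (F : Set (Euc (m + 1)))

/-- All cells have diameter at most `h`. -/
def MeshSizeLE (T : Triangulation m) (h : ℝ) : Prop :=
  ∀ s ∈ T.cells, Metric.diam (convexHull ℝ (s : Set (Euc (m + 1)))) ≤ h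

/-- Shape regularity: the diameter of every cell is at most `σ` times the diameter `ρ` of some
ball inscribed in the cell. -/
def ShapeRegular (T : Triangulation m) (σ : ℝ) : Prop :=
  ∀ s ∈ T.cells, ∃ (c : Euc (m + 1)) (ρ : ℝ),
    Metric.closedBall c (ρ / 2) ⊆ convexHull ℝ (s : Set (Euc (m + 1))) ∧
    Metric.diam (convexHull ℝ (s : Set (Euc (m + 1)))) ≤ σ * ρ

/-- All vertices of the boundary mesh lie on the boundary of `Ω`. -/
def BoundaryVerticesOn (T : Triangulation m) (Ω : Set (Euc (m + 1))) : Prop :=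
  ∀ F ∈ T.boundaryMesh, ∀ v ∈ F, v ∈ frontier Ω

/-- In each local coordinate neighbourhood, the discrete boundary is the graph of a continuous
function over the whole base ball. -/
def GraphCompatible (T : Triangulation m) {Ω : Set (Euc (m + 1))} (𝒜 : C11Atlas Ω) : Prop :=
  ∀ r, ∃ φh : Euc m → ℝ, ContinuousOn φh (Metric.ball 0 𝒜.α) ∧
    T.discreteBoundary ∩ 𝒜.U r =
    {x | (𝒜.A r x).fst ∈ Metric.ball 0 𝒜.α ∧ (𝒜.A r x).snd = φh (𝒜.A r x).fst}

end Triangulation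

/-! ### Sobolev functions and traces -/

/-- `F` is the weak gradient of `f` in the open set `G`. -/
def HasWeakGradient {n : ℕ} (G : Set (Euc n)) (f : Euc n → ℝ) (F : Euc n → Euc n) : Prop :=
  LocallyIntegrableOn f G ∧ LocallyIntegrableOn F G ∧
  ∀ η : Euc n → ℝ, ContDiff ℝ ∞ η → HasCompactSupport η → tsupport η ⊆ G →
    ∀ v : Euc n, ∫ x in G, f x * fderiv ℝ η x v = -∫ x in G, inner ℝ (F x) v * η x

/-- `f ∈ W^{1,p}(G)`, with weak gradient `F`. -/
def MemW1p {n : ℕ} (G : Set (Euc n)) (p : ℝ≥0∞) (f : Euc n → ℝ) (F : Euc n → Euc n) : Prop :=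
  HasWeakGradient G f F ∧ MemLp f p (volume.restrict G) ∧ MemLp F p (volume.restrict G)

/-- The norm `‖f‖_{L^p(G)} + ‖∇f‖_{L^p(G)}` of `W^{1,p}(G)`. -/
def w1pNorm {n : ℕ} (G : Set (Euc n)) (p : ℝ≥0∞) (f : Euc n → ℝ) (F : Euc n → Euc n) : ℝ≥0∞ :=
  eLpNorm f p (volume.restrict G) + eLpNorm F p (volume.restrict G)

/-- `g` is the trace on the compact hypersurface `S ⊆ G` of the function `f`, whose weak gradient
in the open set `G` is `F`: some smooth functions converge to `f` in `W^{1,1}_loc(G)` while their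
restrictions to `S` converge to `g` in `L¹(S)` for the surface measure. -/
def IsTraceOn {m : ℕ} (G S : Set (Euc (m + 1))) (f : Euc (m + 1) → ℝ)
    (F : Euc (m + 1) → Euc (m + 1)) (g : Euc (m + 1) → ℝ) : Prop :=
  Integrable g (μHE[m].restrict S) ∧
  ∃ u : ℕ → Euc (m + 1) → ℝ, (∀ k, ContDiff ℝ ∞ (u k)) ∧
    (∀ Q : Set (Euc (m + 1)), IsCompact Q → Q ⊆ G →
      Tendsto (fun k => w1pNorm Q 1 (fun x => u k x - f x) (fun x => gradient (u k) x - F x))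
        atTop (𝓝 0)) ∧
    Tendsto (fun k => eLpNorm (fun x => u k x - g x) 1 (μHE[m].restrict S)) atTop (𝓝 0)

end

/-! ### The signed distance function -/

/-! Everything rests on one expansion: with a single constant `C`, the signed distance d satisfies
|d(x) - n(y)·(x - y)| ≤ C|x - y|² for all y on Γ and all x (`C11Atlas.exists_second_order`). It is
read off from the graphs of the C^{1,1} functions, and after that Γ enters mostly through it. It
makes n Lipschitz, makes the projection π unique and Lipschitz on the tube of half-width 1/(12C),
and shows that a point y + s n(y) with s small has projection y and signed distance s
(`HasSecondOrderNormal.exists_isNormalTube`). No differentiability of π is used.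

For the mesh, the vertices of a boundary face lie within O(h²) of the tangent plane at one of them,
and convexity carries this to the whole face; this gives the tube of width K₀h². Shape regularity
turns the height O(h²) into a slope O(σh): secants of a face are almost orthogonal to the normal,
and d has small Lipschitz constant on the face (`Triangulation.face_estimate`). In each chart the
relevant part of Γ_h is therefore, for small h, a graph whose Lipschitz constant depends only on the
atlas and along which d is 1/2-Lipschitz (`C11Atlas.exists_patches`). The mesh parameters only
influence how small h must be, which is why the final constant does not depend on σ and K.

Over such a patch the map (w, s) ↦ π(X w) + s ν(X w) has a Lipschitz inverse with an absolute
constant. Comparing Hausdorff measures gives, without the area formula, that integrating over Γ_h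
the integrals of ψ ≥ 0 along normal segments costs at most a constant times the integral of ψ over
the tube (`IsTangentialPatch.lintegral_segIntegral_le`).

For smooth u, |u(x) - u(π x)| is at most the integral of |∇u| along the normal segment through x.
Mollification and L¹ convergence on compact subsets pass this to the traces as an almost everywhere
bound by the weak gradient (`IsTubeSurface.ae_enorm_sub_le`). Only then does the exponent p enter:
Hölder on a segment of length 2b gives the factor (2b)^{1-1/p}
(`IsTubeSurface.eLpNorm_segIntegral_le`). Hence p = 1 and p = ∞ need no separate approximation
argument. -/

theorem abs_sgnDist {n : ℕ} (Ω : Set (Euc n)) (x : Euc n) :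
    |sgnDist Ω x| = Metric.infDist x (frontier Ω) := by
  unfold sgnDist
  split_ifs <;> simp [abs_of_nonneg Metric.infDist_nonneg]

theorem sgnDist_of_mem {n : ℕ} {Ω : Set (Euc n)} {x : Euc n} (hx : x ∈ Ω) :
    sgnDist Ω x = -Metric.infDist x (frontier Ω) := if_pos hx

theorem sgnDist_of_notMem {n : ℕ} {Ω : Set (Euc n)} {x : Euc n} (hx : x ∉ Ω) :
    sgnDist Ω x = Metric.infDist x (frontier Ω) := if_neg hx

theorem sgnDist_of_mem_frontier {n : ℕ} {Ω : Set (Euc n)} {x : Euc n} (hx : x ∈ frontier Ω) :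
    sgnDist Ω x = 0 := by
  rw [← abs_eq_zero, abs_sgnDist, Metric.infDist_zero_of_mem hx]

theorem abs_sgnDist_le_dist {n : ℕ} {Ω : Set (Euc n)} (x : Euc n) {y : Euc n}
    (hy : y ∈ frontier Ω) : |sgnDist Ω x| ≤ dist x y :=
  abs_sgnDist Ω x ▸ Metric.infDist_le_dist_of_mem hy

theorem exists_mem_frontier_dist_eq {n : ℕ} {Ω : Set (Euc n)} (hne : (frontier Ω).Nonempty)
    (x : Euc n) : ∃ y ∈ frontier Ω, dist x y = |sgnDist Ω x| := by
  obtain ⟨y, hy, h⟩ := isClosed_frontier.exists_infDist_eq_dist hne x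
  exact ⟨y, hy, by rw [abs_sgnDist, h]⟩

theorem exists_mem_segment_frontier {n : ℕ} {Ω : Set (Euc n)} {x z : Euc n} (hx : x ∈ Ω)
    (hz : z ∉ Ω) : ∃ w ∈ segment ℝ x z, w ∈ frontier Ω := by
  by_contra! hcon
  have hpre : IsPreconnected (segment ℝ x z) := (convex_segment x z).isPreconnected
  have := hpre.subset_of_closure_inter_subset (u := interior Ω) isOpen_interior
  have hxi : x ∈ interior Ω := by
    by_contra hxi
    exact hcon x (left_mem_segment ℝ x z) ⟨subset_closure hx, hxi⟩
  have hsub : segment ℝ x z ⊆ interior Ω := by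
    refine this ⟨x, left_mem_segment ℝ x z, hxi⟩ ?_
    rintro w ⟨hw1, hw2⟩
    by_contra hwi
    exact hcon w hw2 ⟨closure_mono interior_subset hw1, hwi⟩
  exact hz (interior_subset (hsub (right_mem_segment ℝ x z)))

/-- On one side of the boundary this is the Lipschitz bound for the distance to a set. For points on
opposite sides the segment between them meets the frontier, so the two distances add up to at most
its length. -/
theorem abs_sgnDist_sub_le {n : ℕ} (Ω : Set (Euc n)) (x z : Euc n) :
    |sgnDist Ω x - sgnDist Ω z| ≤ dist x z := by
  have hsame : |Metric.infDist x (frontier Ω) - Metric.infDist z (frontier Ω)| ≤ dist x z := by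
    rw [abs_sub_le_iff]
    have h1 := Metric.infDist_le_infDist_add_dist (s := frontier Ω) (x := x) (y := z)
    have h2 := Metric.infDist_le_infDist_add_dist (s := frontier Ω) (x := z) (y := x)
    rw [dist_comm z x] at h2
    constructor <;> linarith
  have hcross : ∀ x z : Euc n, x ∈ Ω → z ∉ Ω →
      Metric.infDist x (frontier Ω) + Metric.infDist z (frontier Ω) ≤ dist x z := by
    intro x z hx hz
    obtain ⟨w, hw, hwf⟩ := exists_mem_segment_frontier hx hz
    rw [← dist_add_dist_of_mem_segment hw, dist_comm w z]
    exact add_le_add (Metric.infDist_le_dist_of_mem hwf) (Metric.infDist_le_dist_of_mem hwf)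
  have p1 : 0 ≤ Metric.infDist x (frontier Ω) := Metric.infDist_nonneg
  have p2 : 0 ≤ Metric.infDist z (frontier Ω) := Metric.infDist_nonneg
  by_cases hx : x ∈ Ω <;> by_cases hz : z ∈ Ω
  · rw [sgnDist_of_mem hx, sgnDist_of_mem hz, neg_sub_neg, abs_sub_comm]; exact hsame
  · rw [sgnDist_of_mem hx, sgnDist_of_notMem hz, abs_sub_le_iff]
    have := hcross x z hx hz
    constructor <;> linarith
  · rw [sgnDist_of_notMem hx, sgnDist_of_mem hz, abs_sub_le_iff]
    have := hcross z x hz hx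
    rw [dist_comm] at this
    constructor <;> linarith
  · rw [sgnDist_of_notMem hx, sgnDist_of_notMem hz]; exact hsame

theorem continuous_sgnDist {n : ℕ} (Ω : Set (Euc n)) : Continuous (sgnDist Ω) := by
  have : LipschitzWith 1 (sgnDist Ω) := LipschitzWith.of_dist_le_mul fun x z => by
    simpa [Real.dist_eq] using abs_sgnDist_sub_le Ω x z
  exact this.continuous

theorem isOpen_tube {n : ℕ} (Ω : Set (Euc n)) (a : ℝ) : IsOpen (tube Ω a) :=
  isOpen_lt (continuous_sgnDist Ω).abs continuous_const

theorem tube_mono {n : ℕ} (Ω : Set (Euc n)) {a b : ℝ} (h : a ≤ b) : tube Ω a ⊆ tube Ω b :=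
  fun _ hx => lt_of_lt_of_le hx h

theorem frontier_subset_tube {n : ℕ} (Ω : Set (Euc n)) {a : ℝ} (ha : 0 < a) :
    frontier Ω ⊆ tube Ω a := fun x hx => by
  simpa [tube, sgnDist_of_mem_frontier hx] using ha

theorem isCompact_frontier_of_isBounded {n : ℕ} {Ω : Set (Euc n)} (hb : Bornology.IsBounded Ω) :
    IsCompact (frontier Ω) :=
  Metric.isCompact_of_isClosed_isBounded isClosed_frontier (hb.closure.subset frontier_subset_closure)

theorem isCompact_abs_sgnDist_le {n : ℕ} {Ω : Set (Euc n)} (hb : Bornology.IsBounded Ω)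
    (hne : (frontier Ω).Nonempty) (a : ℝ) : IsCompact {x | |sgnDist Ω x| ≤ a} := by
  refine Metric.isCompact_of_isClosed_isBounded
    (isClosed_le (continuous_sgnDist Ω).abs continuous_const) ?_
  refine ((isCompact_frontier_of_isBounded hb).isBounded.cthickening (δ := a)).subset ?_
  intro x hx
  obtain ⟨y, hy, hxy⟩ := exists_mem_frontier_dist_eq hne x
  exact Metric.mem_cthickening_of_dist_le x y a _ hy (hxy ▸ hx)

theorem nonempty_frontier_of_isBounded {m : ℕ} {Ω : Set (Euc (m + 1))}
    (hb : Bornology.IsBounded Ω) (hne : Ω.Nonempty) : (frontier Ω).Nonempty := by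
  rw [nonempty_frontier_iff]
  refine ⟨hne, fun h => ?_⟩
  exact NormedSpace.unbounded_univ ℝ (Euc (m + 1)) (h ▸ hb)

/-- The sign of the signed distance is constant along a segment which misses the boundary. -/
theorem mem_iff_mem_of_segment {n : ℕ} {Ω : Set (Euc n)} {x z : Euc n}
    (h : ∀ w ∈ segment ℝ x z, w ∉ frontier Ω) : x ∈ Ω ↔ z ∈ Ω := by
  constructor <;> intro hx <;> by_contra hz
  · obtain ⟨w, hw, hf⟩ := exists_mem_segment_frontier hx hz
    exact h w hw hf
  · obtain ⟨w, hw, hf⟩ := exists_mem_segment_frontier hx hz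
    exact h w (segment_symm ℝ x z ▸ hw) hf

/-! ### Local coordinates and the normal field -/

theorem hasGradientAt_of_abs_sub_le_sq {n : ℕ} {f : Euc n → ℝ} {y g : Euc n} {C ρ : ℝ}
    (hρ : 0 < ρ) (h : ∀ x ∈ Metric.ball y ρ, |f x - f y - inner ℝ g (x - y)| ≤ C * ‖x - y‖ ^ 2) :
    HasGradientAt f g y := by
  rw [hasGradientAt_iff_isLittleO]
  have h1 : (fun x => f x - f y - inner ℝ g (x - y)) =O[𝓝 y] fun x => ‖x - y‖ ^ 2 := by
    refine Asymptotics.IsBigO.of_bound C ?_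
    filter_upwards [Metric.ball_mem_nhds y hρ] with x hx
    simpa using h x hx
  refine h1.trans_isLittleO ?_
  have h2 : (fun x : Euc n => ‖x - y‖ ^ 2) =o[𝓝 y] fun x => ‖x - y‖ ^ 1 := by
    have ht : Tendsto (fun x : Euc n => ‖x - y‖) (𝓝 y) (𝓝 0) := by
      have : Continuous fun x : Euc n => ‖x - y‖ := by fun_prop
      simpa using this.tendsto y
    exact (Asymptotics.isLittleO_pow_pow (by norm_num : 1 < 2)).comp_tendsto ht
  simpa using h2

namespace C11Atlas

variable {m : ℕ} {Ω : Set (Euc (m + 1))}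

theorem norm_sub_sq_eq (𝒜 : C11Atlas Ω) (r : Fin 𝒜.M) (x y : Euc (m + 1)) :
    ‖x - y‖ ^ 2 = ‖(𝒜.A r x).fst - (𝒜.A r y).fst‖ ^ 2 +
      ((𝒜.A r x).snd - (𝒜.A r y).snd) ^ 2 := by
  have h : ‖x - y‖ = ‖𝒜.A r x - 𝒜.A r y‖ := by
    rw [← dist_eq_norm, ← dist_eq_norm, (𝒜.A r).dist_map]
  rw [h, WithLp.prod_norm_sq_eq_of_L2]
  simp [Real.norm_eq_abs, sq_abs]

theorem norm_fst_sub_le (𝒜 : C11Atlas Ω) (r : Fin 𝒜.M) (x y : Euc (m + 1)) :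
    ‖(𝒜.A r x).fst - (𝒜.A r y).fst‖ ≤ ‖x - y‖ := by
  refine le_of_sq_le_sq ?_ (norm_nonneg _)
  rw [𝒜.norm_sub_sq_eq r x y]
  nlinarith [sq_nonneg ((𝒜.A r x).snd - (𝒜.A r y).snd)]

theorem abs_snd_sub_le (𝒜 : C11Atlas Ω) (r : Fin 𝒜.M) (x y : Euc (m + 1)) :
    |(𝒜.A r x).snd - (𝒜.A r y).snd| ≤ ‖x - y‖ := by
  refine le_of_sq_le_sq ?_ (norm_nonneg _)
  rw [𝒜.norm_sub_sq_eq r x y, sq_abs]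
  nlinarith [sq_nonneg ‖(𝒜.A r x).fst - (𝒜.A r y).fst‖]

theorem norm_sub_le_add (𝒜 : C11Atlas Ω) (r : Fin 𝒜.M) (x y : Euc (m + 1)) :
    ‖x - y‖ ≤ ‖(𝒜.A r x).fst - (𝒜.A r y).fst‖ + |(𝒜.A r x).snd - (𝒜.A r y).snd| := by
  refine le_of_sq_le_sq ?_ (by positivity)
  rw [𝒜.norm_sub_sq_eq r x y, add_sq, sq_abs]
  have : 0 ≤ ‖(𝒜.A r x).fst - (𝒜.A r y).fst‖ * |(𝒜.A r x).snd - (𝒜.A r y).snd| := by positivity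
  nlinarith

/-- The point with given local coordinates. -/
noncomputable def pt (𝒜 : C11Atlas Ω) (r : Fin 𝒜.M) (w : Euc m) (s : ℝ) : Euc (m + 1) :=
  (𝒜.A r).symm (WithLp.toLp 2 (w, s))

@[simp] theorem fst_pt (𝒜 : C11Atlas Ω) (r : Fin 𝒜.M) (w : Euc m) (s : ℝ) :
    (𝒜.A r (𝒜.pt r w s)).fst = w := by simp [pt]

@[simp] theorem snd_pt (𝒜 : C11Atlas Ω) (r : Fin 𝒜.M) (w : Euc m) (s : ℝ) :
    (𝒜.A r (𝒜.pt r w s)).snd = s := by simp [pt]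

theorem pt_coords (𝒜 : C11Atlas Ω) (r : Fin 𝒜.M) (x : Euc (m + 1)) :
    𝒜.pt r (𝒜.A r x).fst (𝒜.A r x).snd = x := by
  unfold pt
  rw [AffineIsometryEquiv.symm_apply_eq]
  rfl

/-- The vertical direction of a coordinate system. -/
noncomputable def vert (𝒜 : C11Atlas Ω) (r : Fin 𝒜.M) : Euc (m + 1) :=
  (𝒜.A r).linearIsometryEquiv.symm (WithLp.toLp 2 (0, 1))

/-- The unit normal at a boundary point expressed by the graph function. -/
noncomputable def chartNormal (𝒜 : C11Atlas Ω) (r : Fin 𝒜.M) (w : Euc m) : Euc (m + 1) :=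
  (√(1 + ‖gradient (𝒜.φ r) w‖ ^ 2))⁻¹ •
    (𝒜.A r).linearIsometryEquiv.symm (WithLp.toLp 2 (gradient (𝒜.φ r) w, -1))

theorem linear_sub (𝒜 : C11Atlas Ω) (r : Fin 𝒜.M) (x y : Euc (m + 1)) :
    (𝒜.A r).linearIsometryEquiv (x - y) = 𝒜.A r x - 𝒜.A r y := by
  have := (𝒜.A r).map_vsub x y
  simpa using this

theorem inner_symm_toLp (𝒜 : C11Atlas Ω) (r : Fin 𝒜.M) (g : Euc m) (b : ℝ)
    (x y : Euc (m + 1)) :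
    inner ℝ ((𝒜.A r).linearIsometryEquiv.symm (WithLp.toLp 2 (g, b))) (x - y) =
      inner ℝ g ((𝒜.A r x).fst - (𝒜.A r y).fst) + b * ((𝒜.A r x).snd - (𝒜.A r y).snd) := by
  rw [← LinearIsometryEquiv.inner_map_map (𝒜.A r).linearIsometryEquiv,
    LinearIsometryEquiv.apply_symm_apply, linear_sub, WithLp.prod_inner_apply]
  simp [mul_comm]

theorem inner_chartNormal (𝒜 : C11Atlas Ω) (r : Fin 𝒜.M) (w : Euc m) (x y : Euc (m + 1)) :
    inner ℝ (𝒜.chartNormal r w) (x - y) = (√(1 + ‖gradient (𝒜.φ r) w‖ ^ 2))⁻¹ *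
      (inner ℝ (gradient (𝒜.φ r) w) ((𝒜.A r x).fst - (𝒜.A r y).fst) -
        ((𝒜.A r x).snd - (𝒜.A r y).snd)) := by
  rw [chartNormal, real_inner_smul_left, inner_symm_toLp]
  ring

theorem norm_chartNormal (𝒜 : C11Atlas Ω) (r : Fin 𝒜.M) (w : Euc m) :
    ‖𝒜.chartNormal r w‖ = 1 := by
  have h : ‖(WithLp.toLp 2 (gradient (𝒜.φ r) w, (-1 : ℝ)) : WithLp 2 (Euc m × ℝ))‖ =
      √(1 + ‖gradient (𝒜.φ r) w‖ ^ 2) := by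
    rw [WithLp.prod_norm_eq_of_L2]
    simp [add_comm]
  rw [chartNormal, norm_smul, LinearIsometryEquiv.norm_map, h, norm_inv, Real.norm_eq_abs,
    abs_of_nonneg (Real.sqrt_nonneg _)]
  refine inv_mul_cancel₀ ?_
  positivity

theorem norm_vert (𝒜 : C11Atlas Ω) (r : Fin 𝒜.M) : ‖𝒜.vert r‖ = 1 := by
  rw [vert, LinearIsometryEquiv.norm_map, WithLp.prod_norm_eq_of_L2]
  simp

theorem pt_sub_pt_vert (𝒜 : C11Atlas Ω) (r : Fin 𝒜.M) (w : Euc m) (s t : ℝ) :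
    𝒜.pt r w s - 𝒜.pt r w t = (s - t) • 𝒜.vert r := by
  apply (𝒜.A r).linearIsometryEquiv.injective
  rw [linear_sub, map_smul, vert, LinearIsometryEquiv.apply_symm_apply]
  simp only [pt, AffineIsometryEquiv.apply_symm_apply]
  rw [← WithLp.toLp_sub, ← WithLp.toLp_smul]
  simp

theorem inner_chartNormal_vert (𝒜 : C11Atlas Ω) (r : Fin 𝒜.M) (w : Euc m) :
    inner ℝ (𝒜.chartNormal r w) (𝒜.vert r) = -(√(1 + ‖gradient (𝒜.φ r) w‖ ^ 2))⁻¹ := by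
  have h := 𝒜.inner_chartNormal r w (𝒜.pt r w 1) (𝒜.pt r w 0)
  rw [pt_sub_pt_vert] at h
  simpa using h

theorem mem_U_cases (𝒜 : C11Atlas Ω) (r : Fin 𝒜.M) {x : Euc (m + 1)} (hx : x ∈ 𝒜.U r) :
    (𝒜.A r x).fst ∈ Metric.ball 0 𝒜.α ∧ |(𝒜.A r x).snd - 𝒜.φ r (𝒜.A r x).fst| < 𝒜.β ∧
    ((x ∈ Ω ∧ 𝒜.φ r (𝒜.A r x).fst < (𝒜.A r x).snd) ∨
      (x ∉ Ω ∧ (𝒜.A r x).snd ≤ 𝒜.φ r (𝒜.A r x).fst)) := by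
  have hβ := 𝒜.β_pos
  by_cases h1 : x ∈ Ω
  · have : x ∈ Ω ∩ 𝒜.U r := ⟨h1, hx⟩
    rw [𝒜.domain_inter r] at this
    obtain ⟨a, b, c⟩ := this
    exact ⟨a, by rw [abs_lt]; constructor <;> linarith, Or.inl ⟨h1, b⟩⟩
  by_cases h2 : x ∈ closure Ω
  · have : x ∈ frontier Ω ∩ 𝒜.U r := ⟨⟨h2, fun h => h1 (interior_subset h)⟩, hx⟩
    rw [𝒜.frontier_inter r] at this
    obtain ⟨a, b⟩ := this
    exact ⟨a, by simpa [b] using hβ, Or.inr ⟨h1, b.le⟩⟩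
  · have : x ∈ (closure Ω)ᶜ ∩ 𝒜.U r := ⟨h2, hx⟩
    rw [𝒜.exterior_inter r] at this
    obtain ⟨a, b, c⟩ := this
    exact ⟨a, by rw [abs_lt]; constructor <;> linarith, Or.inr ⟨h1, c.le⟩⟩

theorem pt_mem_frontier (𝒜 : C11Atlas Ω) (r : Fin 𝒜.M) {w : Euc m}
    (hw : w ∈ Metric.ball 0 𝒜.α) : 𝒜.pt r w (𝒜.φ r w) ∈ frontier Ω ∩ 𝒜.U r := by
  rw [𝒜.frontier_inter r]
  exact ⟨by simpa using hw, by simp⟩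

theorem snd_eq_of_mem_frontier (𝒜 : C11Atlas Ω) (r : Fin 𝒜.M) {x : Euc (m + 1)}
    (hx : x ∈ frontier Ω) (hU : x ∈ 𝒜.U r) :
    (𝒜.A r x).snd = 𝒜.φ r (𝒜.A r x).fst := by
  have : x ∈ frontier Ω ∩ 𝒜.U r := ⟨hx, hU⟩
  rw [𝒜.frontier_inter r] at this
  exact this.2

theorem exists_taylor (𝒜 : C11Atlas Ω) (r : Fin 𝒜.M) :
    ∃ L : ℝ, 0 ≤ L ∧ ∀ y ∈ Metric.ball 0 𝒜.α, ∀ w ∈ Metric.ball 0 𝒜.α,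
      |𝒜.φ r w - 𝒜.φ r y - inner ℝ (gradient (𝒜.φ r) y) (w - y)| ≤ L * ‖w - y‖ ^ 2 := by
  obtain ⟨L, hL⟩ := 𝒜.lipschitz_fderiv r
  refine ⟨L, L.2, fun y hy w hw => ?_⟩
  have hseg : segment ℝ y w ⊆ Metric.ball 0 𝒜.α := (convex_ball _ _).segment_subset hy hw
  have hd : ∀ z ∈ segment ℝ y w,
      HasFDerivWithinAt (𝒜.φ r) (fderiv ℝ (𝒜.φ r) z) (segment ℝ y w) z := fun z hz =>
    ((𝒜.differentiableOn r).differentiableAt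
      (Metric.isOpen_ball.mem_nhds (hseg hz))).hasFDerivAt.hasFDerivWithinAt
  have hb : ∀ z ∈ segment ℝ y w,
      ‖fderiv ℝ (𝒜.φ r) z - fderiv ℝ (𝒜.φ r) y‖ ≤ L * ‖w - y‖ := by
    intro z hz
    have h1 := hL.dist_le_mul z (hseg hz) y hy
    rw [dist_eq_norm, dist_eq_norm] at h1
    refine h1.trans (mul_le_mul_of_nonneg_left ?_ L.2)
    have h3 := dist_add_dist_of_mem_segment hz
    rw [dist_eq_norm, dist_eq_norm, dist_eq_norm, norm_sub_rev y z, norm_sub_rev y w] at h3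
    linarith [norm_nonneg (z - w)]
  have h2 := Convex.norm_image_sub_le_of_norm_hasFDerivWithin_le' hd hb (convex_segment y w)
    (left_mem_segment ℝ y w) (right_mem_segment ℝ y w)
  have h4 : fderiv ℝ (𝒜.φ r) y (w - y) = inner ℝ (gradient (𝒜.φ r) y) (w - y) := by
    rw [gradient, InnerProductSpace.toDual_symm_apply]
  rw [h4, Real.norm_eq_abs] at h2
  calc _ ≤ _ := h2
    _ = _ := by ring

theorem exists_gradient_le (𝒜 : C11Atlas Ω) (r : Fin 𝒜.M) :
    ∃ G : ℝ, 0 ≤ G ∧ ∀ w ∈ Metric.ball 0 𝒜.α, ‖gradient (𝒜.φ r) w‖ ≤ G := by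
  obtain ⟨L, hL⟩ := 𝒜.lipschitz_fderiv r
  have h0 : (0 : Euc m) ∈ Metric.ball (0 : Euc m) 𝒜.α := Metric.mem_ball_self 𝒜.α_pos
  refine ⟨‖fderiv ℝ (𝒜.φ r) 0‖ + L * 𝒜.α, by have := 𝒜.α_pos; positivity, fun w hw => ?_⟩
  rw [gradient, LinearIsometryEquiv.norm_map]
  have h1 := hL.dist_le_mul w hw 0 h0
  have h2 : (L : ℝ) * dist w 0 ≤ L * 𝒜.α := mul_le_mul_of_nonneg_left hw.le L.2
  rw [dist_eq_norm] at h1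
  linarith [norm_le_norm_add_norm_sub' (fderiv ℝ (𝒜.φ r) w) (fderiv ℝ (𝒜.φ r) 0)]

/-- By Taylor, boundary points z lie within L|z - y|² of the tangent plane at y. Applied to the
point nearest to x, which is at most 2|x - y| from y, this bounds |n·(x - y)| by |d(x)| + 4L|x -
y|². Conversely, going from x to the tangent plane and then vertically to the graph reaches Γ, which
bounds |d(x)|. The ball of twice the radius keeps the nearest point in the chart. -/
theorem exists_chart_second_order (𝒜 : C11Atlas Ω) (r : Fin 𝒜.M) :
    ∃ C : ℝ, 0 ≤ C ∧ ∀ y ∈ frontier Ω, ∀ ρ > 0, Metric.ball y (2 * ρ) ⊆ 𝒜.U r →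
      ∀ x ∈ Metric.ball y ρ,
        |sgnDist Ω x - inner ℝ (𝒜.chartNormal r (𝒜.A r y).fst) (x - y)| ≤ C * ‖x - y‖ ^ 2 := by
  obtain ⟨L, hL0, hL⟩ := 𝒜.exists_taylor r
  refine ⟨4 * L, by positivity, fun y hy ρ hρ hsub x hx => ?_⟩
  have hyU : y ∈ 𝒜.U r := hsub (Metric.mem_ball_self (by linarith))
  have hyΔ := (𝒜.mem_U_cases r hyU).1
  set y' := (𝒜.A r y).fst with hy'
  set ν := 𝒜.chartNormal r y' with hν
  set q := √(1 + ‖gradient (𝒜.φ r) y'‖ ^ 2) with hq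
  have hq1 : 1 ≤ q := by
    rw [hq]; apply Real.one_le_sqrt.2; nlinarith [sq_nonneg ‖gradient (𝒜.φ r) y'‖]
  have hq0 : 0 < q := by linarith
  have hqi : q⁻¹ ≤ 1 := inv_le_one_of_one_le₀ hq1
  have hqi0 : 0 < q⁻¹ := inv_pos.2 hq0
  set t := inner ℝ ν (x - y) with ht
  set D := ‖x - y‖ with hD
  have hxD : D < ρ := by rw [hD, ← dist_eq_norm]; exact hx
  have hD0 : 0 ≤ D := norm_nonneg _
  have hν1 : ‖ν‖ = 1 := 𝒜.norm_chartNormal r y'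
  have hyN : (𝒜.A r y).snd = 𝒜.φ r y' := 𝒜.snd_eq_of_mem_frontier r hy hyU
  -- points of the boundary are close to the tangent plane
  have ha : ∀ z ∈ frontier Ω, z ∈ 𝒜.U r → |inner ℝ ν (z - y)| ≤ L * ‖z - y‖ ^ 2 := by
    intro z hz hzU
    rw [hν, 𝒜.inner_chartNormal, 𝒜.snd_eq_of_mem_frontier r hz hzU, hyN, abs_mul,
      abs_of_pos hqi0, abs_sub_comm]
    have h1 := hL y' hyΔ _ (𝒜.mem_U_cases r hzU).1
    have h2 : L * ‖(𝒜.A r z).fst - y'‖ ^ 2 ≤ L * ‖z - y‖ ^ 2 := by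
      have := 𝒜.norm_fst_sub_le r z y
      gcongr
    calc _ ≤ 1 * _ := mul_le_mul_of_nonneg_right hqi (abs_nonneg _)
      _ ≤ _ := by rw [one_mul]; exact h1.trans h2
  have hne : (frontier Ω).Nonempty := ⟨y, hy⟩
  have hb : |t| ≤ |sgnDist Ω x| + 4 * L * D ^ 2 := by
    obtain ⟨z, hz, hzd⟩ := exists_mem_frontier_dist_eq hne x
    have h1 : dist x z ≤ D := by
      rw [hzd, hD, ← dist_eq_norm]; exact abs_sgnDist_le_dist x hy
    have h2 : ‖z - y‖ ≤ 2 * D := by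
      have := norm_sub_le_norm_sub_add_norm_sub z x y
      rw [← dist_eq_norm z x, dist_comm] at this
      linarith
    have hzU : z ∈ 𝒜.U r := hsub (by rw [Metric.mem_ball, dist_eq_norm]; linarith)
    have h3 := ha z hz hzU
    have h4 : |inner ℝ ν (x - z)| ≤ dist x z := by
      have := abs_real_inner_le_norm ν (x - z)
      rwa [hν1, one_mul, ← dist_eq_norm] at this
    have h5 : t = inner ℝ ν (x - z) + inner ℝ ν (z - y) := by
      rw [ht, ← inner_add_right]; congr 1; abel
    have h6 : L * ‖z - y‖ ^ 2 ≤ L * (2 * D) ^ 2 := by gcongr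
    rw [← hzd, h5]
    refine (abs_add_le _ _).trans ?_
    nlinarith
  have hc : |sgnDist Ω x| ≤ |t| + L * D ^ 2 := by
    set w := x - t • ν with hw
    have hwy : w - y = (x - y) - t • ν := by rw [hw]; abel
    have hνw : inner ℝ ν (w - y) = 0 := by
      rw [hwy, inner_sub_right, inner_smul_right, real_inner_self_eq_norm_sq, hν1, ← ht]; ring
    have hwD : ‖w - y‖ ≤ D := by
      refine le_of_sq_le_sq ?_ hD0
      rw [hwy, norm_sub_sq_real, inner_smul_right, real_inner_comm, ← ht, norm_smul, hν1,
        Real.norm_eq_abs, mul_one, sq_abs]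
      nlinarith [sq_nonneg t]
    have hwU : w ∈ 𝒜.U r := hsub (by rw [Metric.mem_ball, dist_eq_norm]; linarith)
    have hwΔ := (𝒜.mem_U_cases r hwU).1
    have hz := (𝒜.pt_mem_frontier r hwΔ).1
    set z := 𝒜.pt r (𝒜.A r w).fst (𝒜.φ r (𝒜.A r w).fst) with hzdef
    have h1 : ‖w - z‖ ≤ L * D ^ 2 := by
      have e : w - z = ((𝒜.A r w).snd - 𝒜.φ r (𝒜.A r w).fst) • 𝒜.vert r := by
        rw [← 𝒜.pt_sub_pt_vert r (𝒜.A r w).fst, 𝒜.pt_coords]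
      rw [e, norm_smul, 𝒜.norm_vert, mul_one, Real.norm_eq_abs, abs_sub_comm]
      have h2 := hL y' hyΔ _ hwΔ
      rw [hν, 𝒜.inner_chartNormal, mul_eq_zero, or_iff_right hqi0.ne', hyN] at hνw
      have h3 : inner ℝ (gradient (𝒜.φ r) y') ((𝒜.A r w).fst - y') =
        (𝒜.A r w).snd - 𝒜.φ r y' := by linarith
      rw [h3] at h2
      have h4 : L * ‖(𝒜.A r w).fst - y'‖ ^ 2 ≤ L * D ^ 2 := by
        have := (𝒜.norm_fst_sub_le r w y).trans hwD
        gcongr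
      refine le_trans (le_of_eq ?_) (h2.trans h4)
      congr 1; ring
    have h2 : ‖x - w‖ = |t| := by
      rw [hw, sub_sub_cancel, norm_smul, hν1, mul_one, Real.norm_eq_abs]
    have h3 := abs_sgnDist_le_dist x hz
    rw [dist_eq_norm] at h3
    linarith [norm_sub_le_norm_sub_add_norm_sub x w z]
  have hxU : x ∈ 𝒜.U r := hsub (Metric.ball_subset_ball (by linarith) hx)
  obtain ⟨hxΔ, -, hcase⟩ := 𝒜.mem_U_cases r hxU
  have hR : |𝒜.φ r (𝒜.A r x).fst - (𝒜.A r x).snd - q * t| ≤ L * D ^ 2 := by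
    have h1 := hL y' hyΔ _ hxΔ
    have h2 : L * ‖(𝒜.A r x).fst - y'‖ ^ 2 ≤ L * D ^ 2 := by
      have := 𝒜.norm_fst_sub_le r x y
      gcongr
    have h3 : q * t = inner ℝ (gradient (𝒜.φ r) y') ((𝒜.A r x).fst - y') -
        ((𝒜.A r x).snd - 𝒜.φ r y') := by
      rw [ht, hν, 𝒜.inner_chartNormal, hyN, ← mul_assoc, mul_inv_cancel₀ hq0.ne', one_mul]
    refine le_trans (le_of_eq ?_) (h1.trans h2)
    rw [h3]; congr 1; ring
  obtain ⟨hR1, hR2⟩ := abs_le.1 hR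
  have hLD : 0 ≤ L * D ^ 2 := by positivity
  -- The absolute values agree up to O(D²); the signs remain. The side of the graph fixes the sign
  -- of d, and by `hR` it nearly fixes that of t: if the two signs disagree, t and d are both O(D²).
  rcases hcase with ⟨hxΩ, hlt⟩ | ⟨hxΩ, hle⟩
  · have hd : sgnDist Ω x = -|sgnDist Ω x| := by
      rw [abs_sgnDist]; exact sgnDist_of_mem hxΩ
    have hp := abs_nonneg (sgnDist Ω x)
    generalize |sgnDist Ω x| = δ at *
    rw [hd]
    rcases le_total t 0 with h | h
    · rw [abs_of_nonpos h] at hb hc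
      rw [abs_le]; constructor <;> linarith
    · have : t ≤ q * t := le_mul_of_one_le_left h hq1
      rw [abs_of_nonneg h] at hb hc
      rw [abs_le]; constructor <;> linarith
  · have hd : sgnDist Ω x = |sgnDist Ω x| := by
      rw [abs_sgnDist]; exact sgnDist_of_notMem hxΩ
    have hp := abs_nonneg (sgnDist Ω x)
    generalize |sgnDist Ω x| = δ at *
    rw [hd]
    rcases le_total t 0 with h | h
    · have : q * t ≤ t := by nlinarith
      rw [abs_of_nonpos h] at hb hc
      rw [abs_le]; constructor <;> linarith
    · rw [abs_of_nonneg h] at hb hc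
      rw [abs_le]; constructor <;> linarith

/-- `gradient` has the default value 0 where d is not differentiable. The quadratic bound proves
differentiability at boundary points, so `outerNormal` is a genuine unit vector there. -/
theorem outerNormal_eq_chartNormal (𝒜 : C11Atlas Ω) (r : Fin 𝒜.M) {y : Euc (m + 1)}
    (hy : y ∈ frontier Ω) (hU : y ∈ 𝒜.U r) :
    outerNormal Ω y = 𝒜.chartNormal r (𝒜.A r y).fst := by
  obtain ⟨C, -, hC⟩ := 𝒜.exists_chart_second_order r
  obtain ⟨ε, hε, hsub⟩ := Metric.isOpen_iff.1 (𝒜.isOpen_U r) y hU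
  have h := hC y hy (ε / 2) (by linarith) (by rwa [mul_div_cancel₀ _ (two_ne_zero)])
  refine (hasGradientAt_of_abs_sub_le_sq (C := C) (half_pos hε) fun x hx => ?_).gradient
  simpa [sgnDist_of_mem_frontier hy] using h x hx

theorem norm_outerNormal (𝒜 : C11Atlas Ω) {y : Euc (m + 1)} (hy : y ∈ frontier Ω) :
    ‖outerNormal Ω y‖ = 1 := by
  obtain ⟨r, hr⟩ := mem_iUnion.1 (𝒜.frontier_subset hy)
  rw [𝒜.outerNormal_eq_chartNormal r hy hr, 𝒜.norm_chartNormal]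

theorem exists_lebesgue_number (𝒜 : C11Atlas Ω) (hb : Bornology.IsBounded Ω) :
    ∃ ε > 0, ∀ y ∈ frontier Ω, ∃ r, Metric.ball y ε ⊆ 𝒜.U r :=
  lebesgue_number_lemma_of_metric (isCompact_frontier_of_isBounded hb) 𝒜.isOpen_U
    𝒜.frontier_subset

theorem exists_second_order (𝒜 : C11Atlas Ω) (hb : Bornology.IsBounded Ω) :
    ∃ C : ℝ, 0 < C ∧ ∀ y ∈ frontier Ω, ∀ x,
      |sgnDist Ω x - inner ℝ (outerNormal Ω y) (x - y)| ≤ C * ‖x - y‖ ^ 2 := by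
  obtain ⟨ε, hε, hsub⟩ := 𝒜.exists_lebesgue_number hb
  choose C hC0 hC using fun r => 𝒜.exists_chart_second_order r
  have hε2 : 0 < 2 / (ε / 2) := by positivity
  refine ⟨∑ r, C r + 2 / (ε / 2), add_pos_of_nonneg_of_pos
    (Finset.sum_nonneg fun r _ => hC0 r) hε2, fun y hy x => ?_⟩
  by_cases hx : ‖x - y‖ < ε / 2
  · obtain ⟨r, hr⟩ := hsub y hy
    have hyU : y ∈ 𝒜.U r := hr (Metric.mem_ball_self hε)
    rw [𝒜.outerNormal_eq_chartNormal r hy hyU]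
    refine (hC r y hy (ε / 2) (by linarith) (by rwa [mul_div_cancel₀ _ (two_ne_zero)]) x
      (by rwa [Metric.mem_ball, dist_eq_norm])).trans ?_
    gcongr
    have := Finset.single_le_sum (fun i _ => hC0 i) (Finset.mem_univ r)
    linarith
  -- Away from y no geometry is needed: both terms are at most |x - y|, which is bounded by a
  -- multiple of |x - y|² once |x - y| ≥ ε/2.
  · push Not at hx
    have h1 := abs_sgnDist_le_dist x hy
    have h2 := abs_real_inner_le_norm (outerNormal Ω y) (x - y)
    rw [𝒜.norm_outerNormal hy, one_mul] at h2
    rw [dist_eq_norm] at h1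
    have h3 : 2 * ‖x - y‖ ≤ 2 / (ε / 2) * ‖x - y‖ ^ 2 := by
      rw [div_mul_eq_mul_div, le_div_iff₀ (by positivity)]
      nlinarith [norm_nonneg (x - y)]
    have h4 : 0 ≤ (∑ r, C r) * ‖x - y‖ ^ 2 :=
      mul_nonneg (Finset.sum_nonneg fun r _ => hC0 r) (by positivity)
    calc _ ≤ |sgnDist Ω x| + |inner ℝ (outerNormal Ω y) (x - y)| := abs_sub _ _
      _ ≤ _ := by linarith

/-- The gradients of the finitely many graph functions are bounded, so normals are uniformly
transversal to the vertical direction of their chart. The constant c controls all later vertical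
estimates. -/
theorem exists_abs_inner_vert_ge (𝒜 : C11Atlas Ω) :
    ∃ c : ℝ, 0 < c ∧ ∀ r, ∀ y ∈ frontier Ω, y ∈ 𝒜.U r →
      c ≤ |inner ℝ (outerNormal Ω y) (𝒜.vert r)| := by
  choose G hG0 hG using fun r => 𝒜.exists_gradient_le r
  have hS0 : 0 ≤ ∑ r, G r := Finset.sum_nonneg fun r _ => hG0 r
  refine ⟨(√(1 + (∑ r, G r) ^ 2))⁻¹, by positivity, fun r y hy hU => ?_⟩
  rw [𝒜.outerNormal_eq_chartNormal r hy hU, inner_chartNormal_vert, abs_neg,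
    abs_of_nonneg (by positivity)]
  have h1 := hG r _ (𝒜.mem_U_cases r hU).1
  have h2 := Finset.single_le_sum (fun i _ => hG0 i) (Finset.mem_univ r)
  gcongr
  exact h1.trans h2

end C11Atlas

/-! ### The tubular neighbourhood of the boundary -/

/-- `Ω` has a field of unit normals for which the signed distance has the second order expansion
`d(x) = n(y) ⬝ (x - y) + O(|x - y|²)` at the boundary points `y`. -/
structure HasSecondOrderNormal {n : ℕ} (Ω : Set (Euc n)) (C : ℝ) : Prop where
  C_pos : 0 < C
  nonempty : (frontier Ω).Nonempty
  norm_normal : ∀ y ∈ frontier Ω, ‖outerNormal Ω y‖ = 1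
  expansion : ∀ y ∈ frontier Ω, ∀ x,
    |sgnDist Ω x - inner ℝ (outerNormal Ω y) (x - y)| ≤ C * ‖x - y‖ ^ 2

theorem inner_eq_one_sub_of_norm_eq_one {n : ℕ} {u v : Euc n} (hu : ‖u‖ = 1) (hv : ‖v‖ = 1) :
    inner ℝ u v = 1 - ‖u - v‖ ^ 2 / 2 := by
  rw [norm_sub_sq_real, hu, hv]; ring

namespace HasSecondOrderNormal

variable {n : ℕ} {Ω : Set (Euc n)} {C : ℝ}

theorem abs_inner_le (h : HasSecondOrderNormal Ω C) {y z : Euc n} (hy : y ∈ frontier Ω)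
    (hz : z ∈ frontier Ω) : |inner ℝ (outerNormal Ω y) (z - y)| ≤ C * ‖z - y‖ ^ 2 := by
  have := h.expansion y hy z
  rwa [sgnDist_of_mem_frontier hz, zero_sub, abs_neg] at this

/-- Compare the expansions at y and at z in one test point y + p, with p parallel to n(y) - n(z) and
of length |y - z|. The errors are C, 4C and C times |y - z|², the last from n(z)·(y - z); hence 6C.
-/
theorem norm_normal_sub_le (h : HasSecondOrderNormal Ω C) {y z : Euc n} (hy : y ∈ frontier Ω)
    (hz : z ∈ frontier Ω) : ‖outerNormal Ω y - outerNormal Ω z‖ ≤ 6 * C * ‖y - z‖ := by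
  set w := outerNormal Ω y - outerNormal Ω z with hw
  set r := ‖y - z‖ with hr
  have hC := h.C_pos
  rcases eq_or_ne y z with rfl | hne
  · simp [hw, hr]
  have hr0 : 0 < r := norm_pos_iff.2 (sub_ne_zero.2 hne)
  rcases eq_or_ne w 0 with h0 | h0
  · rw [h0, norm_zero]; positivity
  have hw0 : 0 < ‖w‖ := norm_pos_iff.2 h0
  set p := (r / ‖w‖) • w with hp
  have hpn : ‖p‖ = r := by
    rw [hp, norm_smul, Real.norm_eq_abs, abs_of_pos (by positivity)]; field_simp
  have e1 := h.expansion y hy (y + p)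
  have e2 := h.expansion z hz (y + p)
  have e3 := h.abs_inner_le hz hy
  rw [add_sub_cancel_left, hpn] at e1
  have hp2 : ‖y + p - z‖ ≤ 2 * r := by
    have : y + p - z = (y - z) + p := by abel
    rw [this]; linarith [norm_add_le (y - z) p]
  have e4 : C * ‖y + p - z‖ ^ 2 ≤ C * (2 * r) ^ 2 := by gcongr
  have e5 : inner ℝ w p = r * ‖w‖ := by
    rw [hp, inner_smul_right, real_inner_self_eq_norm_sq]; field_simp
  have e6 : inner ℝ (outerNormal Ω z) (y + p - z) =
      inner ℝ (outerNormal Ω z) (y - z) + inner ℝ (outerNormal Ω z) p := by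
    rw [← inner_add_right]; congr 1; abel
  rw [hw, inner_sub_left] at e5
  rw [e6] at e2
  rw [abs_le] at e1 e2 e3
  have e7 : r * ‖w‖ ≤ r * (6 * C * r) := by nlinarith
  exact le_of_mul_le_mul_left e7 hr0

/-- Take y nearest to x. Along the segment from y to x the signed distance is linear, so the
expansion divided by τ gives d(x) = n(y)·(x - y) as τ → 0. Since |x - y| = |d(x)| and |n(y)| = 1,
this is the equality case of Cauchy–Schwarz and x - y = d(x) n(y). No smallness of d is needed for
existence. -/
theorem exists_isOrthProj (h : HasSecondOrderNormal Ω C) (x : Euc n) :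
    ∃ y, IsOrthProj Ω x y := by
  obtain ⟨y, hy, hxy⟩ := exists_mem_frontier_dist_eq h.nonempty x
  refine ⟨y, hy, ?_⟩
  rw [dist_eq_norm] at hxy
  set nn := outerNormal Ω y with hnn
  by_cases h0 : sgnDist Ω x = 0
  · rw [h0, abs_zero, norm_eq_zero, sub_eq_zero] at hxy
    rw [h0, zero_smul, add_zero, hxy]
  have hpos : 0 < |sgnDist Ω x| := abs_pos.2 h0
  have habs : ∀ τ : ℝ, 0 ≤ τ → τ ≤ 1 →
      |sgnDist Ω (y + τ • (x - y))| = τ * |sgnDist Ω x| := by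
    intro τ h0 h1
    apply le_antisymm
    · have := abs_sgnDist_le_dist (y + τ • (x - y)) hy
      rwa [dist_eq_norm, add_sub_cancel_left, norm_smul, hxy, Real.norm_eq_abs,
        abs_of_nonneg h0] at this
    · have h2 := abs_sgnDist_sub_le Ω x (y + τ • (x - y))
      have h3 : x - (y + τ • (x - y)) = (1 - τ) • (x - y) := by module
      rw [dist_eq_norm, h3, norm_smul, hxy, Real.norm_eq_abs,
        abs_of_nonneg (a := 1 - τ) (by linarith)] at h2
      have h4 := abs_sub_abs_le_abs_sub (sgnDist Ω x) (sgnDist Ω (y + τ • (x - y)))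
      linarith
  have hray : ∀ τ : ℝ, 0 < τ → τ ≤ 1 → sgnDist Ω (y + τ • (x - y)) = τ * sgnDist Ω x := by
    intro τ h0 h1
    have hseg : ∀ w ∈ segment ℝ (y + τ • (x - y)) x, w ∉ frontier Ω := by
      intro w hw hwf
      rw [segment_eq_image'] at hw
      obtain ⟨θ, ⟨hθ0, hθ1⟩, rfl⟩ := hw
      have e : (fun θ : ℝ => y + τ • (x - y) + θ • (x - (y + τ • (x - y)))) θ =
          y + (τ + θ * (1 - τ)) • (x - y) := by
        simp only; module
      rw [e] at hwf
      have h2 := habs (τ + θ * (1 - τ)) (by nlinarith) (by nlinarith)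
      rw [sgnDist_of_mem_frontier hwf, abs_zero] at h2
      have : 0 < (τ + θ * (1 - τ)) * |sgnDist Ω x| := by
        apply mul_pos _ hpos; nlinarith
      linarith
    have hiff := mem_iff_mem_of_segment hseg
    have h2 := habs τ h0.le h1
    rw [abs_sgnDist, abs_sgnDist] at h2
    by_cases hx : x ∈ Ω
    · rw [sgnDist_of_mem hx, sgnDist_of_mem (hiff.2 hx), h2]; ring
    · rw [sgnDist_of_notMem hx, sgnDist_of_notMem (mt hiff.1 hx), h2]
  have hkey : sgnDist Ω x = inner ℝ nn (x - y) := by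
    have hle : ∀ τ : ℝ, 0 < τ → τ ≤ 1 →
        |sgnDist Ω x - inner ℝ nn (x - y)| ≤ τ * (C * ‖x - y‖ ^ 2) := by
      intro τ h0 h1
      have := h.expansion y hy (y + τ • (x - y))
      rw [hray τ h0 h1, add_sub_cancel_left, inner_smul_right, ← mul_sub, abs_mul, abs_of_pos h0,
        norm_smul, Real.norm_eq_abs, abs_of_pos h0] at this
      refine le_of_mul_le_mul_left ?_ h0
      calc _ ≤ _ := this
        _ = _ := by ring
    by_contra hne
    have hp : 0 < |sgnDist Ω x - inner ℝ nn (x - y)| := abs_pos.2 (sub_ne_zero.2 hne)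
    set e := |sgnDist Ω x - inner ℝ nn (x - y)| with he
    set B := C * ‖x - y‖ ^ 2 with hB
    have hB0 : 0 ≤ B := mul_nonneg h.C_pos.le (by positivity)
    -- This τ makes τB at most e/2, which replaces the limit τ → 0.
    have h1 := hle (min 1 (e / (2 * (B + 1)))) (by positivity) (min_le_left _ _)
    have h2 : min 1 (e / (2 * (B + 1))) * B ≤ e / (2 * (B + 1)) * (B + 1) := by
      gcongr
      · exact min_le_right _ _
      · linarith
    have h3 : e / (2 * (B + 1)) * (B + 1) = e / 2 := by field_simp
    linarith
  have hz : ‖x - y - sgnDist Ω x • nn‖ ^ 2 = 0 := by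
    rw [norm_sub_sq_real, inner_smul_right, real_inner_comm, ← hkey, norm_smul, hxy,
      h.norm_normal y hy, Real.norm_eq_abs, mul_one, sq_abs]
    ring
  rw [sq_eq_zero_iff, norm_eq_zero, sub_eq_zero] at hz
  rw [← hz]; abel

/-- Two projections differ by d(x) times the difference of their normals. In the tube |d|·6C is at
most 1/2, so the distance between them is at most half of itself. -/
theorem isOrthProj_unique (h : HasSecondOrderNormal Ω C) {x y z : Euc n}
    (hx : x ∈ tube Ω (12 * C)⁻¹) (hy : IsOrthProj Ω x y) (hz : IsOrthProj Ω x z) : y = z := by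
  have hC := h.C_pos
  have h1 := h.norm_normal_sub_le hy.1 hz.1
  have h2 : y - z = -(sgnDist Ω x • (outerNormal Ω y - outerNormal Ω z)) := by
    have := hy.2.symm.trans hz.2
    rw [smul_sub, neg_sub, sub_eq_sub_iff_add_eq_add, add_comm (sgnDist Ω x • _), this, add_comm]
  have h3 : ‖y - z‖ ≤ (12 * C)⁻¹ * (6 * C * ‖y - z‖) := by
    nth_rw 1 [h2]
    rw [norm_neg, norm_smul, Real.norm_eq_abs]
    exact mul_le_mul (le_of_lt hx) h1 (norm_nonneg _) (by positivity)
  have h4 : (12 * C)⁻¹ * (6 * C * ‖y - z‖) = ‖y - z‖ / 2 := by field_simp; ring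
  rw [h4] at h3
  have : ‖y - z‖ = 0 := by linarith [norm_nonneg (y - z)]
  rwa [norm_eq_zero, sub_eq_zero] at this

end HasSecondOrderNormal

/-- `π` and `ν` are continuous extensions of the orthogonal projection onto the boundary of `Ω`,
and of the normal at the projected point, from the tubular neighbourhood of width `δ`. -/
structure IsNormalTube {n : ℕ} (Ω : Set (Euc n)) (L δ : ℝ) (π ν : Euc n → Euc n) : Prop where
  L_pos : 0 < L
  δ_pos : 0 < δ
  δ_mul_L : δ * L ≤ 1 / 2
  nonempty : (frontier Ω).Nonempty
  continuous_π : Continuous π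
  continuous_ν : Continuous ν
  isOrthProj : ∀ x ∈ tube Ω δ, IsOrthProj Ω x (π x)
  isOrthProj_unique : ∀ x ∈ tube Ω δ, ∀ y, IsOrthProj Ω x y → y = π x
  ν_eq : ∀ x ∈ tube Ω δ, ν x = outerNormal Ω (π x)
  norm_normal : ∀ y ∈ frontier Ω, ‖outerNormal Ω y‖ = 1
  norm_normal_sub_le : ∀ y ∈ frontier Ω, ∀ z ∈ frontier Ω,
    ‖outerNormal Ω y - outerNormal Ω z‖ ≤ L * ‖y - z‖
  norm_π_sub_le : ∀ x ∈ tube Ω δ, ∀ z ∈ tube Ω δ, ‖π x - π z‖ ≤ 4 * ‖x - z‖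
  expansion : ∀ y ∈ frontier Ω, ∀ x,
    |sgnDist Ω x - inner ℝ (outerNormal Ω y) (x - y)| ≤ L * ‖x - y‖ ^ 2
  expansion_tube : ∀ x ∈ tube Ω δ, ∀ z ∈ tube Ω δ,
    |sgnDist Ω x - sgnDist Ω z - inner ℝ (ν z) (x - z)| ≤ L * ‖π x - π z‖ ^ 2
  normal_line : ∀ y ∈ frontier Ω, ∀ s : ℝ, |s| < δ →
    π (y + s • outerNormal Ω y) = y ∧ sgnDist Ω (y + s • outerNormal Ω y) = s

theorem HasSecondOrderNormal.exists_isNormalTube {n : ℕ} {Ω : Set (Euc n)} {C : ℝ}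
    (h : HasSecondOrderNormal Ω C) : ∃ π ν, IsNormalTube Ω (6 * C) (12 * C)⁻¹ π ν := by
  have hC := h.C_pos
  set δ := (12 * C)⁻¹ with hδ
  have hδ0 : 0 < δ := by positivity
  have hδL : δ * (6 * C) = 1 / 2 := by rw [hδ]; field_simp; norm_num
  choose P hP using h.exists_isOrthProj
  have hlipP : ∀ x ∈ tube Ω δ, ∀ z ∈ tube Ω δ, ‖P x - P z‖ ≤ 4 * ‖x - z‖ := by
    intro x hx z hz
    have h1 := h.norm_normal_sub_le (hP x).1 (hP z).1
    have h2 : P x - P z = (x - z) - (sgnDist Ω x - sgnDist Ω z) • outerNormal Ω (P x) -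
        sgnDist Ω z • (outerNormal Ω (P x) - outerNormal Ω (P z)) := by
      have e1 : P x = x - sgnDist Ω x • outerNormal Ω (P x) := eq_sub_of_add_eq (hP x).2.symm
      have e2 : P z = z - sgnDist Ω z • outerNormal Ω (P z) := eq_sub_of_add_eq (hP z).2.symm
      have e3 : ∀ a b : Euc n, (x - sgnDist Ω x • a) - (z - sgnDist Ω z • b) =
        (x - z) - (sgnDist Ω x - sgnDist Ω z) • a - sgnDist Ω z • (a - b) := by
        intro a b; module
      rw [← e3, ← e1, ← e2]
    have h3 : ‖(sgnDist Ω x - sgnDist Ω z) • outerNormal Ω (P x)‖ ≤ ‖x - z‖ := by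
      rw [norm_smul, h.norm_normal _ (hP x).1, mul_one, Real.norm_eq_abs, ← dist_eq_norm]
      exact abs_sgnDist_sub_le Ω x z
    have h4 : ‖sgnDist Ω z • (outerNormal Ω (P x) - outerNormal Ω (P z))‖ ≤ ‖P x - P z‖ / 2 := by
      rw [norm_smul, Real.norm_eq_abs]
      calc _ ≤ δ * (6 * C * ‖P x - P z‖) :=
            mul_le_mul (le_of_lt hz) h1 (norm_nonneg _) hδ0.le
        _ = _ := by rw [← mul_assoc, hδL]; ring
    have h5 : ‖P x - P z‖ ≤ ‖x - z‖ + ‖x - z‖ + ‖P x - P z‖ / 2 := by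
      nth_rw 1 [h2]
      exact (norm_sub_le _ _).trans (add_le_add ((norm_sub_le _ _).trans (by gcongr)) h4)
    linarith
  have hL1 : LipschitzOnWith 4 P (tube Ω δ) := LipschitzOnWith.of_dist_le_mul fun x hx z hz => by
    simpa [dist_eq_norm] using hlipP x hx z hz
  have hL2 : LipschitzOnWith (Real.toNNReal (24 * C)) (fun x => outerNormal Ω (P x))
      (tube Ω δ) := LipschitzOnWith.of_dist_le_mul fun x hx z hz => by
    rw [Real.coe_toNNReal _ (by positivity), dist_eq_norm, dist_eq_norm]
    calc _ ≤ _ := h.norm_normal_sub_le (hP x).1 (hP z).1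
      _ ≤ 6 * C * (4 * ‖x - z‖) := by gcongr; exact hlipP x hx z hz
      _ = _ := by ring
  -- Extension to the whole space makes π and ν globally continuous, hence measurable; only their
  -- values in the tube carry meaning.
  obtain ⟨π, hπ, hπP⟩ := hL1.extend_finite_dimension
  obtain ⟨ν, hν, hνP⟩ := hL2.extend_finite_dimension
  -- Two unit normals have inner product 1 minus half the squared norm of their difference. Their
  -- failure to be parallel therefore contributes only quadratically in |y - z|.
  have hd2 : ∀ y ∈ frontier Ω, ∀ z ∈ frontier Ω, ∀ s : ℝ, |s| < δ →
      |s * (‖outerNormal Ω y - outerNormal Ω z‖ ^ 2 / 2)| ≤ 3 / 2 * C * ‖y - z‖ ^ 2 := by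
    intro y hy z hz s hs
    have h1 := h.norm_normal_sub_le hy hz
    have h2 : ‖outerNormal Ω y - outerNormal Ω z‖ ^ 2 ≤ (6 * C * ‖y - z‖) ^ 2 := by gcongr
    rw [abs_mul, abs_of_nonneg (a := ‖outerNormal Ω y - outerNormal Ω z‖ ^ 2 / 2) (by positivity)]
    calc _ ≤ δ * ((6 * C * ‖y - z‖) ^ 2 / 2) := by gcongr
      _ = (δ * (6 * C)) * (6 * C) * ‖y - z‖ ^ 2 / 2 := by ring
      _ = _ := by rw [hδL]; ring
  refine ⟨π, ν, by positivity, hδ0, hδL.le, h.nonempty, hπ.continuous, hν.continuous, ?_, ?_, ?_,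
    h.norm_normal, fun y hy z hz => h.norm_normal_sub_le hy hz, ?_, ?_, ?_, ?_⟩
  · intro x hx
    rw [← hπP hx]; exact hP x
  · intro x hx y hy
    rw [← hπP hx]; exact h.isOrthProj_unique hx hy (hP x)
  · intro x hx
    rw [← hπP hx, ← hνP hx]
  · intro x hx z hz
    rw [← hπP hx, ← hπP hz]; exact hlipP x hx z hz
  · intro y hy x
    refine (h.expansion y hy x).trans ?_
    gcongr; linarith
  · intro x hx z hz
    rw [← hπP hx, ← hπP hz, ← hνP hz]
    have e0 : x - z = (P x - P z) + sgnDist Ω x • outerNormal Ω (P x) -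
        sgnDist Ω z • outerNormal Ω (P z) := by
      have e1 := (hP x).2
      have e2 := (hP z).2
      nth_rw 1 [e1, e2]; abel
    have e3 : inner ℝ (outerNormal Ω (P z)) (x - z) =
        inner ℝ (outerNormal Ω (P z)) (P x - P z) + sgnDist Ω x -
        sgnDist Ω x * (‖outerNormal Ω (P x) - outerNormal Ω (P z)‖ ^ 2 / 2) - sgnDist Ω z := by
      rw [e0, inner_sub_right, inner_add_right, inner_smul_right, inner_smul_right,
        real_inner_self_eq_norm_sq, h.norm_normal _ (hP z).1, real_inner_comm (outerNormal Ω (P x)),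
        inner_eq_one_sub_of_norm_eq_one (h.norm_normal _ (hP x).1) (h.norm_normal _ (hP z).1)]
      ring
    have e4 := h.abs_inner_le (hP z).1 (hP x).1
    have e5 := hd2 _ (hP x).1 _ (hP z).1 _ hx
    have e6 : 0 ≤ C * ‖P x - P z‖ ^ 2 := by positivity
    rw [e3]
    rw [abs_le] at e4 e5 ⊢
    constructor <;> linarith
  -- With z the projection of y + s n(y) and d its signed distance, the expansion gives |d - s| ≤
  -- (5/2)C|y - z|², while |y - z| ≤ 2|d - s|. So |y - z| ≤ 5C|y - z|², and since |y - z| ≤ 2δ =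
  -- 1/(6C) this forces y = z and then d = s.
  · intro y hy s hs
    set x := y + s • outerNormal Ω y with hx
    have hds : |sgnDist Ω x| ≤ |s| := by
      have := abs_sgnDist_le_dist x hy
      rwa [dist_eq_norm, hx, add_sub_cancel_left, norm_smul, h.norm_normal y hy, mul_one,
        Real.norm_eq_abs] at this
    have hxt : x ∈ tube Ω δ := lt_of_le_of_lt hds hs
    rw [← hπP hxt]
    set z := P x with hz
    obtain ⟨hzf, hzx⟩ := hP x
    rw [← hz] at hzf hzx
    set d := sgnDist Ω x with hd
    have e0 : y - z = d • outerNormal Ω z - s • outerNormal Ω y := by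
      rw [sub_eq_sub_iff_add_eq_add, ← hx, add_comm, ← hzx]
    have e1 : inner ℝ (outerNormal Ω z) (y - z) =
        d - s + s * (‖outerNormal Ω y - outerNormal Ω z‖ ^ 2 / 2) := by
      rw [e0, inner_sub_right, inner_smul_right, inner_smul_right, real_inner_self_eq_norm_sq,
        h.norm_normal z hzf, real_inner_comm,
        inner_eq_one_sub_of_norm_eq_one (h.norm_normal y hy) (h.norm_normal z hzf)]
      ring
    have e2 := h.abs_inner_le hzf hy
    have e3 := hd2 y hy z hzf s hs
    have e4 : |d - s| ≤ 5 / 2 * C * ‖y - z‖ ^ 2 := by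
      rw [e1] at e2
      rw [abs_le] at e2 e3 ⊢
      constructor <;> linarith
    have e5 : ‖y - z‖ ≤ |d - s| + ‖y - z‖ / 2 := by
      have : y - z = (d - s) • outerNormal Ω z - s • (outerNormal Ω y - outerNormal Ω z) := by
        rw [e0]; module
      nth_rw 1 [this]
      refine (norm_sub_le _ _).trans (add_le_add ?_ ?_)
      · rw [norm_smul, h.norm_normal z hzf, mul_one, Real.norm_eq_abs]
      · rw [norm_smul, Real.norm_eq_abs]
        calc _ ≤ δ * (6 * C * ‖y - z‖) :=
              mul_le_mul hs.le (h.norm_normal_sub_le hy hzf) (norm_nonneg _) hδ0.le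
          _ = _ := by rw [← mul_assoc, hδL]; ring
    have e6 : ‖y - z‖ ≤ 2 * δ := by
      rw [e0]
      refine (norm_sub_le _ _).trans ?_
      rw [norm_smul, norm_smul, h.norm_normal z hzf, h.norm_normal y hy, mul_one, mul_one,
        Real.norm_eq_abs, Real.norm_eq_abs]
      linarith
    have e7 : ‖y - z‖ = 0 := by
      by_contra hne
      have hp : 0 < ‖y - z‖ := lt_of_le_of_ne (norm_nonneg _) (Ne.symm hne)
      have e8 : ‖y - z‖ * 1 ≤ ‖y - z‖ * (5 * C * ‖y - z‖) := by nlinarith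
      have e9 := le_of_mul_le_mul_left e8 hp
      have e10 : 5 * C * ‖y - z‖ ≤ 5 * C * (2 * δ) := by gcongr
      nlinarith
    constructor
    · rw [norm_eq_zero, sub_eq_zero] at e7
      exact e7.symm
    · rw [e7] at e4
      have : |d - s| = 0 := le_antisymm (by simpa using e4) (abs_nonneg _)
      rwa [abs_eq_zero, sub_eq_zero] at this

/-! ### The faces of the boundary mesh -/

theorem convex_abs_inner_sub_le {n : ℕ} (w v : Euc n) (B : ℝ) :
    Convex ℝ {x : Euc n | |inner ℝ w (x - v)| ≤ B} := by
  intro x hx y hy a b ha hb hab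
  have e : a • x + b • y - v = a • (x - v) + b • (y - v) := by
    have : v = (a + b) • v := by rw [hab, one_smul]
    nth_rw 1 [this]; module
  simp only [mem_ofPred_eq] at hx hy ⊢
  rw [e, inner_add_right, inner_smul_right, inner_smul_right]
  calc _ ≤ |a * inner ℝ w (x - v)| + |b * inner ℝ w (y - v)| := abs_add_le _ _
    _ ≤ a * B + b * B := by
      rw [abs_mul, abs_mul, abs_of_nonneg ha, abs_of_nonneg hb]; gcongr
    _ = B := by rw [← add_mul, hab, one_mul]

/-- An affine function with values in `[0,1]` on a ball of diameter `ρ` is `1/ρ`-Lipschitz. -/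
theorem abs_affine_sub_le {n : ℕ} (f : Euc n →ᵃ[ℝ] ℝ) {c : Euc n} {ρ : ℝ} (hρ : 0 < ρ)
    (h : ∀ x ∈ Metric.closedBall c (ρ / 2), 0 ≤ f x ∧ f x ≤ 1) (x y : Euc n) :
    |f x - f y| ≤ ‖x - y‖ / ρ := by
  rcases eq_or_ne x y with rfl | hne
  · simp
  have hp : 0 < ‖x - y‖ := norm_pos_iff.2 (sub_ne_zero.2 hne)
  set u := (ρ / 2 / ‖x - y‖) • (x - y) with hu
  have hun : ‖u‖ = ρ / 2 := by
    rw [hu, norm_smul, Real.norm_eq_abs, abs_of_pos (by positivity)]; field_simp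
  have h1 := h (c + u) (by simp [Metric.mem_closedBall, hun])
  have h2 := h (c - u) (by simp [Metric.mem_closedBall, hun])
  have e1 : f (c + u) - f (c - u) = f.linear ((c + u) - (c - u)) := by
    have := f.linearMap_vsub (c + u) (c - u)
    simpa using this.symm
  have e2 : f x - f y = f.linear (x - y) := by
    have := f.linearMap_vsub x y
    simpa using this.symm
  have e3 : (c + u) - (c - u) = (ρ / ‖x - y‖) • (x - y) := by rw [hu]; module
  rw [e3, map_smul, ← e2, smul_eq_mul] at e1
  have h3 : |ρ / ‖x - y‖ * (f x - f y)| ≤ 1 := by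
    rw [← e1, abs_le]; constructor <;> linarith
  rw [abs_mul, abs_of_pos (by positivity), div_mul_eq_mul_div, div_le_one hp] at h3
  rw [le_div_iff₀ hρ]; linarith

namespace Triangulation

variable {m : ℕ}

/-- Write x - y in barycentric coordinates of the cell. On the inscribed ball each coordinate lies
in [0, 1], so it is 1/ρ-Lipschitz; coordinates of vertices outside F vanish on F. The factor m + 2
counts all vertices of the cell. -/
theorem abs_inner_sub_le_of_mem_convexHull (T : Triangulation m) {s F : Finset (Euc (m + 1))}
    (hs : s ∈ T.cells) (hF : F ⊆ s) {c : Euc (m + 1)} {ρ : ℝ} (hρ : 0 < ρ)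
    (hball : Metric.closedBall c (ρ / 2) ⊆ convexHull ℝ (s : Set (Euc (m + 1))))
    {w v₀ : Euc (m + 1)} {B : ℝ} (hB : ∀ v ∈ F, |inner ℝ w (v - v₀)| ≤ B) {x y : Euc (m + 1)}
    (hx : x ∈ convexHull ℝ (F : Set (Euc (m + 1)))) (hy : y ∈ convexHull ℝ (F : Set (Euc (m + 1)))) :
    |inner ℝ w (x - y)| ≤ (m + 2) * B / ρ * ‖x - y‖ := by
  have hspan : affineSpan ℝ (range fun v : s => (v : Euc (m + 1))) = ⊤ := by
    rw [(T.affineIndependent s hs).affineSpan_eq_top_iff_card_eq_finrank_add_one]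
    simp [T.card_eq s hs]
  let b : AffineBasis s ℝ (Euc (m + 1)) := ⟨fun v => v, T.affineIndependent s hs, hspan⟩
  have hb : ∀ i : s, b i = i := fun i => rfl
  have hrange : range b = (s : Set (Euc (m + 1))) := by
    ext z; simp [hb]
  have hcoord : ∀ i : s, ∀ z ∈ convexHull ℝ (s : Set (Euc (m + 1))),
      0 ≤ b.coord i z ∧ b.coord i z ≤ 1 := by
    intro i z hz
    rw [← hrange, b.convexHull_eq_nonneg_coord] at hz
    refine ⟨hz i, ?_⟩
    rw [← b.sum_coord_apply_eq_one z]
    exact Finset.single_le_sum (f := fun j => b.coord j z) (fun j _ => hz j) (Finset.mem_univ i)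
  have hlip : ∀ i : s, |b.coord i x - b.coord i y| ≤ ‖x - y‖ / ρ := fun i =>
    abs_affine_sub_le (b.coord i) hρ (fun z hz => hcoord i z (hball hz)) x y
  have hzero : ∀ i : s, (i : Euc (m + 1)) ∉ F →
      ∀ z ∈ convexHull ℝ (F : Set (Euc (m + 1))), b.coord i z = 0 := by
    intro i hi z hz
    have hsub : convexHull ℝ (F : Set (Euc (m + 1))) ⊆ b.coord i ⁻¹' {0} := by
      refine convexHull_min ?_ ((convex_singleton (0 : ℝ)).affine_preimage _)
      intro v hv
      have hne : i ≠ ⟨v, hF hv⟩ := fun h => hi (by rw [h]; exact hv)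
      have := b.coord_apply_ne hne
      simpa [hb] using this
    exact hsub hz
  -- The coordinate differences sum to zero, so any base point v₀ may be subtracted.
  have hcomb : x - y = ∑ i : s, (b.coord i x - b.coord i y) • ((i : Euc (m + 1)) - v₀) := by
    have e1 := b.linear_combination_coord_eq_self x
    have e2 := b.linear_combination_coord_eq_self y
    have e3 := b.sum_coord_apply_eq_one x
    have e4 := b.sum_coord_apply_eq_one y
    simp only [hb] at e1 e2
    simp only [smul_sub, sub_smul, Finset.sum_sub_distrib, e1, e2, ← Finset.sum_smul, e3, e4]
    abel
  have hterm : ∀ i : s, |(b.coord i x - b.coord i y) * inner ℝ w ((i : Euc (m + 1)) - v₀)| ≤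
      ‖x - y‖ / ρ * B := by
    intro i
    have hB0 : 0 ≤ B := by
      have hFne : (F : Set (Euc (m + 1))).Nonempty := by
        rw [← convexHull_nonempty_iff (𝕜 := ℝ)]; exact ⟨x, hx⟩
      obtain ⟨v, hv⟩ := hFne
      exact (abs_nonneg _).trans (hB v hv)
    by_cases hi : (i : Euc (m + 1)) ∈ F
    · rw [abs_mul]
      exact mul_le_mul (hlip i) (hB i hi) (abs_nonneg _) (by positivity)
    · rw [hzero i hi x hx, hzero i hi y hy, sub_zero, zero_mul, abs_zero]
      positivity
  rw [hcomb, inner_sum]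
  simp only [inner_smul_right]
  calc _ ≤ ∑ i : s, |(b.coord i x - b.coord i y) * inner ℝ w ((i : Euc (m + 1)) - v₀)| :=
        Finset.abs_sum_le_sum_abs _ _
    _ ≤ ∑ _i : s, ‖x - y‖ / ρ * B := Finset.sum_le_sum fun i _ => hterm i
    _ = (m + 2) * B / ρ * ‖x - y‖ := by
      simp [T.card_eq s hs]; ring
    _ = _ := by rw [← hcomb]

theorem dist_le_diam_of_mem_convexHull (s : Finset (Euc (m + 1))) {x y : Euc (m + 1)}
    (hx : x ∈ convexHull ℝ (s : Set (Euc (m + 1))))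
    (hy : y ∈ convexHull ℝ (s : Set (Euc (m + 1)))) :
    dist x y ≤ Metric.diam (convexHull ℝ (s : Set (Euc (m + 1)))) :=
  Metric.dist_le_diam_of_mem (isBounded_convexHull.2 s.finite_toSet.isBounded) hx hy

/-- Relative to the tangent plane at a vertex v, the other vertices have height at most Ch², and by
convexity so has the face. The expansion at v adds another Ch²; the constant 3 instead of 2 makes
the inequality strict. Shape regularity plays no role. -/
theorem discreteBoundary_subset_tube (T : Triangulation m) {Ω : Set (Euc (m + 1))} {C h : ℝ}
    (hn : HasSecondOrderNormal Ω C) (hh : 0 < h) (hmesh : T.MeshSizeLE h)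
    (hvert : T.BoundaryVerticesOn Ω) : T.discreteBoundary ⊆ tube Ω (3 * C * h ^ 2) := by
  intro x hx
  simp only [discreteBoundary, mem_iUnion, exists_prop] at hx
  obtain ⟨F, hF, hxF⟩ := hx
  obtain ⟨hcard, ⟨s, hs, hFs⟩, -⟩ := id hF
  have hC := hn.C_pos
  have hsub : convexHull ℝ (F : Set (Euc (m + 1))) ⊆ convexHull ℝ (s : Set (Euc (m + 1))) :=
    convexHull_mono (by exact_mod_cast hFs)
  obtain ⟨v, hv⟩ : F.Nonempty := Finset.card_pos.1 (by omega)
  have hvF : v ∈ convexHull ℝ (F : Set (Euc (m + 1))) := subset_convexHull ℝ _ hv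
  have hdist : ∀ z ∈ convexHull ℝ (F : Set (Euc (m + 1))), ‖z - v‖ ≤ h := fun z hz => by
    rw [← dist_eq_norm]
    exact (dist_le_diam_of_mem_convexHull s (hsub hz) (hsub hvF)).trans (hmesh s hs)
  have hvΓ := hvert F hF v hv
  have h1 : |inner ℝ (outerNormal Ω v) (x - v)| ≤ C * h ^ 2 := by
    have : convexHull ℝ (F : Set (Euc (m + 1))) ⊆
        {x | |inner ℝ (outerNormal Ω v) (x - v)| ≤ C * h ^ 2} := by
      refine convexHull_min ?_ (convex_abs_inner_sub_le _ _ _)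
      intro z hz
      have h2 := hdist z (subset_convexHull ℝ _ hz)
      refine (hn.abs_inner_le hvΓ (hvert F hF z hz)).trans ?_
      gcongr
    exact this hxF
  have h2 := hn.expansion v hvΓ x
  have h3 : C * ‖x - v‖ ^ 2 ≤ C * h ^ 2 := by
    have := hdist x hxF
    gcongr
  have h4 : 0 < C * h ^ 2 := by positivity
  change |sgnDist Ω x| < _
  rw [abs_le] at h1 h2
  rw [abs_lt]
  constructor <;> linarith

/-- The constant governing the deviation of the faces from the tangent directions. -/
noncomputable def faceConst (m : ℕ) (L σ : ℝ) : ℝ := (m + 2) * (3 * L) * σ + 16 * L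

/-- Relative to the normal at π y, the vertices have height at most 3LD²: one part because they lie
on Γ, two from the turning of the normal between π y and v₀. Dividing by ρ ≥ D/σ yields the slope.
The statement on d follows from the expansion inside the tube, whose remainder is at most 16L|x -
y|² ≤ 16Lh|x - y|. -/
theorem face_estimate (T : Triangulation m) {Ω : Set (Euc (m + 1))} {L δ σ h : ℝ}
    {π ν : Euc (m + 1) → Euc (m + 1)} (hT : IsNormalTube Ω L δ π ν) (hσ : 0 < σ) (hh : 0 < h)
    (hmesh : T.MeshSizeLE h)
    (hshape : T.ShapeRegular σ) (hvert : T.BoundaryVerticesOn Ω)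
    (htube : T.discreteBoundary ⊆ tube Ω δ) {F : Finset (Euc (m + 1))}
    (hF : F ∈ T.boundaryMesh) {x y : Euc (m + 1)}
    (hx : x ∈ convexHull ℝ (F : Set (Euc (m + 1))))
    (hy : y ∈ convexHull ℝ (F : Set (Euc (m + 1)))) :
    |inner ℝ (ν y) (x - y)| ≤ faceConst m L σ * h * ‖x - y‖ ∧
      |sgnDist Ω x - sgnDist Ω y| ≤ faceConst m L σ * h * ‖x - y‖ := by
  obtain ⟨hcard, ⟨s, hs, hFs⟩, -⟩ := id hF
  have hL := hT.L_pos
  have hsub : convexHull ℝ (F : Set (Euc (m + 1))) ⊆ convexHull ℝ (s : Set (Euc (m + 1))) :=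
    convexHull_mono (by exact_mod_cast hFs)
  have hFT : convexHull ℝ (F : Set (Euc (m + 1))) ⊆ tube Ω δ :=
    (subset_iUnion₂ (s := fun (F : Finset (Euc (m + 1))) (_ : F ∈ T.boundaryMesh) =>
      convexHull ℝ (F : Set (Euc (m + 1)))) F hF).trans htube
  set D := Metric.diam (convexHull ℝ (s : Set (Euc (m + 1)))) with hD
  have hDh : D ≤ h := hmesh s hs
  have hdist : ∀ z ∈ convexHull ℝ (F : Set (Euc (m + 1))),
      ∀ w ∈ convexHull ℝ (F : Set (Euc (m + 1))), ‖z - w‖ ≤ D := fun z hz w hw => by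
    rw [← dist_eq_norm]
    exact dist_le_diam_of_mem_convexHull s (hsub hz) (hsub hw)
  have hD0 : 0 < D := by
    obtain ⟨a, ha, b, hb, hab⟩ := Finset.one_lt_card.1 (show 1 < s.card by
      rw [T.card_eq s hs]; omega)
    exact (dist_pos.2 hab).trans_le (dist_le_diam_of_mem_convexHull s
      (subset_convexHull ℝ _ ha) (subset_convexHull ℝ _ hb))
  obtain ⟨c, ρ, hball, hρD⟩ := hshape s hs
  rw [← hD] at hρD
  -- A nonpositive ρ is not excluded by the ball inclusion, but D ≤ σρ with D > 0 excludes it.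
  have hρ : 0 < ρ := by
    by_contra hneg
    push Not at hneg
    nlinarith
  obtain ⟨v₀, hv₀⟩ : F.Nonempty := Finset.card_pos.1 (by omega)
  have hv₀F : v₀ ∈ convexHull ℝ (F : Set (Euc (m + 1))) := subset_convexHull ℝ _ hv₀
  have hv₀Γ := hvert F hF v₀ hv₀
  obtain ⟨hπy, hyeq⟩ := hT.isOrthProj y (hFT hy)
  have hBv : ∀ v ∈ F, |inner ℝ (ν y) (v - v₀)| ≤ 3 * L * D ^ 2 := by
    intro v hv
    rw [hT.ν_eq y (hFT hy)]
    have h1 := hT.expansion v₀ hv₀Γ v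
    rw [sgnDist_of_mem_frontier (hvert F hF v hv), zero_sub, abs_neg] at h1
    have hvD := hdist v (subset_convexHull ℝ _ hv) v₀ hv₀F
    have h2 : L * ‖v - v₀‖ ^ 2 ≤ L * D ^ 2 := by gcongr
    have h3 : ‖π y - v₀‖ ≤ 2 * D := by
      have e1 : ‖y - π y‖ ≤ D := by
        nth_rw 1 [hyeq]
        rw [add_sub_cancel_left, norm_smul, hT.norm_normal _ hπy, mul_one, Real.norm_eq_abs]
        refine (abs_sgnDist_le_dist y hv₀Γ).trans ?_
        rw [dist_eq_norm]; exact hdist y hy v₀ hv₀F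
      have e2 := hdist y hy v₀ hv₀F
      have e3 := norm_sub_le_norm_sub_add_norm_sub (π y) y v₀
      rw [norm_sub_rev (π y) y] at e3
      linarith
    have h4 : |inner ℝ (outerNormal Ω (π y) - outerNormal Ω v₀) (v - v₀)| ≤
        L * (2 * D) * D := by
      refine (abs_real_inner_le_norm _ _).trans ?_
      have := hT.norm_normal_sub_le _ hπy _ hv₀Γ
      have h5 : L * ‖π y - v₀‖ ≤ L * (2 * D) := by gcongr
      exact mul_le_mul (this.trans h5) hvD (norm_nonneg _) (by positivity)
    have h6 : inner ℝ (outerNormal Ω (π y)) (v - v₀) = inner ℝ (outerNormal Ω v₀) (v - v₀) +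
        inner ℝ (outerNormal Ω (π y) - outerNormal Ω v₀) (v - v₀) := by
      rw [← inner_add_left, add_sub_cancel]
    rw [h6]
    refine (abs_add_le _ _).trans ?_
    linarith
  have key : |inner ℝ (ν y) (x - y)| ≤ (m + 2) * (3 * L) * σ * h * ‖x - y‖ := by
    refine (T.abs_inner_sub_le_of_mem_convexHull hs hFs hρ hball hBv hx hy).trans ?_
    refine mul_le_mul_of_nonneg_right ?_ (norm_nonneg _)
    rw [div_le_iff₀ hρ]
    have h7 : D ^ 2 ≤ h * (σ * ρ) := by
      rw [sq]; exact mul_le_mul hDh hρD hD0.le hh.le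
    calc _ = (m + 2) * (3 * L) * D ^ 2 := by ring
      _ ≤ (m + 2) * (3 * L) * (h * (σ * ρ)) := by gcongr
      _ = _ := by ring
  have h16 : 0 ≤ 16 * L * h * ‖x - y‖ := by positivity
  have hexp : faceConst m L σ * h * ‖x - y‖ =
      (m + 2) * (3 * L) * σ * h * ‖x - y‖ + 16 * L * h * ‖x - y‖ := by
    unfold faceConst; ring
  rw [hexp]
  refine ⟨by linarith, ?_⟩
  have h8 := hT.expansion_tube x (hFT hx) y (hFT hy)
  have h9 : L * ‖π x - π y‖ ^ 2 ≤ 16 * L * h * ‖x - y‖ := by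
    have e1 := hT.norm_π_sub_le x (hFT hx) y (hFT hy)
    have e2 : ‖x - y‖ ≤ h := (hdist x hx y hy).trans hDh
    calc _ ≤ L * (4 * ‖x - y‖) ^ 2 := by gcongr
      _ = 16 * L * ‖x - y‖ * ‖x - y‖ := by ring
      _ ≤ _ := by gcongr
  rw [abs_le] at h8 key ⊢
  constructor <;> linarith

end Triangulation

/-! ### Discrete boundaries as Lipschitz graphs -/

/-- A function which is pointwise locally `K`-Lipschitz on a convex set is `K`-Lipschitz there. -/
theorem abs_sub_le_of_eventually {E : Type*} [NormedAddCommGroup E] [NormedSpace ℝ E]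
    {D : Set E} (hD : Convex ℝ D) {f : E → ℝ} {K : ℝ}
    (h : ∀ x ∈ D, ∀ᶠ y in 𝓝[D] x, |f y - f x| ≤ K * ‖y - x‖) {x y : E} (hx : x ∈ D)
    (hy : y ∈ D) : |f y - f x| ≤ K * ‖y - x‖ := by
  set γ : ℝ → E := fun τ => x + τ • (y - x) with hγ
  have hγc : Continuous γ := by fun_prop
  have hγD : MapsTo γ (Icc 0 1) D := fun τ hτ => by
    have := hD.add_smul_sub_mem hx hy hτ
    exact this
  have hγn : ∀ s t, ‖γ s - γ t‖ = |s - t| * ‖y - x‖ := fun s t => by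
    have : γ s - γ t = (s - t) • (y - x) := by simp only [hγ]; module
    rw [this, norm_smul, Real.norm_eq_abs]
  set B := K * ‖y - x‖ with hB
  have hloc : ∀ t ∈ Icc (0 : ℝ) 1, ∀ᶠ s in 𝓝[Icc 0 1] t, |f (γ s) - f (γ t)| ≤ B * |s - t| := by
    intro t ht
    have h1 : Tendsto γ (𝓝[Icc 0 1] t) (𝓝[D] (γ t)) :=
      hγc.continuousWithinAt.tendsto_nhdsWithin hγD
    filter_upwards [h1.eventually (h (γ t) (hγD ht))] with s hs
    rw [hγn] at hs
    calc _ ≤ _ := hs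
      _ = _ := by rw [hB]; ring
  have hcont : ContinuousOn (fun t => f (γ t)) (Icc 0 1) := by
    intro t ht
    rw [ContinuousWithinAt, tendsto_iff_dist_tendsto_zero]
    have h0 : Tendsto (fun s : ℝ => B * |s - t|) (𝓝[Icc 0 1] t) (𝓝 0) := by
      have : Continuous fun s : ℝ => B * |s - t| := by fun_prop
      simpa using (this.tendsto t).mono_left nhdsWithin_le_nhds
    refine squeeze_zero' (Eventually.of_forall fun _ => dist_nonneg) ?_ h0
    filter_upwards [hloc t ht] with s hs
    rwa [Real.dist_eq]
  -- Continuous induction along the segment: the set of parameters where the bound from the start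
  -- point holds is closed, and the local bound extends it to the right.
  have hclosed : IsClosed ({t | |f (γ t) - f (γ 0)| ≤ B * t} ∩ Icc 0 1) := by
    have h1 : ContinuousOn (fun t => |f (γ t) - f (γ 0)|) (Icc 0 1) :=
      (hcont.sub continuousOn_const).abs
    have h2 : ContinuousOn (fun t : ℝ => B * t) (Icc 0 1) := by fun_prop
    have := isClosed_Icc.isClosed_le h1 h2
    rwa [inter_comm]
  have h1 := hclosed.mem_of_ge_of_forall_exists_gt (by simp) zero_le_one (by
    rintro t ⟨ht, ht0, ht1⟩
    have h2 := hloc t ⟨ht0, ht1.le⟩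
    rw [eventually_nhdsWithin_iff, Metric.eventually_nhds_iff] at h2
    obtain ⟨ε, hε, h2⟩ := h2
    set s := min 1 (t + ε / 2) with hs
    have hts : t < s := lt_min ht1 (by linarith)
    have hs1 : s ≤ 1 := min_le_left _ _
    have hsε : s ≤ t + ε / 2 := min_le_right _ _
    have h3 := h2 (y := s) (by rw [Real.dist_eq, abs_of_pos (by linarith)]; linarith)
      ⟨by linarith, hs1⟩
    refine ⟨s, ?_, hts, hs1⟩
    rw [abs_of_pos (a := s - t) (by linarith)] at h3
    change |f (γ t) - f (γ 0)| ≤ B * t at ht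
    change |f (γ s) - f (γ 0)| ≤ B * s
    have h4 := abs_sub_le (f (γ s)) (f (γ t)) (f (γ 0))
    linarith)
  simpa [hγ] using h1

/-- A piece of a hypersurface which is a bi-Lipschitz image of a measurable set of parameters, and
along which the signed distance is `1/2`-Lipschitz. -/
def IsTangentialPatch {m : ℕ} (Ω : Set (Euc (m + 1))) (Λ : ℝ≥0) (P : Set (Euc (m + 1))) : Prop :=
  ∃ (D : Set (Euc m)) (X : Euc m → Euc (m + 1)), MeasurableSet D ∧ LipschitzWith Λ X ∧
    P = X '' D ∧ (∀ w ∈ D, ∀ z ∈ D, ‖w - z‖ ≤ ‖X w - X z‖) ∧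
    ∀ w ∈ D, ∀ z ∈ D, |sgnDist Ω (X w) - sgnDist Ω (X z)| ≤ 1 / 2 * ‖X w - X z‖

/-! ### Vertical gaps and slopes in the coordinate charts -/

namespace C11Atlas

variable {m : ℕ} {Ω : Set (Euc (m + 1))}

/-- The parametrisation has to be Lipschitz on the whole space, so f is first extended from the
ball. The lower bound on distances holds because the horizontal projection is a contraction. -/
theorem isTangentialPatch_graph (𝒜 : C11Atlas Ω) (r : Fin 𝒜.M) {f : Euc m → ℝ} {Λ : ℝ≥0}
    (hf : ∀ w ∈ Metric.ball 0 𝒜.α, ∀ z ∈ Metric.ball 0 𝒜.α, |f w - f z| ≤ Λ * ‖w - z‖)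
    (hd : ∀ w ∈ Metric.ball 0 𝒜.α, ∀ z ∈ Metric.ball 0 𝒜.α,
      |sgnDist Ω (𝒜.pt r w (f w)) - sgnDist Ω (𝒜.pt r z (f z))| ≤ 1 / 2 * ‖w - z‖) :
    IsTangentialPatch Ω (1 + Λ) ((fun w => 𝒜.pt r w (f w)) '' Metric.ball 0 𝒜.α) := by
  have hL : LipschitzOnWith Λ f (Metric.ball 0 𝒜.α) := LipschitzOnWith.of_dist_le_mul
    fun w hw z hz => by simpa [Real.dist_eq, dist_eq_norm] using hf w hw z hz
  obtain ⟨g, hg, hfg⟩ := hL.extend_real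
  have hmono : ∀ w z : Euc m, ∀ s t : ℝ, ‖w - z‖ ≤ ‖𝒜.pt r w s - 𝒜.pt r z t‖ := by
    intro w z s t
    have := 𝒜.norm_fst_sub_le r (𝒜.pt r w s) (𝒜.pt r z t)
    simpa using this
  refine ⟨Metric.ball 0 𝒜.α, fun w => 𝒜.pt r w (g w), measurableSet_ball, ?_, ?_, ?_, ?_⟩
  · refine LipschitzWith.of_dist_le_mul fun w z => ?_
    have h1 := 𝒜.norm_sub_le_add r (𝒜.pt r w (g w)) (𝒜.pt r z (g z))
    have h2 := hg.dist_le_mul w z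
    simp only [fst_pt, snd_pt] at h1
    simp only [dist_eq_norm, Real.norm_eq_abs] at h2 ⊢
    push_cast
    linarith
  · exact image_congr fun w hw => by simp only [hfg hw]
  · exact fun w _ z _ => hmono w z _ _
  · intro w hw z hz
    simp only
    rw [← hfg hw, ← hfg hz]
    have := hmono w z (f w) (f z)
    linarith [hd w hw z hz]

theorem exists_abs_φ_sub_le (𝒜 : C11Atlas Ω) :
    ∃ G : ℝ≥0, ∀ r, ∀ w ∈ Metric.ball 0 𝒜.α, ∀ z ∈ Metric.ball 0 𝒜.α,
      |𝒜.φ r w - 𝒜.φ r z| ≤ G * ‖w - z‖ := by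
  choose G hG0 hG using fun r => 𝒜.exists_gradient_le r
  have hS0 : 0 ≤ ∑ r, G r := Finset.sum_nonneg fun r _ => hG0 r
  refine ⟨⟨∑ r, G r, hS0⟩, fun r w hw z hz => ?_⟩
  have h := Convex.norm_image_sub_le_of_norm_fderiv_le (f := 𝒜.φ r) (C := ∑ r, G r)
    (fun x hx => (𝒜.differentiableOn r).differentiableAt (Metric.isOpen_ball.mem_nhds hx))
    (fun x hx => ?_) (convex_ball 0 𝒜.α) hz hw
  · exact h
  · have h1 := hG r x hx
    rw [gradient, LinearIsometryEquiv.norm_map] at h1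
    exact h1.trans (Finset.single_le_sum (fun i _ => hG0 i) (Finset.mem_univ r))

theorem frontier_inter_U (𝒜 : C11Atlas Ω) (r : Fin 𝒜.M) :
    frontier Ω ∩ 𝒜.U r = (fun w => 𝒜.pt r w (𝒜.φ r w)) '' Metric.ball 0 𝒜.α := by
  ext x
  constructor
  · rintro ⟨hx, hU⟩
    refine ⟨(𝒜.A r x).fst, (𝒜.mem_U_cases r hU).1, ?_⟩
    simp only
    rw [← 𝒜.snd_eq_of_mem_frontier r hx hU, 𝒜.pt_coords]
  · rintro ⟨w, hw, rfl⟩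
    exact 𝒜.pt_mem_frontier r hw

theorem exists_isTangentialPatch_frontier (𝒜 : C11Atlas Ω) :
    ∃ Λ : ℝ≥0, ∀ r, IsTangentialPatch Ω Λ (frontier Ω ∩ 𝒜.U r) := by
  obtain ⟨G, hG⟩ := 𝒜.exists_abs_φ_sub_le
  refine ⟨1 + G, fun r => ?_⟩
  rw [𝒜.frontier_inter_U]
  refine 𝒜.isTangentialPatch_graph r (hG r) fun w hw z hz => ?_
  rw [sgnDist_of_mem_frontier (𝒜.pt_mem_frontier r hw).1,
    sgnDist_of_mem_frontier (𝒜.pt_mem_frontier r hz).1]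
  simp only [sub_zero, abs_zero]
  positivity

/-- The part of a coordinate neighbourhood at vertical distance less than `b` from the boundary. -/
noncomputable def nearZone (𝒜 : C11Atlas Ω) (r : Fin 𝒜.M) (b : ℝ) : Set (Euc (m + 1)) :=
  {x | x ∈ 𝒜.U r ∧ |(𝒜.A r x).snd - 𝒜.φ r (𝒜.A r x).fst| < b}

theorem foot_sub (𝒜 : C11Atlas Ω) (r : Fin 𝒜.M) (x : Euc (m + 1)) :
    x - 𝒜.pt r (𝒜.A r x).fst (𝒜.φ r (𝒜.A r x).fst) =
      ((𝒜.A r x).snd - 𝒜.φ r (𝒜.A r x).fst) • 𝒜.vert r := by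
  rw [← 𝒜.pt_sub_pt_vert r (𝒜.A r x).fst, 𝒜.pt_coords]

/-- This is the expansion of d at the boundary point vertically aligned with x. For small |d(x)| the
quadratic inequality is a dichotomy: the gap is either at most 2|d(x)|/c or at least c/(2L). -/
theorem vertical_gap (𝒜 : C11Atlas Ω) {L δ c : ℝ} {π ν : Euc (m + 1) → Euc (m + 1)}
    (hT : IsNormalTube Ω L δ π ν)
    (hc : ∀ r, ∀ y ∈ frontier Ω, y ∈ 𝒜.U r → c ≤ |inner ℝ (outerNormal Ω y) (𝒜.vert r)|)
    {r : Fin 𝒜.M} {x : Euc (m + 1)} (hx : x ∈ 𝒜.U r) :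
    c * |(𝒜.A r x).snd - 𝒜.φ r (𝒜.A r x).fst| -
      L * |(𝒜.A r x).snd - 𝒜.φ r (𝒜.A r x).fst| ^ 2 ≤ |sgnDist Ω x| := by
  obtain ⟨hz, hzU⟩ := 𝒜.pt_mem_frontier r (𝒜.mem_U_cases r hx).1
  have h1 := hT.expansion _ hz x
  have h2 := hc r _ hz hzU
  rw [𝒜.foot_sub, inner_smul_right, norm_smul, 𝒜.norm_vert, mul_one, Real.norm_eq_abs] at h1
  set b := (𝒜.A r x).snd - 𝒜.φ r (𝒜.A r x).fst with hb
  have h3 : c * |b| ≤ |b * inner ℝ (outerNormal Ω (𝒜.pt r (𝒜.A r x).fst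
      (𝒜.φ r (𝒜.A r x).fst))) (𝒜.vert r)| := by
    rw [abs_mul, mul_comm]; gcongr
  have h4 := abs_sub_abs_le_abs_sub (b * inner ℝ (outerNormal Ω (𝒜.pt r (𝒜.A r x).fst
      (𝒜.φ r (𝒜.A r x).fst))) (𝒜.vert r)) (sgnDist Ω x)
  rw [abs_sub_comm] at h4
  linarith

/-- Near the boundary, the normal at the projected point is not horizontal. -/
theorem abs_inner_ν_vert_ge (𝒜 : C11Atlas Ω) {L δ c η b : ℝ} {π ν : Euc (m + 1) → Euc (m + 1)}
    (hT : IsNormalTube Ω L δ π ν)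
    (hc : ∀ r, ∀ y ∈ frontier Ω, y ∈ 𝒜.U r → c ≤ |inner ℝ (outerNormal Ω y) (𝒜.vert r)|)
    {r : Fin 𝒜.M} {x : Euc (m + 1)} (hx : x ∈ 𝒜.U r) (hη : x ∈ tube Ω η) (hηδ : η ≤ δ)
    (hb : |(𝒜.A r x).snd - 𝒜.φ r (𝒜.A r x).fst| ≤ b) (hsmall : L * (η + b) ≤ c / 2) :
    c / 2 ≤ |inner ℝ (ν x) (𝒜.vert r)| := by
  obtain ⟨hz, hzU⟩ := 𝒜.pt_mem_frontier r (𝒜.mem_U_cases r hx).1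
  set z := 𝒜.pt r (𝒜.A r x).fst (𝒜.φ r (𝒜.A r x).fst) with hzdef
  have hxδ : x ∈ tube Ω δ := tube_mono Ω hηδ hη
  obtain ⟨hπ, hxeq⟩ := hT.isOrthProj x hxδ
  have h1 : ‖π x - x‖ ≤ η := by
    rw [norm_sub_rev]
    nth_rw 1 [hxeq]
    rw [add_sub_cancel_left, norm_smul, hT.norm_normal _ hπ, mul_one]
    exact le_of_lt hη
  have h2 : ‖x - z‖ ≤ b := by
    rw [hzdef, 𝒜.foot_sub, norm_smul, 𝒜.norm_vert, mul_one]; exact hb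
  have h3 : ‖π x - z‖ ≤ η + b := (norm_sub_le_norm_sub_add_norm_sub _ x _).trans (by gcongr)
  have h4 := hT.norm_normal_sub_le _ hπ _ hz
  rw [← hT.ν_eq x hxδ] at h4
  have h5 : |inner ℝ (ν x - outerNormal Ω z) (𝒜.vert r)| ≤ c / 2 := by
    refine (abs_real_inner_le_norm _ _).trans ?_
    rw [𝒜.norm_vert, mul_one]
    refine h4.trans (le_trans ?_ hsmall)
    have := hT.L_pos
    gcongr
  have h6 := hc r z hz hzU
  rw [inner_sub_left] at h5
  have h7 := abs_sub_abs_le_abs_sub (inner ℝ (outerNormal Ω z) (𝒜.vert r))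
    (inner ℝ (ν x) (𝒜.vert r))
  rw [abs_sub_comm] at h7
  linarith

/-- A secant which is nearly orthogonal to a non-horizontal direction is not steep. -/
theorem abs_snd_sub_le_of_inner (𝒜 : C11Atlas Ω) {c ε : ℝ} (hc0 : 0 < c) (hc1 : c ≤ 1)
    (hε : ε ≤ c / 4) {r : Fin 𝒜.M} {u x y : Euc (m + 1)} (hu : ‖u‖ = 1)
    (huv : c / 2 ≤ |inner ℝ u (𝒜.vert r)|) (hxy : |inner ℝ u (x - y)| ≤ ε * ‖x - y‖) :
    |(𝒜.A r x).snd - (𝒜.A r y).snd| ≤ 5 / c * ‖(𝒜.A r x).fst - (𝒜.A r y).fst‖ := by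
  set t := (𝒜.A r x).snd - (𝒜.A r y).snd with ht
  set q := 𝒜.pt r (𝒜.A r x).fst (𝒜.A r y).snd - y with hq
  have hsplit : x - y = t • 𝒜.vert r + q := by
    rw [ht, ← 𝒜.pt_sub_pt_vert r (𝒜.A r x).fst, 𝒜.pt_coords, hq]; abel
  have hqn : ‖q‖ ≤ ‖(𝒜.A r x).fst - (𝒜.A r y).fst‖ := by
    have := 𝒜.norm_sub_le_add r (𝒜.pt r (𝒜.A r x).fst (𝒜.A r y).snd) y
    simpa using this
  have h1 := 𝒜.norm_sub_le_add r x y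
  set Q := ‖(𝒜.A r x).fst - (𝒜.A r y).fst‖ with hQ
  have h2 : |inner ℝ u q| ≤ Q := by
    have := abs_real_inner_le_norm u q
    rw [hu, one_mul] at this
    exact this.trans hqn
  have h3 : |t| * (c / 2) ≤ |t * inner ℝ u (𝒜.vert r)| := by rw [abs_mul]; gcongr
  have h4 : t * inner ℝ u (𝒜.vert r) = inner ℝ u (x - y) - inner ℝ u q := by
    rw [hsplit, inner_add_right, inner_smul_right]; ring
  have h5 : ε * ‖x - y‖ ≤ c / 4 * (Q + |t|) :=
    (mul_le_mul_of_nonneg_right hε (norm_nonneg _)).trans (by gcongr)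
  have h6 := abs_sub (inner ℝ u (x - y)) (inner ℝ u q)
  rw [← h4] at h6
  rw [div_mul_eq_mul_div, le_div_iff₀ hc0]
  have hQ0 : 0 ≤ Q := norm_nonneg _
  nlinarith

theorem mem_nearZone_of_mem_tube (𝒜 : C11Atlas Ω) {L δ ε η b : ℝ} {G : ℝ≥0}
    {π ν : Euc (m + 1) → Euc (m + 1)} (hT : IsNormalTube Ω L δ π ν)
    (hG : ∀ r, ∀ w ∈ Metric.ball 0 𝒜.α, ∀ z ∈ Metric.ball 0 𝒜.α,
      |𝒜.φ r w - 𝒜.φ r z| ≤ G * ‖w - z‖)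
    (hε : ∀ y ∈ frontier Ω, ∃ r, Metric.ball y ε ⊆ 𝒜.U r) (hηε : η ≤ ε)
    (hηb : (1 + G) * η ≤ b) {x : Euc (m + 1)} (hx : x ∈ tube Ω η) :
    ∃ r, x ∈ 𝒜.nearZone r b := by
  obtain ⟨y, hy, hxy⟩ := exists_mem_frontier_dist_eq hT.nonempty x
  have hlt : ‖x - y‖ < η := by rw [← dist_eq_norm, hxy]; exact hx
  obtain ⟨r, hr⟩ := hε y hy
  have hxU : x ∈ 𝒜.U r := hr (by rw [Metric.mem_ball, dist_eq_norm]; linarith)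
  have hyU : y ∈ 𝒜.U r := hr (Metric.mem_ball_self (by linarith [norm_nonneg (x - y)]))
  refine ⟨r, hxU, lt_of_lt_of_le ?_ hηb⟩
  have h1 := hG r _ (𝒜.mem_U_cases r hyU).1 _ (𝒜.mem_U_cases r hxU).1
  rw [← 𝒜.snd_eq_of_mem_frontier r hy hyU, norm_sub_rev] at h1
  have h2 := 𝒜.abs_snd_sub_le r x y
  have h3 : G * ‖(𝒜.A r x).fst - (𝒜.A r y).fst‖ ≤ G * ‖x - y‖ := by
    have := 𝒜.norm_fst_sub_le r x y
    gcongr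
  have h4 := abs_sub_le (𝒜.A r x).snd (𝒜.A r y).snd (𝒜.φ r (𝒜.A r x).fst)
  have h5 : (1 + G) * ‖x - y‖ < (1 + G) * η := by gcongr
  nlinarith

end C11Atlas

/-! ### The discrete boundary in a single chart -/

namespace Triangulation

variable {m : ℕ}

theorem finite_boundaryMesh (T : Triangulation m) : T.boundaryMesh.Finite := by
  refine (T.cells.biUnion Finset.powerset).finite_toSet.subset ?_
  rintro F ⟨-, ⟨s, hs, hFs⟩, -⟩
  simpa using ⟨s, hs, hFs⟩

theorem isCompact_face (F : Finset (Euc (m + 1))) :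
    IsCompact (convexHull ℝ (F : Set (Euc (m + 1)))) :=
  F.finite_toSet.isCompact_convexHull ℝ

theorem isCompact_discreteBoundary (T : Triangulation m) : IsCompact T.discreteBoundary :=
  T.finite_boundaryMesh.isCompact_biUnion fun F _ => isCompact_face F

/-- Nearby points of a curve in the discrete boundary lie on a common face. -/
theorem eventually_exists_face (T : Triangulation m) {D : Set (Euc m)}
    {X : Euc m → Euc (m + 1)} (hX : ContinuousOn X D) (hXT : ∀ w ∈ D, X w ∈ T.discreteBoundary)
    {z : Euc m} (hz : z ∈ D) : ∀ᶠ w in 𝓝[D] z, ∃ F ∈ T.boundaryMesh,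
      X w ∈ convexHull ℝ (F : Set (Euc (m + 1))) ∧ X z ∈ convexHull ℝ (F : Set (Euc (m + 1))) := by
  have h1 : ∀ F ∈ T.boundaryMesh, ∀ᶠ w in 𝓝[D] z,
      X z ∉ convexHull ℝ (F : Set (Euc (m + 1))) → X w ∉ convexHull ℝ (F : Set (Euc (m + 1))) := by
    intro F _
    by_cases hF : X z ∈ convexHull ℝ (F : Set (Euc (m + 1)))
    · exact Eventually.of_forall fun w h => absurd hF h
    · filter_upwards [(hX z hz).eventually
        ((isCompact_face F).isClosed.isOpen_compl.mem_nhds hF)] with w hw _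
      exact hw
  rw [← Filter.eventually_all_finite T.finite_boundaryMesh] at h1
  filter_upwards [h1, self_mem_nhdsWithin] with w hw hwD
  have h2 := hXT w hwD
  simp only [discreteBoundary, mem_iUnion, exists_prop] at h2
  obtain ⟨F, hF, hwF⟩ := h2
  exact ⟨F, hF, hwF, by by_contra h; exact hw F hF h hwF⟩

/-- Graph compatibility alone does not place the discrete graph close to the graph of Γ in the
chart. By `vertical_gap` the gap avoids an interval of values, and it is continuous on a connected
ball; so the whole discrete graph is near Γ or no point of it is. In the first case the estimates on
single faces hold locally along the graph, and convexity of the ball makes them global. -/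
theorem isTangentialPatch_nearZone (T : Triangulation m) {Ω : Set (Euc (m + 1))}
    (𝒜 : C11Atlas Ω) {L δ σ h c η : ℝ} {π ν : Euc (m + 1) → Euc (m + 1)}
    (hT : IsNormalTube Ω L δ π ν) (hσ : 0 < σ) (hh : 0 < h)
    (hc0 : 0 < c) (hc1 : c ≤ 1)
    (hc : ∀ r, ∀ y ∈ frontier Ω, y ∈ 𝒜.U r → c ≤ |inner ℝ (outerNormal Ω y) (𝒜.vert r)|)
    (hmesh : T.MeshSizeLE h) (hshape : T.ShapeRegular σ) (hvert : T.BoundaryVerticesOn Ω)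
    (hgraph : T.GraphCompatible 𝒜) (htube : T.discreteBoundary ⊆ tube Ω η) (hηδ : η ≤ δ)
    (hη1 : 2 * η / c ≤ c / (4 * L)) (hη2 : L * (η + 2 * η / c) ≤ c / 2)
    (hε1 : faceConst m L σ * h ≤ c / 4) (hε2 : faceConst m L σ * h * (1 + 5 / c) ≤ 1 / 2)
    (r : Fin 𝒜.M) :
    IsTangentialPatch Ω (1 + Real.toNNReal (5 / c))
      (T.discreteBoundary ∩ 𝒜.nearZone r (c / (2 * L))) := by
  have hL := hT.L_pos
  set Λ := Real.toNNReal (5 / c) with hΛ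
  have hΛc : (Λ : ℝ) = 5 / c := Real.coe_toNNReal _ (by positivity)
  rcases (T.discreteBoundary ∩ 𝒜.nearZone r (c / (2 * L))).eq_empty_or_nonempty with he | hne
  -- A discrete graph with no point in the near zone contributes an empty patch.
  · refine ⟨∅, fun _ => 0, MeasurableSet.empty, ?_, by simp [he], by simp, by simp⟩
    exact (LipschitzWith.const 0).weaken zero_le
  obtain ⟨φh, hφh, hset⟩ := hgraph r
  set X : Euc m → Euc (m + 1) := fun w => 𝒜.pt r w (φh w) with hX
  have hXS : ∀ w ∈ Metric.ball 0 𝒜.α, X w ∈ T.discreteBoundary ∧ X w ∈ 𝒜.U r := by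
    intro w hw
    have : X w ∈ T.discreteBoundary ∩ 𝒜.U r := by
      rw [hset]; simpa [hX] using hw
    exact this
  have hgap : ∀ w ∈ Metric.ball 0 𝒜.α, |φh w - 𝒜.φ r w| < c / (2 * L) →
      |φh w - 𝒜.φ r w| ≤ 2 * η / c := by
    intro w hw hlt
    have h1 := 𝒜.vertical_gap hT hc (hXS w hw).2
    simp only [hX, C11Atlas.fst_pt, C11Atlas.snd_pt] at h1
    have h2 : |sgnDist Ω (X w)| < η := htube (hXS w hw).1
    set b := |φh w - 𝒜.φ r w| with hb
    have hb0 : 0 ≤ b := abs_nonneg _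
    rw [lt_div_iff₀ (by positivity)] at hlt
    rw [le_div_iff₀ hc0]
    have h3 : |sgnDist Ω (𝒜.pt r w (φh w))| < η := h2
    nlinarith
  have hnear : ∀ w ∈ Metric.ball 0 𝒜.α, |φh w - 𝒜.φ r w| < c / (2 * L) := by
    obtain ⟨x, hxS, hxU, hxb⟩ := hne
    have hx : x ∈ T.discreteBoundary ∩ 𝒜.U r := ⟨hxS, hxU⟩
    rw [hset] at hx
    obtain ⟨hxΔ, hxN⟩ := hx
    rw [hxN] at hxb
    intro w hw
    by_contra hcon
    push Not at hcon
    have hcontb : ContinuousOn (fun w => |φh w - 𝒜.φ r w|) (Metric.ball 0 𝒜.α) :=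
      (hφh.sub (𝒜.differentiableOn r).continuousOn).abs
    have h1 := (convex_ball (0 : Euc m) 𝒜.α).isPreconnected.intermediate_value hxΔ hw hcontb
    have h2 := hgap _ hxΔ hxb
    have e1 : c / (4 * L) = c / L / 4 := by field_simp
    have e2 : c / (2 * L) = c / L / 2 := by field_simp
    have e3 : 0 < c / L := by positivity
    rw [e1] at hη1
    rw [e2] at hcon
    -- The value 3c/(8L) lies strictly between c/(4L) and c/(2L), in the range excluded by `hgap`.
    obtain ⟨z, hz, hzb⟩ := h1 (show c / L * (3 / 8) ∈ _ from ⟨by linarith, by linarith⟩)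
    simp only at hzb
    have h3 := hgap z hz (by rw [hzb, e2]; linarith)
    linarith
  have hfact : ∀ F ∈ T.boundaryMesh, ∀ w ∈ Metric.ball 0 𝒜.α, ∀ z ∈ Metric.ball 0 𝒜.α,
      X w ∈ convexHull ℝ (F : Set (Euc (m + 1))) → X z ∈ convexHull ℝ (F : Set (Euc (m + 1))) →
      |φh w - φh z| ≤ 5 / c * ‖w - z‖ ∧
        |sgnDist Ω (X w) - sgnDist Ω (X z)| ≤ 1 / 2 * ‖w - z‖ := by
    intro F hF w hw z hz hwF hzF
    obtain ⟨h1, h2⟩ := T.face_estimate hT hσ hh hmesh hshape hvert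
      (htube.trans (tube_mono Ω hηδ)) hF hwF hzF
    have hzη : X z ∈ tube Ω η := htube (hXS z hz).1
    have hzδ : X z ∈ tube Ω δ := tube_mono Ω hηδ hzη
    have hν1 : ‖ν (X z)‖ = 1 := by
      rw [hT.ν_eq _ hzδ]; exact hT.norm_normal _ (hT.isOrthProj _ hzδ).1
    have h3 := 𝒜.abs_inner_ν_vert_ge hT hc (hXS z hz).2 hzη hηδ
      (b := 2 * η / c) (by simpa [hX] using hgap z hz (hnear z hz)) hη2
    have h4 := 𝒜.abs_snd_sub_le_of_inner hc0 hc1 hε1 hν1 h3 h1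
    simp only [hX, C11Atlas.fst_pt, C11Atlas.snd_pt] at h4
    refine ⟨h4, h2.trans ?_⟩
    have h5 := 𝒜.norm_sub_le_add r (X w) (X z)
    simp only [hX, C11Atlas.fst_pt, C11Atlas.snd_pt] at h5
    have h6 : ‖X w - X z‖ ≤ (1 + 5 / c) * ‖w - z‖ := by
      simp only [hX]; linarith
    have hfc : 0 ≤ faceConst m L σ * h := by unfold faceConst; positivity
    calc _ ≤ faceConst m L σ * h * ((1 + 5 / c) * ‖w - z‖) := by gcongr
      _ = faceConst m L σ * h * (1 + 5 / c) * ‖w - z‖ := by ring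
      _ ≤ _ := by gcongr
  have hXcont : ContinuousOn X (Metric.ball 0 𝒜.α) := by
    have h1 : Continuous fun p : Euc m × ℝ => 𝒜.pt r p.1 p.2 := by
      unfold C11Atlas.pt
      exact (𝒜.A r).symm.continuous.comp (WithLp.prod_continuous_toLp 2 _ _)
    exact h1.comp_continuousOn (continuousOn_id.prodMk hφh)
  have hφLip : ∀ w ∈ Metric.ball 0 𝒜.α, ∀ z ∈ Metric.ball 0 𝒜.α,
      |φh w - φh z| ≤ Λ * ‖w - z‖ := by
    intro w hw z hz
    rw [hΛc]
    refine abs_sub_le_of_eventually (convex_ball (0 : Euc m) 𝒜.α) (f := φh) ?_ hz hw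
    intro z hz
    filter_upwards [T.eventually_exists_face hXcont (fun w hw => (hXS w hw).1) hz,
      self_mem_nhdsWithin] with w ⟨F, hF, hwF, hzF⟩ hw
    exact (hfact F hF w hw z hz hwF hzF).1
  have hdLip : ∀ w ∈ Metric.ball 0 𝒜.α, ∀ z ∈ Metric.ball 0 𝒜.α,
      |sgnDist Ω (X w) - sgnDist Ω (X z)| ≤ 1 / 2 * ‖w - z‖ := by
    intro w hw z hz
    refine abs_sub_le_of_eventually (convex_ball (0 : Euc m) 𝒜.α)
      (f := fun w => sgnDist Ω (X w)) ?_ hz hw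
    intro z hz
    filter_upwards [T.eventually_exists_face hXcont (fun w hw => (hXS w hw).1) hz,
      self_mem_nhdsWithin] with w ⟨F, hF, hwF, hzF⟩ hw
    exact (hfact F hF w hw z hz hwF hzF).2
  have hPeq : T.discreteBoundary ∩ 𝒜.nearZone r (c / (2 * L)) = X '' Metric.ball 0 𝒜.α := by
    ext x
    constructor
    · rintro ⟨hxS, hxU, -⟩
      have hx : x ∈ T.discreteBoundary ∩ 𝒜.U r := ⟨hxS, hxU⟩
      rw [hset] at hx
      refine ⟨(𝒜.A r x).fst, hx.1, ?_⟩
      simp only [hX]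
      rw [← hx.2, 𝒜.pt_coords]
    · rintro ⟨w, hw, rfl⟩
      exact ⟨(hXS w hw).1, (hXS w hw).2, by simpa [hX] using hnear w hw⟩
  rw [hPeq]
  exact 𝒜.isTangentialPatch_graph r hφLip hdLip

end Triangulation

/-- For fine meshes, the discrete boundary consists of uniformly tangential patches. -/
theorem C11Atlas.exists_patches {m : ℕ} {Ω : Set (Euc (m + 1))} (𝒜 : C11Atlas Ω)
    (hb : Bornology.IsBounded Ω) {L δ : ℝ} {π ν : Euc (m + 1) → Euc (m + 1)}
    (hT : IsNormalTube Ω L δ π ν) :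
    ∃ Λ : ℝ≥0, ∀ σ : ℝ, 0 < σ → ∀ K : ℝ, 0 < K → ∃ h₁ : ℝ, 0 < h₁ ∧
      ∀ h : ℝ, 0 < h → h < h₁ → 2 * K * h ^ 2 < δ ∧ ∀ T : Triangulation m,
        T.MeshSizeLE h → T.ShapeRegular σ → T.BoundaryVerticesOn Ω → T.GraphCompatible 𝒜 →
        T.discreteBoundary ⊆ tube Ω (K * h ^ 2) →
        ∃ P : Fin 𝒜.M → Set (Euc (m + 1)), T.discreteBoundary = ⋃ r, P r ∧
          ∀ r, IsTangentialPatch Ω Λ (P r) := by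
  obtain ⟨c₀, hc₀, hcv⟩ := 𝒜.exists_abs_inner_vert_ge
  obtain ⟨ε, hε, hleb⟩ := 𝒜.exists_lebesgue_number hb
  obtain ⟨G, hG⟩ := 𝒜.exists_abs_φ_sub_le
  have hL := hT.L_pos
  have hδ := hT.δ_pos
  set c := min c₀ 1 with hc
  have hc0 : 0 < c := lt_min hc₀ one_pos
  have hc1 : c ≤ 1 := min_le_right _ _
  have hcv' : ∀ r, ∀ y ∈ frontier Ω, y ∈ 𝒜.U r →
      c ≤ |inner ℝ (outerNormal Ω y) (𝒜.vert r)| :=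
    fun r y hy hU => (min_le_left _ _).trans (hcv r y hy hU)
  -- The patch constant is fixed before σ and K are introduced; these enter only through the
  -- threshold h₁.
  refine ⟨1 + Real.toNNReal (5 / c), fun σ hσ K hK => ?_⟩
  set fc := Triangulation.faceConst m L σ with hfc
  have hfc0 : 0 < fc := by rw [hfc, Triangulation.faceConst]; positivity
  have key : ∃ h₁ > 0, h₁ ≤ 1 ∧ 2 * K * h₁ ≤ δ ∧ K * h₁ ≤ ε ∧ (1 + G) * (K * h₁) ≤ c / (2 * L) ∧
      2 * (K * h₁) / c ≤ c / (4 * L) ∧ L * (K * h₁ + 2 * (K * h₁) / c) ≤ c / 2 ∧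
      fc * h₁ ≤ c / 4 ∧ fc * h₁ * (1 + 5 / c) ≤ 1 / 2 := by
    have ev : ∀ (a b : ℝ), 0 < b → ∀ᶠ t in 𝓝[>] (0 : ℝ), a * t ≤ b := by
      intro a b hb
      have h1 : Tendsto (fun t : ℝ => a * t) (𝓝[>] 0) (𝓝 0) := by
        have : Continuous fun t : ℝ => a * t := by fun_prop
        simpa using (this.tendsto 0).mono_left nhdsWithin_le_nhds
      filter_upwards [h1.eventually (gt_mem_nhds hb)] with t ht using ht.le
    have hall := (ev 1 1 one_pos).and <| (ev (2 * K) δ hδ).and <| (ev K ε hε).and <|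
      (ev ((1 + G) * K) (c / (2 * L)) (by positivity)).and <|
      (ev (2 * K / c) (c / (4 * L)) (by positivity)).and <|
      (ev (L * (K + 2 * K / c)) (c / 2) (by positivity)).and <|
      (ev fc (c / 4) (by positivity)).and <|
      (ev (fc * (1 + 5 / c)) (1 / 2) (by positivity)).and self_mem_nhdsWithin
    obtain ⟨t, h1, h2, h3, h4, h5, h6, h7, h8, h9⟩ := hall.exists
    refine ⟨t, h9, by linarith, h2, h3, by linarith, ?_, ?_, h7, by linarith⟩
    · refine le_trans (le_of_eq ?_) h5; ring
    · refine le_trans (le_of_eq ?_) h6; ring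
  obtain ⟨h₁, h1pos, k1, k2, k3, k4, k5, k6, k7, k8⟩ := key
  refine ⟨h₁, h1pos, fun h hh hlt => ?_⟩
  -- The smallness conditions are stated linearly in h₁; h₁ ≤ 1 gives h² ≤ h₁.
  have hsq : K * h ^ 2 ≤ K * h₁ := by
    have : h ^ 2 ≤ h₁ := by nlinarith
    gcongr
  have hsq' : 2 * K * h ^ 2 < δ := by
    have : h ^ 2 < h₁ := by nlinarith
    calc 2 * K * h ^ 2 < 2 * K * h₁ := by gcongr
      _ ≤ δ := k2
  refine ⟨hsq', fun T hmesh hshape hvert hgraph htube => ?_⟩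
  have hK0 : 0 < K * h ^ 2 := by positivity
  have htube' : T.discreteBoundary ⊆ tube Ω (K * h₁) := htube.trans (tube_mono Ω hsq)
  refine ⟨fun r => T.discreteBoundary ∩ 𝒜.nearZone r (c / (2 * L)), ?_, fun r => ?_⟩
  · rw [← inter_iUnion, eq_comm, inter_eq_left]
    intro x hx
    exact mem_iUnion.2 (𝒜.mem_nearZone_of_mem_tube hT hG hleb k3 k4 (htube' hx))
  · refine T.isTangentialPatch_nearZone 𝒜 hT hσ hh hc0 hc1 hcv' hmesh hshape hvert hgraph htube'
      (by linarith) k5 k6 ?_ ?_ r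
    · exact le_trans (by gcongr) k7
    · exact le_trans (by gcongr) k8

/-! ### Integration over surfaces along normal segments -/

theorem euclideanHausdorffMeasure_image_le {X Y : Type*} [MetricSpace X] [MeasurableSpace X]
    [BorelSpace X] [MetricSpace Y] [MeasurableSpace Y] [BorelSpace Y] {K : ℝ≥0} {f : X → Y}
    {s : Set X} (h : LipschitzOnWith K f s) (d : ℕ) :
    μHE[d] (f '' s) ≤ (K : ℝ≥0∞) ^ d * μHE[d] s := by
  simp only [Measure.euclideanHausdorffMeasure_def, Measure.smul_apply, Measure.nnreal_smul_coe_apply]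
  have := h.hausdorffMeasure_image_le (d := d) (Nat.cast_nonneg d)
  rw [ENNReal.rpow_natCast] at this
  calc _ ≤ _ := mul_le_mul_right this _
    _ = _ := by ring

/-- The inverse on the image is K-Lipschitz. This bound stands in for the area formula: it needs
neither differentiability of f nor measurability of s. -/
theorem euclideanHausdorffMeasure_le_image {X Y : Type*} [MetricSpace X] [MeasurableSpace X]
    [BorelSpace X] [MetricSpace Y] [MeasurableSpace Y] [BorelSpace Y] {K : ℝ≥0} {f : X → Y}
    {s : Set X} (h : ∀ x ∈ s, ∀ y ∈ s, dist x y ≤ K * dist (f x) (f y)) (d : ℕ) :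
    μHE[d] s ≤ (K : ℝ≥0∞) ^ d * μHE[d] (f '' s) := by
  rcases isEmpty_or_nonempty X with hX | hX
  · simp [Set.eq_empty_of_isEmpty s]
  have hinj : InjOn f s := fun x hx y hy hxy => by
    have := h x hx y hy
    rw [hxy, dist_self, mul_zero] at this
    exact dist_le_zero.1 this
  have hl : LeftInvOn (Function.invFunOn f s) f s := hinj.leftInvOn_invFunOn
  have hlip : LipschitzOnWith K (Function.invFunOn f s) (f '' s) := by
    refine LipschitzOnWith.of_dist_le_mul ?_
    rintro _ ⟨x, hx, rfl⟩ _ ⟨y, hy, rfl⟩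
    rw [hl hx, hl hy]; exact h x hx y hy
  have := euclideanHausdorffMeasure_image_le hlip d
  rwa [hl.image_image] at this

section Patch

variable {m : ℕ} {Ω : Set (Euc (m + 1))} {L δ : ℝ} {π ν : Euc (m + 1) → Euc (m + 1)}

/-- Split x - z into the difference of the projections, the difference of the distances along the
normal, and the turning of the normal. The second part is at most half of |x - z| and the third at
most half of |π x - π z|, which leaves the factor 3. -/
theorem IsNormalTube.norm_sub_le_of_tangential (hT : IsNormalTube Ω L δ π ν)
    {x z : Euc (m + 1)} (hx : x ∈ tube Ω δ) (hz : z ∈ tube Ω δ)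
    (hd : |sgnDist Ω x - sgnDist Ω z| ≤ 1 / 2 * ‖x - z‖) : ‖x - z‖ ≤ 3 * ‖π x - π z‖ := by
  obtain ⟨hπx, ex⟩ := hT.isOrthProj x hx
  obtain ⟨hπz, ez⟩ := hT.isOrthProj z hz
  have e : x - z = (π x - π z) + (sgnDist Ω x - sgnDist Ω z) • outerNormal Ω (π x) +
      sgnDist Ω z • (outerNormal Ω (π x) - outerNormal Ω (π z)) := by
    nth_rw 1 [ex, ez]; module
  have h1 : ‖(sgnDist Ω x - sgnDist Ω z) • outerNormal Ω (π x)‖ ≤ 1 / 2 * ‖x - z‖ := by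
    rw [norm_smul, hT.norm_normal _ hπx, mul_one]; exact hd
  have h2 : ‖sgnDist Ω z • (outerNormal Ω (π x) - outerNormal Ω (π z))‖ ≤
      1 / 2 * ‖π x - π z‖ := by
    rw [norm_smul]
    calc _ ≤ δ * (L * ‖π x - π z‖) := mul_le_mul (le_of_lt hz)
          (hT.norm_normal_sub_le _ hπx _ hπz) (norm_nonneg _) hT.δ_pos.le
      _ = δ * L * ‖π x - π z‖ := by ring
      _ ≤ _ := by have := hT.δ_mul_L; gcongr
  have h3 : ‖x - z‖ ≤ ‖π x - π z‖ + 1 / 2 * ‖x - z‖ + 1 / 2 * ‖π x - π z‖ := by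
    nth_rw 1 [e]
    exact (norm_add_le _ _).trans (add_le_add ((norm_add_le _ _).trans (by gcongr)) h2)
  linarith

theorem IsNormalTube.normal_line_tube (hT : IsNormalTube Ω L δ π ν) {x : Euc (m + 1)}
    (hx : x ∈ tube Ω δ) {s : ℝ} (hs : |s| < δ) :
    π (π x + s • ν x) = π x ∧ sgnDist Ω (π x + s • ν x) = s := by
  rw [hT.ν_eq x hx]
  exact hT.normal_line _ (hT.isOrthProj x hx).1 s hs

/-- The integral of `ψ` along the normal segment of half-length `a` through `π x`. -/
noncomputable def segIntegral (π ν : Euc (m + 1) → Euc (m + 1)) (a : ℝ) (ψ : Euc (m + 1) → ℝ≥0∞)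
    (x : Euc (m + 1)) : ℝ≥0∞ := ∫⁻ s in Ioo (-a) a, ψ (π x + s • ν x)

theorem IsNormalTube.measurable_segIntegral (hT : IsNormalTube Ω L δ π ν) {a : ℝ}
    {ψ : Euc (m + 1) → ℝ≥0∞} (hψ : Measurable ψ) : Measurable (segIntegral π ν a ψ) := by
  have h1 : Continuous fun p : Euc (m + 1) × ℝ => π p.1 + p.2 • ν p.1 := by
    have := hT.continuous_π
    have := hT.continuous_ν
    fun_prop
  exact (hψ.comp h1.measurable).lintegral_prod_right'

theorem IsTangentialPatch.restrict_le {Λ : ℝ≥0} {D : Set (Euc m)} {X : Euc m → Euc (m + 1)}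
    (hX : LipschitzWith Λ X) :
    μHE[m].restrict (X '' D) ≤ ((Λ : ℝ≥0∞) ^ m) • (volume.restrict D).map X := by
  refine Measure.le_iff.2 fun B hB => ?_
  rw [Measure.restrict_apply hB, Measure.smul_apply, Measure.map_apply hX.continuous.measurable hB,
    Measure.restrict_apply (hX.continuous.measurable hB), smul_eq_mul, inter_comm,
    ← image_inter_preimage, inter_comm]
  rw [← EuclideanSpace.euclideanHausdorffMeasure_eq_volume m]
  exact euclideanHausdorffMeasure_image_le hX.lipschitzOnWith m

/-- The parameters can be recovered from Θ(w, s): its projection is π(X w) and its signed distance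
is s. Hence |w - z| ≤ 3|π(X w) - π(X z)| ≤ 12|Θ - Θ'| and |s - t| ≤ |Θ - Θ'|, so the inverse is
Lipschitz with constant 13 and preimages have controlled volume. -/
theorem IsNormalTube.map_normal_segments_le (hT : IsNormalTube Ω L δ π ν) {D : Set (Euc m)}
    {X : Euc m → Euc (m + 1)} (hD : MeasurableSet D) (hXc : Continuous X)
    (hXtube : ∀ w ∈ D, X w ∈ tube Ω δ)
    (hmono : ∀ w ∈ D, ∀ z ∈ D, ‖w - z‖ ≤ ‖X w - X z‖)
    (hd : ∀ w ∈ D, ∀ z ∈ D, |sgnDist Ω (X w) - sgnDist Ω (X z)| ≤ 1 / 2 * ‖X w - X z‖)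
    {a : ℝ} (ha : a ≤ δ) :
    ((volume.restrict D).prod (volume.restrict (Ioo (-a) a))).map
      (fun p : Euc m × ℝ => π (X p.1) + p.2 • ν (X p.1)) ≤
      ((13 : ℝ≥0) : ℝ≥0∞) ^ (m + 1) • volume.restrict (tube Ω a) := by
  set Θ : Euc m × ℝ → Euc (m + 1) := fun p => π (X p.1) + p.2 • ν (X p.1) with hΘ
  have hΘc : Continuous Θ := by
    have := hT.continuous_π
    have := hT.continuous_ν
    fun_prop
  have hΘd : ∀ p ∈ D ×ˢ Ioo (-a) a, π (Θ p) = π (X p.1) ∧ sgnDist Ω (Θ p) = p.2 := by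
    rintro ⟨w, s⟩ ⟨hw, hs⟩
    exact hT.normal_line_tube (hXtube w hw) (lt_of_lt_of_le (abs_lt.2 hs) ha)
  have hΘtube : ∀ p ∈ D ×ˢ Ioo (-a) a, Θ p ∈ tube Ω a := by
    intro p hp
    change |sgnDist Ω (Θ p)| < a
    rw [(hΘd p hp).2]; exact abs_lt.2 hp.2
  have hanti : ∀ p ∈ D ×ˢ Ioo (-a) a, ∀ q ∈ D ×ˢ Ioo (-a) a,
      ‖p.1 - q.1‖ + |p.2 - q.2| ≤ 13 * ‖Θ p - Θ q‖ := by
    intro p hp q hq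
    obtain ⟨e1, e2⟩ := hΘd p hp
    obtain ⟨e3, e4⟩ := hΘd q hq
    have h1 := hT.norm_π_sub_le _ (tube_mono Ω ha (hΘtube p hp)) _ (tube_mono Ω ha (hΘtube q hq))
    have h2 := abs_sgnDist_sub_le Ω (Θ p) (Θ q)
    rw [e1, e3] at h1
    rw [e2, e4, dist_eq_norm] at h2
    have h3 := hT.norm_sub_le_of_tangential (hXtube _ hp.1) (hXtube _ hq.1) (hd _ hp.1 _ hq.1)
    have h4 := hmono _ hp.1 _ hq.1
    linarith
  refine Measure.le_iff.2 fun B hB => ?_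
  rw [Measure.map_apply hΘc.measurable hB, Measure.prod_restrict, ← Measure.volume_eq_prod,
    Measure.restrict_apply (hΘc.measurable hB), Measure.smul_apply, Measure.restrict_apply hB,
    smul_eq_mul]
  set A := Θ ⁻¹' B ∩ D ×ˢ Ioo (-a) a with hA
  have hAm : MeasurableSet A := (hΘc.measurable hB).inter (hD.prod measurableSet_Ioo)
  -- The product carries the maximum norm; passing to the L² product makes volume the Euclidean
  -- Hausdorff measure of dimension m + 1.
  rw [← (WithLp.volume_preserving_ofLp (Euc m) ℝ).measure_preimage hAm.nullMeasurableSet]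
  have hfin : Module.finrank ℝ (WithLp 2 (Euc m × ℝ)) = m + 1 := by
    rw [(WithLp.linearEquiv 2 ℝ (Euc m × ℝ)).finrank_eq]; simp
  rw [← InnerProductSpace.euclideanHausdorffMeasure_eq_volume, hfin]
  have h1 := euclideanHausdorffMeasure_le_image (K := 13)
    (f := fun p : WithLp 2 (Euc m × ℝ) => Θ (WithLp.ofLp p)) (s := WithLp.ofLp ⁻¹' A)
    (fun p hp q hq => by
      have h2 := hanti _ hp.2 _ hq.2
      rw [dist_eq_norm, dist_eq_norm]
      refine le_trans ?_ h2
      refine le_of_sq_le_sq ?_ (by positivity)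
      rw [WithLp.prod_norm_sq_eq_of_L2, add_sq, sq_abs]
      have h3 : ‖(p - q).snd‖ ^ 2 = (p.ofLp.2 - q.ofLp.2) ^ 2 := by
        rw [Real.norm_eq_abs, sq_abs]; rfl
      have h4 : ‖(p - q).fst‖ = ‖p.ofLp.1 - q.ofLp.1‖ := rfl
      rw [h3, h4]
      have : 0 ≤ ‖p.ofLp.1 - q.ofLp.1‖ * |p.ofLp.2 - q.ofLp.2| := by positivity
      linarith) (m + 1)
  refine h1.trans ?_
  rw [EuclideanSpace.euclideanHausdorffMeasure_eq_volume (m + 1)]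
  gcongr
  rintro _ ⟨p, hp, rfl⟩
  exact ⟨hp.1, hΘtube _ hp.2⟩

theorem IsTangentialPatch.lintegral_segIntegral_le (hT : IsNormalTube Ω L δ π ν) {Λ : ℝ≥0}
    {P : Set (Euc (m + 1))} (hP : IsTangentialPatch Ω Λ P) (hPδ : P ⊆ tube Ω δ) {a : ℝ}
    (ha : a ≤ δ) {ψ : Euc (m + 1) → ℝ≥0∞} (hψ : Measurable ψ) :
    ∫⁻ x in P, segIntegral π ν a ψ x ∂μHE[m] ≤
      ((Λ ^ m * 13 ^ (m + 1) : ℝ≥0) : ℝ≥0∞) * ∫⁻ x in tube Ω a, ψ x := by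
  obtain ⟨D, X, hD, hX, rfl, hmono, hd⟩ := hP
  have hm := hT.measurable_segIntegral (a := a) hψ
  have hΘc : Continuous fun p : Euc m × ℝ => π (X p.1) + p.2 • ν (X p.1) := by
    have := hT.continuous_π
    have := hT.continuous_ν
    have := hX.continuous
    fun_prop
  calc ∫⁻ x in X '' D, segIntegral π ν a ψ x ∂μHE[m]
      ≤ ∫⁻ x, segIntegral π ν a ψ x ∂(((Λ : ℝ≥0∞) ^ m) • (volume.restrict D).map X) :=
        lintegral_mono' (IsTangentialPatch.restrict_le hX) le_rfl
    _ = (Λ : ℝ≥0∞) ^ m * ∫⁻ w in D, segIntegral π ν a ψ (X w) := by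
        rw [lintegral_smul_measure, lintegral_map hm hX.continuous.measurable, smul_eq_mul]
    _ = (Λ : ℝ≥0∞) ^ m * ∫⁻ p, ψ (π (X p.1) + p.2 • ν (X p.1))
          ∂((volume.restrict D).prod (volume.restrict (Ioo (-a) a))) := by
        congr 1
        exact (lintegral_prod _ (hψ.comp hΘc.measurable).aemeasurable).symm
    _ = (Λ : ℝ≥0∞) ^ m * ∫⁻ x, ψ x ∂((volume.restrict D).prod (volume.restrict (Ioo (-a) a))).map
          (fun p : Euc m × ℝ => π (X p.1) + p.2 • ν (X p.1)) := by
        rw [lintegral_map hψ hΘc.measurable]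
    _ ≤ (Λ : ℝ≥0∞) ^ m *
          ∫⁻ x, ψ x ∂(((13 : ℝ≥0) : ℝ≥0∞) ^ (m + 1) • volume.restrict (tube Ω a)) := by
        gcongr
        exact hT.map_normal_segments_le hD hX.continuous
          (fun w hw => hPδ (mem_image_of_mem X hw)) hmono hd ha
    _ = _ := by
        rw [lintegral_smul_measure, smul_eq_mul]; push_cast; ring

theorem IsTangentialPatch.measure_inter_preimage_le (hT : IsNormalTube Ω L δ π ν) {Λ : ℝ≥0}
    {P : Set (Euc (m + 1))} (hP : IsTangentialPatch Ω Λ P) (hPδ : P ⊆ tube Ω δ)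
    (B : Set (Euc (m + 1))) :
    μHE[m] (P ∩ π ⁻¹' B) ≤ ((3 : ℝ≥0) : ℝ≥0∞) ^ m * μHE[m] (B ∩ frontier Ω) := by
  obtain ⟨D, X, hD, hX, rfl, hmono, hd⟩ := hP
  refine (euclideanHausdorffMeasure_le_image (K := 3) (f := π) ?_ m).trans ?_
  · rintro _ ⟨⟨w, hw, rfl⟩, -⟩ _ ⟨⟨z, hz, rfl⟩, -⟩
    rw [dist_eq_norm, dist_eq_norm]
    exact hT.norm_sub_le_of_tangential (hPδ (mem_image_of_mem X hw)) (hPδ (mem_image_of_mem X hz))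
      (hd w hw z hz)
  · gcongr
    rintro _ ⟨x, ⟨hx, hxB⟩, rfl⟩
    exact ⟨hxB, (hT.isOrthProj x (hPδ hx)).1⟩

/-- A compact hypersurface in the tube for which integrals along normal segments are controlled by
volume integrals, and whose surface measure is controlled by that of the boundary. -/
structure IsTubeSurface (Ω : Set (Euc (m + 1))) (δ : ℝ) (π ν : Euc (m + 1) → Euc (m + 1))
    (c : ℝ≥0) (S : Set (Euc (m + 1))) : Prop where
  isCompact : IsCompact S
  subset_tube : S ⊆ tube Ω δ
  lintegral_le : ∀ a ≤ δ, ∀ ψ : Euc (m + 1) → ℝ≥0∞, Measurable ψ →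
    ∫⁻ x in S, segIntegral π ν a ψ x ∂μHE[m] ≤ c * ∫⁻ x in tube Ω a, ψ x
  map_le : (μHE[m].restrict S).map π ≤ (c : ℝ≥0∞) • μHE[m].restrict (frontier Ω)

/-- The constant of a surface made of `M` patches. -/
noncomputable def surfaceConst (m M : ℕ) (Λ : ℝ≥0) : ℝ≥0 := M * (Λ ^ m * 13 ^ (m + 1) + 3 ^ m)

theorem isTubeSurface_of_patches (hT : IsNormalTube Ω L δ π ν) {Λ : ℝ≥0} {M : ℕ}
    {P : Fin M → Set (Euc (m + 1))} {S : Set (Euc (m + 1))} (hS : IsCompact S)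
    (hSδ : S ⊆ tube Ω δ) (hSP : S = ⋃ r, P r) (hP : ∀ r, IsTangentialPatch Ω Λ (P r)) :
    IsTubeSurface Ω δ π ν (surfaceConst m M Λ) S := by
  have hPδ : ∀ r, P r ⊆ tube Ω δ := fun r =>
    (subset_iUnion P r).trans (hSP ▸ hSδ)
  refine ⟨hS, hSδ, fun a ha ψ hψ => ?_, ?_⟩
  · rw [hSP]
    refine (lintegral_iUnion_le _ _).trans ?_
    rw [tsum_fintype]
    refine (Finset.sum_le_sum fun r _ =>
      IsTangentialPatch.lintegral_segIntegral_le hT (hP r) (hPδ r) ha hψ).trans ?_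
    rw [Finset.sum_const, Finset.card_univ, Fintype.card_fin, nsmul_eq_mul, ← mul_assoc]
    gcongr
    unfold surfaceConst
    push_cast
    gcongr
    exact le_self_add
  · refine Measure.le_iff.2 fun B hB => ?_
    rw [Measure.map_apply hT.continuous_π.measurable hB, Measure.smul_apply,
      Measure.restrict_apply hB, Measure.restrict_apply (hT.continuous_π.measurable hB),
      hSP, inter_comm, iUnion_inter]
    refine (measure_iUnion_le _).trans ?_
    rw [tsum_fintype]
    refine (Finset.sum_le_sum fun r _ =>
      IsTangentialPatch.measure_inter_preimage_le hT (hP r) (hPδ r) B).trans ?_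
    rw [Finset.sum_const, Finset.card_univ, Fintype.card_fin, nsmul_eq_mul, ← mul_assoc,
      smul_eq_mul]
    gcongr
    unfold surfaceConst
    push_cast
    gcongr
    exact le_add_self

end Patch

/-! ### Approximation by smooth functions -/

section Mollify

variable {n : ℕ} {V : Type*} [NormedAddCommGroup V]

/-- Translation is continuous in `L¹`. -/
theorem tendsto_lintegral_translate_sub {h : Euc n → V} (hh : Integrable h) :
    Tendsto (fun t => ∫⁻ x, ‖h (x - t) - h x‖ₑ) (𝓝 0) (𝓝 0) := by
  have hL : MemLp h 1 volume := memLp_one_iff_integrable.2 hh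
  let g : C(Euc n, C(Euc n, Euc n)) :=
    (ContinuousMap.mk (fun p : Euc n × Euc n => p.2 - p.1) (by fun_prop)).curry
  have hg : ∀ t x, g t x = x - t := fun t x => rfl
  have hgm : ∀ t, MeasurePreserving (g t) (volume : Measure (Euc n)) volume := fun t =>
    measurePreserving_sub_right volume t
  have h1 : Continuous fun t => Lp.compMeasurePreserving (g t) (hgm t) (hL.toLp h) :=
    continuous_const.compMeasurePreservingLp g.continuous hgm ENNReal.one_ne_top
  have h2 := (h1.tendsto 0).edist tendsto_const_nhds (b := Lp.compMeasurePreserving (g 0) (hgm 0)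
    (hL.toLp h))
  rw [edist_self] at h2
  refine h2.congr fun t => ?_
  rw [Lp.toLp_compMeasurePreserving hL (hgm t), Lp.toLp_compMeasurePreserving hL (hgm 0),
    Lp.edist_toLp_toLp, eLpNorm_one_eq_lintegral_enorm]
  simp [hg]

/-- The mollification error is a weighted average of translation errors over the support of the
kernel; Tonelli moves the L¹ norm inside the average. -/
theorem lintegral_mollify_sub_le [NormedSpace ℝ V] [CompleteSpace V] (ρ : ContDiffBump (0 : Euc n)) {h : Euc n → V}
    (hh : Integrable h) {B : ℝ≥0∞}
    (hB : ∀ t, ‖t‖ < ρ.rOut → ∫⁻ x, ‖h (x - t) - h x‖ₑ ≤ B) :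
    ∫⁻ x, ‖(∫ t, ρ.normed volume (x - t) • h t) - h x‖ₑ ≤ B := by
  -- Tonelli needs joint measurability of h(x - t) - h(x), which a strongly measurable
  -- representative provides.
  wlog hsm : StronglyMeasurable h generalizing h
  · have hae := hh.1.ae_eq_mk
    have hmk := this (hh.congr hae) (fun t ht => by
      refine le_trans (le_of_eq ?_) (hB t ht)
      refine lintegral_congr_ae ?_
      have h1 := (measurePreserving_sub_right volume t).quasiMeasurePreserving.ae_eq_comp hae
      filter_upwards [hae, h1] with x hx hx1
      simp only [Function.comp_apply] at hx1
      rw [hx, hx1]) hh.1.stronglyMeasurable_mk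
    refine le_trans (le_of_eq ?_) hmk
    refine lintegral_congr_ae ?_
    filter_upwards [hae] with x hx
    rw [hx]
    congr 2
    refine integral_congr_ae ?_
    filter_upwards [hae] with t ht
    rw [ht]
  have hρm : Measurable (ρ.normed volume) := ρ.continuous_normed.measurable
  have hpt : ∀ x, ‖(∫ t, ρ.normed volume (x - t) • h t) - h x‖ₑ ≤
      ∫⁻ t, ENNReal.ofReal (ρ.normed volume t) * ‖h (x - t) - h x‖ₑ := by
    intro x
    have hex := (ρ.hasCompactSupport_normed (μ := volume)).convolutionExists_left
      (ContinuousLinearMap.lsmul ℝ ℝ) ρ.continuous_normed hh.locallyIntegrable x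
    have e1 : (∫ t, ρ.normed volume (x - t) • h t) = ∫ t, ρ.normed volume t • h (x - t) := by
      rw [← convolution_lsmul_swap]; rfl
    have e2 : h x = ∫ t, ρ.normed volume t • h x := by
      rw [integral_smul_const, ρ.integral_normed, one_smul]
    have e3 : (∫ t, ρ.normed volume (x - t) • h t) - h x =
        ∫ t, ρ.normed volume t • (h (x - t) - h x) := by
      simp_rw [smul_sub]
      have hex' : Integrable fun t => ρ.normed volume t • h (x - t) := hex
      rw [integral_sub hex' (ρ.integrable_normed.smul_const _), ← e1, ← e2]
    rw [e3]
    refine (enorm_integral_le_lintegral_enorm _).trans (le_of_eq ?_)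
    refine lintegral_congr fun t => ?_
    rw [enorm_smul, Real.enorm_of_nonneg (ρ.nonneg_normed t)]
  have hmeas : Measurable fun p : Euc n × Euc n => ‖h (p.1 - p.2) - h p.1‖ₑ := by
    have h1 : StronglyMeasurable fun p : Euc n × Euc n => h (p.1 - p.2) - h p.1 :=
      (hsm.comp_measurable (measurable_fst.sub measurable_snd)).sub
        (hsm.comp_measurable measurable_fst)
    exact h1.enorm
  calc ∫⁻ x, ‖(∫ t, ρ.normed volume (x - t) • h t) - h x‖ₑ
      ≤ ∫⁻ x, ∫⁻ t, ENNReal.ofReal (ρ.normed volume t) * ‖h (x - t) - h x‖ₑ :=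
        lintegral_mono hpt
    _ = ∫⁻ t, ∫⁻ x, ENNReal.ofReal (ρ.normed volume t) * ‖h (x - t) - h x‖ₑ := by
        refine lintegral_lintegral_swap ?_
        exact ((hρm.comp measurable_snd).ennreal_ofReal.mul hmeas).aemeasurable
    _ ≤ ∫⁻ t, ENNReal.ofReal (ρ.normed volume t) * B := by
        refine lintegral_mono fun t => ?_
        simp only
        have hm : Measurable fun x => ‖h (x - t) - h x‖ₑ := hmeas.comp measurable_prodMk_right
        rw [lintegral_const_mul _ hm]
        by_cases ht : ‖t‖ < ρ.rOut
        · gcongr; exact hB t ht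
        · have : ρ.normed volume t = 0 := by
            rw [← Function.notMem_support, ρ.support_normed_eq]
            simpa using ht
          simp [this]
    _ = B := by
        rw [lintegral_mul_const _ hρm.ennreal_ofReal,
          ← ofReal_integral_eq_lintegral_ofReal ρ.integrable_normed
            (Eventually.of_forall ρ.nonneg_normed), ρ.integral_normed]
        simp

end Mollify

theorem inner_gradient {n : ℕ} (u : Euc n → ℝ) (x v : Euc n) :
    inner ℝ (gradient u x) v = fderiv ℝ u x v := by
  rw [gradient, InnerProductSpace.toDual_symm_apply]

theorem w1pNorm_mono {n : ℕ} {G G' : Set (Euc n)} (h : G ⊆ G') (p : ℝ≥0∞) (f : Euc n → ℝ)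
    (F : Euc n → Euc n) : w1pNorm G p f F ≤ w1pNorm G' p f F :=
  add_le_add (eLpNorm_mono_measure _ (Measure.restrict_mono h le_rfl))
    (eLpNorm_mono_measure _ (Measure.restrict_mono h le_rfl))

/-- The mollification of a weakly differentiable function has the mollified weak gradient as its
gradient. -/
theorem gradient_mollify {n : ℕ} {G K' : Set (Euc n)} {f : Euc n → ℝ} {F : Euc n → Euc n}
    (hW : HasWeakGradient G f F) (hG : MeasurableSet G) (hK' : IsCompact K') (hKG : K' ⊆ G)
    (ρ : ContDiffBump (0 : Euc n)) {x : Euc n} (hx : Metric.closedBall x ρ.rOut ⊆ K') :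
    gradient (fun x => ∫ t, ρ.normed volume (x - t) • K'.indicator f t) x =
      ∫ t, ρ.normed volume (x - t) • K'.indicator F t := by
  obtain ⟨hf, hF, hw⟩ := hW
  set k := ρ.normed (volume : Measure (Euc n)) with hk
  have hkc : ContDiff ℝ ∞ k := ρ.contDiff_normed
  have hk1 : ContDiff ℝ 1 k := hkc.of_le (by exact_mod_cast le_top)
  have hks : HasCompactSupport k := ρ.hasCompactSupport_normed
  have hfK : Integrable (K'.indicator f) :=
    (integrable_indicator_iff hK'.measurableSet).2 (hf.integrableOn_compact_subset hKG hK')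
  have hFK : Integrable (K'.indicator F) :=
    (integrable_indicator_iff hK'.measurableSet).2 (hF.integrableOn_compact_subset hKG hK')
  have hkd : ∀ y v, fderiv ℝ (fun y => k (x - y)) y v = -fderiv ℝ k (x - y) v := by
    intro y v
    have h1 : HasFDerivAt (fun y => x - y) (-ContinuousLinearMap.id ℝ (Euc n)) y := by
      simpa using (hasFDerivAt_id y).const_sub x
    have h2 : HasFDerivAt k (fderiv ℝ k (x - y)) (x - y) :=
      (hk1.differentiable one_ne_zero _).hasFDerivAt
    have h3 : HasFDerivAt (fun y => k (x - y)) _ y := h2.comp y h1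
    rw [h3.fderiv]
    simp
  have hsupp : ∀ y ∉ K', k (x - y) = 0 ∧ fderiv ℝ k (x - y) = 0 := by
    intro y hy
    have h1 : x - y ∉ tsupport k := by
      rw [hk, ρ.tsupport_normed_eq]
      intro h
      refine hy (hx ?_)
      rw [Metric.mem_closedBall, dist_comm, dist_eq_norm]
      simpa using h
    refine ⟨image_eq_zero_of_notMem_tsupport h1, ?_⟩
    by_contra h2
    exact h1 (support_fderiv_subset ℝ h2)
  have hind : ∀ (a : Euc n → ℝ), (∀ y ∉ K', a y = 0) → ∀ (b : Euc n → ℝ),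
      ∫ y in G, b y * a y = ∫ y, K'.indicator b y * a y := by
    intro a ha b
    rw [← integral_indicator hG]
    congr 1
    ext y
    by_cases hy : y ∈ K'
    · rw [indicator_of_mem hy, indicator_of_mem (hKG hy)]
    · by_cases hyG : y ∈ G <;> simp [hyG, hy, ha y hy]
  refine ext_inner_right ℝ fun v => ?_
  rw [inner_gradient]
  have hconv : (fun x => ∫ t, k (x - t) • K'.indicator f t) =
      convolution (K'.indicator f) k (ContinuousLinearMap.lsmul ℝ ℝ) volume := by
    ext z
    rw [convolution_def]
    congr 1; ext t
    simp [mul_comm]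
  rw [hconv, (hks.hasFDerivAt_convolution_right (ContinuousLinearMap.lsmul ℝ ℝ)
    hfK.locallyIntegrable hk1 x).fderiv,
    convolution_precompR_apply _ hfK.locallyIntegrable (hks.fderiv ℝ)
      (hk1.continuous_fderiv one_ne_zero), convolution_def]
  -- The reflected kernel centred at x is the test function. Its support lies in K', so the cut-off
  -- by the indicator contributes no boundary term.
  have hη := hw (fun y => k (x - y)) (hkc.comp (by fun_prop))
    (hks.comp_homeomorph (Homeomorph.subLeft x)) (by
      refine subset_trans (closure_minimal ?_ hK'.isClosed) hKG
      intro y hy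
      by_contra hyK
      exact hy (hsupp y hyK).1) v
  simp only [hkd] at hη
  rw [hind (fun y => -fderiv ℝ k (x - y) v) (fun y hy => by simp [(hsupp y hy).2]) f,
    hind (fun y => k (x - y)) (fun y hy => (hsupp y hy).1) (fun y => inner ℝ (F y) v)] at hη
  simp only [mul_neg, integral_neg, neg_inj] at hη
  simp only [ContinuousLinearMap.lsmul_apply, smul_eq_mul]
  rw [hη]
  have hint : Integrable (fun t => k (x - t) • K'.indicator F t) := by
    have hex := hks.convolutionExists_left (ContinuousLinearMap.lsmul ℝ ℝ) hk1.continuous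
      hFK.locallyIntegrable x
    have := hex.integrable_swap
    simpa using this
  rw [real_inner_comm, ← integral_inner hint]
  congr 1; ext t
  rw [inner_smul_right]
  by_cases ht : t ∈ K'
  · simp only [indicator_of_mem ht]
    rw [real_inner_comm, mul_comm]
  · simp [ht]

theorem exists_smooth_approx_on {n : ℕ} {G K : Set (Euc n)} {f : Euc n → ℝ} {F : Euc n → Euc n}
    (hW : HasWeakGradient G f F) (hG : IsOpen G) (hK : IsCompact K) (hKG : K ⊆ G) {η : ℝ≥0∞}
    (hη : η ≠ 0) : ∃ u : Euc n → ℝ, ContDiff ℝ ∞ u ∧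
      w1pNorm K 1 (fun x => u x - f x) (fun x => gradient u x - F x) ≤ η := by
  obtain ⟨ε₀, hε₀, hsub⟩ := hK.exists_cthickening_subset_open hG hKG
  set K' := Metric.cthickening ε₀ K with hK'def
  have hK' : IsCompact K' := hK.cthickening
  have hKK' : K ⊆ K' := Metric.self_subset_cthickening K
  have hfK : Integrable (K'.indicator f) :=
    (integrable_indicator_iff hK'.measurableSet).2 (hW.1.integrableOn_compact_subset hsub hK')
  have hFK : Integrable (K'.indicator F) :=
    (integrable_indicator_iff hK'.measurableSet).2 (hW.2.1.integrableOn_compact_subset hsub hK')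
  have hη2 : 0 < η / 2 := ENNReal.half_pos hη
  have e1 := (tendsto_lintegral_translate_sub hfK).eventually (ge_mem_nhds hη2)
  have e2 := (tendsto_lintegral_translate_sub hFK).eventually (ge_mem_nhds hη2)
  obtain ⟨ε₁, hε₁, h12⟩ := Metric.eventually_nhds_iff.1 (e1.and e2)
  set ε := min ε₀ ε₁ with hε
  have hε0 : 0 < ε := lt_min hε₀ hε₁
  let ρ : ContDiffBump (0 : Euc n) := ⟨ε / 2, ε, by linarith, by linarith⟩
  have hρ : ρ.rOut = ε := rfl
  have hb : ∀ t : Euc n, ‖t‖ < ρ.rOut → dist t 0 < ε₁ := fun t ht => by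
    rw [dist_zero_right]; exact lt_of_lt_of_le ht (min_le_right _ _)
  have m1 := lintegral_mollify_sub_le ρ hfK fun t ht => (h12 (hb t ht)).1
  have m2 := lintegral_mollify_sub_le ρ hFK fun t ht => (h12 (hb t ht)).2
  refine ⟨fun x => ∫ t, ρ.normed volume (x - t) • K'.indicator f t, ?_, ?_⟩
  · have hconv : (fun x => ∫ t, ρ.normed volume (x - t) • K'.indicator f t) =
        convolution (ρ.normed volume) (K'.indicator f) (ContinuousLinearMap.lsmul ℝ ℝ) volume := by
      ext z; rw [convolution_lsmul_swap]
    rw [hconv]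
    exact (ρ.hasCompactSupport_normed).contDiff_convolution_left _ ρ.contDiff_normed
      hfK.locallyIntegrable
  · unfold w1pNorm
    rw [eLpNorm_one_eq_lintegral_enorm, eLpNorm_one_eq_lintegral_enorm, ← ENNReal.add_halves η]
    have hball : ∀ x ∈ K, Metric.closedBall x ρ.rOut ⊆ K' := fun x hx =>
      (Metric.closedBall_subset_closedBall (min_le_left _ _)).trans
        (Metric.closedBall_subset_cthickening hx ε₀)
    refine add_le_add ?_ ?_
    · refine le_trans ?_ m1
      refine le_trans (le_of_eq ?_) (setLIntegral_le_lintegral K _)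
      refine setLIntegral_congr_fun hK.measurableSet fun x hx => ?_
      simp only [indicator_of_mem (hKK' hx)]
    · refine le_trans ?_ m2
      refine le_trans (le_of_eq ?_) (setLIntegral_le_lintegral K _)
      refine setLIntegral_congr_fun hK.measurableSet fun x hx => ?_
      simp only [indicator_of_mem (hKK' hx)]
      rw [gradient_mollify hW hG.measurableSet hK' hsub ρ (hball x hx)]

theorem exists_smooth_seq_tube {n : ℕ} {Ω : Set (Euc n)} (hb : Bornology.IsBounded Ω)
    (hne : (frontier Ω).Nonempty) {a : ℝ} {f : Euc n → ℝ} {F : Euc n → Euc n}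
    (hW : HasWeakGradient (tube Ω a) f F) :
    ∃ u : ℕ → Euc n → ℝ, (∀ k, ContDiff ℝ ∞ (u k)) ∧
      ∀ Q : Set (Euc n), IsCompact Q → Q ⊆ tube Ω a →
        Tendsto (fun k => w1pNorm Q 1 (fun x => u k x - f x) (fun x => gradient (u k) x - F x))
          atTop (𝓝 0) := by
  -- Compact subtubes exhausting the tube: every compact Q is eventually contained in them, so one
  -- diagonal sequence serves all Q.
  let Kk : ℕ → Set (Euc n) := fun k => {x | |sgnDist Ω x| ≤ a - 1 / ((k : ℝ) + 1)}
  have hKc : ∀ k, IsCompact (Kk k) := fun k => isCompact_abs_sgnDist_le hb hne _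
  have hKG : ∀ k, Kk k ⊆ tube Ω a := fun k x hx => by
    have : 0 < 1 / ((k : ℝ) + 1) := by positivity
    have h1 : |sgnDist Ω x| ≤ a - 1 / ((k : ℝ) + 1) := hx
    exact lt_of_le_of_lt h1 (by linarith)
  choose u hu hue using fun k : ℕ => exists_smooth_approx_on hW (isOpen_tube Ω a) (hKc k) (hKG k)
    (η := ((k : ℝ≥0∞) + 1)⁻¹) (by simp)
  refine ⟨u, hu, fun Q hQ hQG => ?_⟩
  have hQK : ∀ᶠ k in atTop, Q ⊆ Kk k := by
    rcases Q.eq_empty_or_nonempty with rfl | hQne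
    · simp
    obtain ⟨x₀, hx₀, hmax⟩ := hQ.exists_isMaxOn hQne (continuous_sgnDist Ω).abs.continuousOn
    have h0 : 0 < a - |sgnDist Ω x₀| := sub_pos.2 (hQG hx₀)
    filter_upwards [tendsto_one_div_add_atTop_nhds_zero_nat.eventually (gt_mem_nhds h0)] with k hk
    intro x hx
    have h1 : |sgnDist Ω x| ≤ |sgnDist Ω x₀| := hmax hx
    change |sgnDist Ω x| ≤ a - 1 / ((k : ℝ) + 1)
    linarith
  have hlim : Tendsto (fun k : ℕ => ((k : ℝ≥0∞) + 1)⁻¹) atTop (𝓝 0) := by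
    have := (tendsto_add_atTop_iff_nat 1).2 ENNReal.tendsto_inv_nat_nhds_zero
    refine this.congr fun k => by push_cast; rfl
  refine tendsto_of_tendsto_of_tendsto_of_le_of_le' tendsto_const_nhds hlim
    (Eventually.of_forall fun _ => zero_le) ?_
  filter_upwards [hQK] with k hk
  exact (w1pNorm_mono hk _ _ _).trans (hue k)

/-! ### Traces on hypersurfaces in the tube -/

theorem enorm_sub_le_lintegral_deriv {w w' : ℝ → ℝ} (hw : ∀ t, HasDerivAt w (w' t) t)
    (hc : Continuous w') {b s t : ℝ} (hs : s ∈ Ioo (-b) b) (ht : t ∈ Ioo (-b) b) :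
    ‖w t - w s‖ₑ ≤ ∫⁻ τ in Ioo (-b) b, ‖w' τ‖ₑ := by
  rw [← intervalIntegral.integral_eq_sub_of_hasDerivAt (fun τ _ => hw τ)
    (hc.intervalIntegrable s t)]
  have h1 : ‖∫ τ in s..t, w' τ‖ₑ = ‖∫ τ in uIoc s t, w' τ‖ₑ := by
    rw [← ofReal_norm, ← ofReal_norm, intervalIntegral.norm_intervalIntegral_eq]
  rw [h1]
  refine (enorm_integral_le_lintegral_enorm _).trans (lintegral_mono_set ?_)
  rw [uIoc]
  intro τ hτ
  exact ⟨(lt_min hs.1 ht.1).trans hτ.1, hτ.2.trans_lt (max_lt hs.2 ht.2)⟩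

/-- Approximation is available only on compact subsets of the open tube; the gap between b and a
provides a compact closed subtube around S. -/
theorem exists_lt_subset_tube {n : ℕ} {Ω : Set (Euc n)} {S : Set (Euc n)} (hS : IsCompact S)
    {a : ℝ} (ha : 0 < a) (hSa : S ⊆ tube Ω a) : ∃ b, 0 < b ∧ b < a ∧ S ⊆ tube Ω b := by
  rcases S.eq_empty_or_nonempty with rfl | hne
  · exact ⟨a / 2, by linarith, by linarith, empty_subset _⟩
  obtain ⟨x₀, hx₀, hmax⟩ := hS.exists_isMaxOn hne (continuous_sgnDist Ω).abs.continuousOn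
  have h0 : |sgnDist Ω x₀| < a := hSa hx₀
  have h1 := abs_nonneg (sgnDist Ω x₀)
  refine ⟨(|sgnDist Ω x₀| + a) / 2, by linarith, by linarith, fun x hx => ?_⟩
  have h2 : |sgnDist Ω x| ≤ |sgnDist Ω x₀| := hmax hx
  change |sgnDist Ω x| < _
  linarith

theorem continuous_gradient_of_contDiff {n : ℕ} {u : Euc n → ℝ} (hu : ContDiff ℝ ∞ u) :
    Continuous (gradient u) := by
  have h1 : Continuous (fderiv ℝ u) := hu.continuous_fderiv (by simp)
  exact (InnerProductSpace.toDual ℝ (Euc n)).symm.continuous.comp h1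

theorem gradient_sub_of_contDiff {n : ℕ} {u v : Euc n → ℝ} (hu : ContDiff ℝ ∞ u)
    (hv : ContDiff ℝ ∞ v) (x : Euc n) :
    gradient (fun x => u x - v x) x = gradient u x - gradient v x := by
  have hu1 := (hu.differentiable (by simp)) x
  have hv1 := (hv.differentiable (by simp)) x
  simp only [gradient]
  rw [fderiv_fun_sub hu1 hv1, map_sub]

section Trace

variable {m : ℕ} {Ω : Set (Euc (m + 1))} {L δ : ℝ} {π ν : Euc (m + 1) → Euc (m + 1)}
  {c : ℝ≥0} {S : Set (Euc (m + 1))}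

theorem IsNormalTube.enorm_sub_le_segIntegral (hT : IsNormalTube Ω L δ π ν)
    {u : Euc (m + 1) → ℝ} (hu : ContDiff ℝ ∞ u) {b : ℝ} (hb : b ≤ δ) {x : Euc (m + 1)}
    (hx : x ∈ tube Ω b) {s : ℝ} (hs : s ∈ Ioo (-b) b) :
    ‖u x - u (π x + s • ν x)‖ₑ ≤ segIntegral π ν b (fun y => ‖gradient u y‖ₑ) x := by
  have hxδ := tube_mono Ω hb hx
  obtain ⟨hπ, hxeq⟩ := hT.isOrthProj x hxδ
  rw [← hT.ν_eq x hxδ] at hxeq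
  have hν : ‖ν x‖ = 1 := by rw [hT.ν_eq x hxδ]; exact hT.norm_normal _ hπ
  have hline : ∀ τ : ℝ, HasDerivAt (fun τ : ℝ => π x + τ • ν x) (ν x) τ := fun τ => by
    simpa using ((hasDerivAt_id τ).smul_const (ν x)).const_add (π x)
  have hw : ∀ τ : ℝ, HasDerivAt (fun τ : ℝ => u (π x + τ • ν x))
      (fderiv ℝ u (π x + τ • ν x) (ν x)) τ := fun τ =>
    ((hu.differentiable (by simp)) _).hasFDerivAt.comp_hasDerivAt τ (hline τ)
  have hcont : Continuous fun τ : ℝ => fderiv ℝ u (π x + τ • ν x) (ν x) := by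
    have h1 : Continuous (fderiv ℝ u) := hu.continuous_fderiv (by simp)
    fun_prop
  have h1 := enorm_sub_le_lintegral_deriv hw hcont hs (abs_lt.1 hx : sgnDist Ω x ∈ Ioo (-b) b)
  simp only [← hxeq] at h1
  refine h1.trans (lintegral_mono fun τ => ?_)
  simp only
  rw [← inner_gradient, ← ofReal_norm, ← ofReal_norm]
  refine ENNReal.ofReal_le_ofReal ?_
  have := abs_real_inner_le_norm (gradient u (π x + τ • ν x)) (ν x)
  rwa [hν, mul_one] at this

/-- The trace inequality. -/
theorem IsTubeSurface.lintegral_enorm_le (hS : IsTubeSurface Ω δ π ν c S)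
    (hT : IsNormalTube Ω L δ π ν) {b : ℝ} (hb0 : 0 < b) (hb : b ≤ δ) (hSb : S ⊆ tube Ω b)
    {u : Euc (m + 1) → ℝ} (hu : ContDiff ℝ ∞ u) :
    eLpNorm u 1 (μHE[m].restrict S) ≤
      c * ((ENNReal.ofReal (2 * b))⁻¹ + 1) * w1pNorm (tube Ω b) 1 u (gradient u) := by
  set ℓ := ENNReal.ofReal (2 * b) with hℓ
  have hℓ0 : ℓ ≠ 0 := by rw [hℓ]; simpa using hb0
  have hℓt : ℓ ≠ ⊤ := ENNReal.ofReal_ne_top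
  have hvol : volume (Ioo (-b) b) = ℓ := by rw [Real.volume_Ioo, hℓ]; congr 1; ring
  have hum : Measurable fun y => ‖u y‖ₑ := hu.continuous.enorm.measurable
  have hgm : Measurable fun y => ‖gradient u y‖ₑ :=
    (continuous_gradient_of_contDiff hu).enorm.measurable
  -- Averaging over the normal segment produces 1/(2b). The blow-up for thin tubes is harmless,
  -- since this bound serves only existence and convergence of traces.
  have hpt : ∀ x ∈ S, ‖u x‖ₑ ≤ ℓ⁻¹ * segIntegral π ν b (fun y => ‖u y‖ₑ) x +
      segIntegral π ν b (fun y => ‖gradient u y‖ₑ) x := by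
    intro x hx
    set g := segIntegral π ν b (fun y => ‖gradient u y‖ₑ) x with hg
    have hΘ : Continuous fun s : ℝ => π x + s • ν x := by fun_prop
    have h1 : ℓ * ‖u x‖ₑ ≤ segIntegral π ν b (fun y => ‖u y‖ₑ) x + ℓ * g := by
      calc ℓ * ‖u x‖ₑ = ∫⁻ _ in Ioo (-b) b, ‖u x‖ₑ := by
            rw [lintegral_const, Measure.restrict_apply_univ, hvol, mul_comm]
        _ ≤ ∫⁻ s in Ioo (-b) b, (‖u (π x + s • ν x)‖ₑ + g) := by
            refine setLIntegral_mono' measurableSet_Ioo fun s hs => ?_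
            have h2 := hT.enorm_sub_le_segIntegral hu hb (hSb hx) hs
            calc ‖u x‖ₑ = ‖u (π x + s • ν x) + (u x - u (π x + s • ν x))‖ₑ := by
                  congr 1; ring
              _ ≤ _ := (enorm_add_le _ _).trans (by gcongr)
        _ = _ := by
            rw [lintegral_add_right _ measurable_const, lintegral_const,
              Measure.restrict_apply_univ, hvol, mul_comm ℓ]
            rfl
    calc ‖u x‖ₑ = ℓ⁻¹ * (ℓ * ‖u x‖ₑ) := by
          rw [← mul_assoc, ENNReal.inv_mul_cancel hℓ0 hℓt, one_mul]
      _ ≤ ℓ⁻¹ * (segIntegral π ν b (fun y => ‖u y‖ₑ) x + ℓ * g) := by gcongr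
      _ = _ := by rw [mul_add, ← mul_assoc, ENNReal.inv_mul_cancel hℓ0 hℓt, one_mul]
  rw [eLpNorm_one_eq_lintegral_enorm]
  calc ∫⁻ x in S, ‖u x‖ₑ ∂μHE[m]
      ≤ ∫⁻ x in S, (ℓ⁻¹ * segIntegral π ν b (fun y => ‖u y‖ₑ) x +
          segIntegral π ν b (fun y => ‖gradient u y‖ₑ) x) ∂μHE[m] :=
        setLIntegral_mono' hS.isCompact.measurableSet hpt
    _ = ℓ⁻¹ * ∫⁻ x in S, segIntegral π ν b (fun y => ‖u y‖ₑ) x ∂μHE[m] +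
          ∫⁻ x in S, segIntegral π ν b (fun y => ‖gradient u y‖ₑ) x ∂μHE[m] := by
        rw [lintegral_add_right _ (hT.measurable_segIntegral hgm),
          lintegral_const_mul _ (hT.measurable_segIntegral hum)]
    _ ≤ ℓ⁻¹ * (c * ∫⁻ x in tube Ω b, ‖u x‖ₑ) + c * ∫⁻ x in tube Ω b, ‖gradient u x‖ₑ := by
        gcongr
        · exact hS.lintegral_le b hb _ hum
        · exact hS.lintegral_le b hb _ hgm
    _ ≤ _ := by
        rw [w1pNorm, eLpNorm_one_eq_lintegral_enorm, eLpNorm_one_eq_lintegral_enorm]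
        set A := ∫⁻ x in tube Ω b, ‖u x‖ₑ
        set B := ∫⁻ x in tube Ω b, ‖gradient u x‖ₑ
        calc ℓ⁻¹ * (c * A) + c * B ≤ (ℓ⁻¹ * (c * A) + c * B) + (c * A + ℓ⁻¹ * (c * B)) :=
              le_self_add
          _ = _ := by ring

theorem w1pNorm_sub_le {n : ℕ} {G Q : Set (Euc n)} {f : Euc n → ℝ} {F : Euc n → Euc n}
    (hW : HasWeakGradient G f F) (hQ : IsCompact Q) (hQG : Q ⊆ G) {u v : Euc n → ℝ}
    (hu : ContDiff ℝ ∞ u) (hv : ContDiff ℝ ∞ v) :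
    w1pNorm Q 1 (fun x => u x - v x) (gradient fun x => u x - v x) ≤
      w1pNorm Q 1 (fun x => u x - f x) (fun x => gradient u x - F x) +
      w1pNorm Q 1 (fun x => v x - f x) (fun x => gradient v x - F x) := by
  have hf := (hW.1.integrableOn_compact_subset hQG hQ).aestronglyMeasurable
  have hF := (hW.2.1.integrableOn_compact_subset hQG hQ).aestronglyMeasurable
  have hgu := (continuous_gradient_of_contDiff hu).aestronglyMeasurable (μ := volume.restrict Q)
  have hgv := (continuous_gradient_of_contDiff hv).aestronglyMeasurable (μ := volume.restrict Q)
  have hu' := hu.continuous.aestronglyMeasurable (μ := volume.restrict Q)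
  have hv' := hv.continuous.aestronglyMeasurable (μ := volume.restrict Q)
  have e1 : (fun x => u x - v x) = (fun x => u x - f x) - fun x => v x - f x := by
    ext x; simp
  have e2 : (gradient fun x => u x - v x) =
      (fun x => gradient u x - F x) - fun x => gradient v x - F x := by
    ext1 x; rw [gradient_sub_of_contDiff hu hv]; simp
  unfold w1pNorm
  rw [e2, e1]
  calc _ ≤ _ := add_le_add (eLpNorm_sub_le (hu'.sub hf) (hv'.sub hf) le_rfl)
        (eLpNorm_sub_le (hgu.sub hF) (hgv.sub hF) le_rfl)
    _ = _ := add_add_add_comm _ _ _ _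

/-- Smooth functions are integrable on the surface, and the difference of their traces is controlled
by their distances to a common weakly differentiable function near the surface. -/
theorem IsTubeSurface.exists_trace_const (hS : IsTubeSurface Ω δ π ν c S)
    (hT : IsNormalTube Ω L δ π ν) (hb : Bornology.IsBounded Ω) {a : ℝ} (ha0 : 0 < a)
    (ha : a ≤ δ) (hSa : S ⊆ tube Ω a) :
    ∃ (C : ℝ≥0∞) (Q : Set (Euc (m + 1))), C ≠ ⊤ ∧ IsCompact Q ∧ Q ⊆ tube Ω a ∧
      (∀ u : Euc (m + 1) → ℝ, ContDiff ℝ ∞ u → MemLp u 1 (μHE[m].restrict S)) ∧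
      ∀ (f : Euc (m + 1) → ℝ) (F : Euc (m + 1) → Euc (m + 1)),
        HasWeakGradient (tube Ω a) f F → ∀ u v : Euc (m + 1) → ℝ, ContDiff ℝ ∞ u →
        ContDiff ℝ ∞ v → eLpNorm (fun x => u x - v x) 1 (μHE[m].restrict S) ≤
          C * (w1pNorm Q 1 (fun x => u x - f x) (fun x => gradient u x - F x) +
            w1pNorm Q 1 (fun x => v x - f x) (fun x => gradient v x - F x)) := by
  obtain ⟨b, hb0, hba, hSb⟩ := exists_lt_subset_tube hS.isCompact ha0 hSa
  have hQ := isCompact_abs_sgnDist_le hb hT.nonempty b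
  have hQa : {x | |sgnDist Ω x| ≤ b} ⊆ tube Ω a := fun x hx => lt_of_le_of_lt hx hba
  have hbQ : tube Ω b ⊆ {x | |sgnDist Ω x| ≤ b} := fun x hx => show |sgnDist Ω x| ≤ b from le_of_lt hx
  have hC : (c : ℝ≥0∞) * ((ENNReal.ofReal (2 * b))⁻¹ + 1) ≠ ⊤ := by
    refine ENNReal.mul_ne_top ENNReal.coe_ne_top (ENNReal.add_ne_top.2 ⟨?_, ENNReal.one_ne_top⟩)
    simpa using hb0
  refine ⟨_, _, hC, hQ, hQa, fun u hu => ⟨hu.continuous.aestronglyMeasurable, ?_⟩,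
    fun f F hW u v hu hv => ?_⟩
  · refine (hS.lintegral_enorm_le hT hb0 (hba.le.trans ha) hSb hu).trans_lt
      (ENNReal.mul_lt_top hC.lt_top ?_)
    refine (w1pNorm_mono hbQ _ _ _).trans_lt ?_
    have h1 := memLp_one_iff_integrable.2
      (hu.continuous.continuousOn.integrableOn_compact (μ := volume) hQ)
    have h2 := memLp_one_iff_integrable.2
      ((continuous_gradient_of_contDiff hu).continuousOn.integrableOn_compact (μ := volume) hQ)
    exact ENNReal.add_lt_top.2 ⟨h1.2, h2.2⟩
  · refine (hS.lintegral_enorm_le hT hb0 (hba.le.trans ha) hSb (hu.sub hv)).trans ?_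
    gcongr
    exact (w1pNorm_mono hbQ _ _ _).trans (w1pNorm_sub_le hW hQ hQa hu hv)

/-- Traces of weakly differentiable functions exist. -/
theorem IsTubeSurface.exists_isTraceOn (hS : IsTubeSurface Ω δ π ν c S)
    (hT : IsNormalTube Ω L δ π ν) (hb : Bornology.IsBounded Ω) {a : ℝ} (ha0 : 0 < a)
    (ha : a ≤ δ) (hSa : S ⊆ tube Ω a) {f : Euc (m + 1) → ℝ} {F : Euc (m + 1) → Euc (m + 1)}
    (hW : HasWeakGradient (tube Ω a) f F) : ∃ g, IsTraceOn (tube Ω a) S f F g := by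
  obtain ⟨C, Q, hC, hQ, hQa, hmem, htr⟩ := hS.exists_trace_const hT hb ha0 ha hSa
  obtain ⟨u, hu, hconv⟩ := exists_smooth_seq_tube hb hT.nonempty hW
  set e : ℕ → ℝ≥0∞ := fun k =>
    w1pNorm Q 1 (fun x => u k x - f x) (fun x => gradient (u k) x - F x) with he
  have he0 : Tendsto e atTop (𝓝 0) := hconv Q hQ hQa
  have hcau : CauchySeq fun k => (hmem (u k) (hu k)).toLp (u k) := by
    rw [EMetric.cauchySeq_iff]
    intro ε hε
    have h1 : Tendsto (fun p : ℕ × ℕ => C * (e p.1 + e p.2)) atTop (𝓝 0) := by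
      have h2 : Tendsto (fun p : ℕ × ℕ => e p.1 + e p.2) atTop (𝓝 (0 + 0)) := by
        rw [← prod_atTop_atTop_eq]
        exact (he0.comp tendsto_fst).add (he0.comp tendsto_snd)
      rw [add_zero] at h2
      have h3 := ENNReal.Tendsto.const_mul (a := C) h2 (Or.inr hC)
      rwa [mul_zero] at h3
    obtain ⟨⟨N, M⟩, hN⟩ := eventually_atTop.1 (h1.eventually (gt_mem_nhds hε))
    refine ⟨max N M, fun k hk l hl => ?_⟩
    rw [Lp.edist_toLp_toLp]
    refine lt_of_le_of_lt (htr f F hW (u k) (u l) (hu k) (hu l)) ?_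
    exact hN (k, l) ⟨(le_max_left _ _).trans hk, (le_max_right _ _).trans hl⟩
  obtain ⟨g, hg⟩ := cauchySeq_tendsto_of_complete hcau
  have hgL := Lp.memLp g
  rw [← Lp.toLp_coeFn g hgL, Lp.tendsto_Lp_iff_tendsto_eLpNorm''] at hg
  exact ⟨g, memLp_one_iff_integrable.1 hgL, u, hu, hconv, hg⟩

/-- Every approximating sequence converges to the trace on the surface. -/
theorem IsTubeSurface.tendsto_trace (hS : IsTubeSurface Ω δ π ν c S)
    (hT : IsNormalTube Ω L δ π ν) (hb : Bornology.IsBounded Ω) {a : ℝ} (ha0 : 0 < a)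
    (ha : a ≤ δ) (hSa : S ⊆ tube Ω a) {f : Euc (m + 1) → ℝ} {F : Euc (m + 1) → Euc (m + 1)}
    (hW : HasWeakGradient (tube Ω a) f F) {g : Euc (m + 1) → ℝ}
    (hg : IsTraceOn (tube Ω a) S f F g) {u : ℕ → Euc (m + 1) → ℝ} (hu : ∀ k, ContDiff ℝ ∞ (u k))
    (hconv : ∀ Q : Set (Euc (m + 1)), IsCompact Q → Q ⊆ tube Ω a →
      Tendsto (fun k => w1pNorm Q 1 (fun x => u k x - f x) (fun x => gradient (u k) x - F x))
        atTop (𝓝 0)) :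
    Tendsto (fun k => eLpNorm (fun x => u k x - g x) 1 (μHE[m].restrict S)) atTop (𝓝 0) := by
  obtain ⟨C, Q, hC, hQ, hQa, hmem, htr⟩ := hS.exists_trace_const hT hb ha0 ha hSa
  obtain ⟨hgi, v, hv, hvconv, hvg⟩ := hg
  have h1 : Tendsto (fun k => C * (w1pNorm Q 1 (fun x => u k x - f x)
      (fun x => gradient (u k) x - F x) + w1pNorm Q 1 (fun x => v k x - f x)
      (fun x => gradient (v k) x - F x)) + eLpNorm (fun x => v k x - g x) 1 (μHE[m].restrict S))
      atTop (𝓝 0) := by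
    have h2 := (hconv Q hQ hQa).add (hvconv Q hQ hQa)
    have h3 := (ENNReal.Tendsto.const_mul (a := C) h2 (Or.inr hC)).add hvg
    simpa using h3
  refine tendsto_of_tendsto_of_tendsto_of_le_of_le tendsto_const_nhds h1 (fun _ => zero_le)
    fun k => ?_
  have e1 : (fun x => u k x - g x) = (fun x => u k x - v k x) + fun x => v k x - g x := by
    ext x; simp
  rw [e1]
  refine (eLpNorm_add_le ((hmem _ (hu k)).1.sub (hmem _ (hv k)).1)
    ((hmem _ (hv k)).1.sub hgi.1) le_rfl).trans ?_
  exact add_le_add (htr f F hW (u k) (v k) (hu k) (hv k)) le_rfl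

end Trace

/-! ### The estimate of the difference of the traces -/

section Estimate

variable {m : ℕ} {Ω : Set (Euc (m + 1))} {L δ : ℝ} {π ν : Euc (m + 1) → Euc (m + 1)}
  {c : ℝ≥0} {S : Set (Euc (m + 1))}

/-- A trace on Γ is determined only almost everywhere; composing it with π is meaningful on S
because null sets of Γ have null preimages there. -/
theorem IsTubeSurface.absolutelyContinuous_map (hS : IsTubeSurface Ω δ π ν c S) :
    (μHE[m].restrict S).map π ≪ μHE[m].restrict (frontier Ω) :=
  (Measure.absolutelyContinuous_of_le hS.map_le).trans
    (Measure.smul_absolutelyContinuous)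

theorem IsTubeSurface.aestronglyMeasurable_comp (hS : IsTubeSurface Ω δ π ν c S)
    (hT : IsNormalTube Ω L δ π ν) {g : Euc (m + 1) → ℝ}
    (hg : AEStronglyMeasurable g (μHE[m].restrict (frontier Ω))) :
    AEStronglyMeasurable (fun x => g (π x)) (μHE[m].restrict S) :=
  (hg.mono_ac hS.absolutelyContinuous_map).comp_measurable hT.continuous_π.measurable

theorem IsTubeSurface.lintegral_comp_le (hS : IsTubeSurface Ω δ π ν c S)
    (hT : IsNormalTube Ω L δ π ν) {g : Euc (m + 1) → ℝ}
    (hg : AEStronglyMeasurable g (μHE[m].restrict (frontier Ω))) :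
    ∫⁻ x in S, ‖g (π x)‖ₑ ∂μHE[m] ≤ c * eLpNorm g 1 (μHE[m].restrict (frontier Ω)) := by
  have h1 : AEMeasurable (fun y => ‖g y‖ₑ) ((μHE[m].restrict S).map π) :=
    (hg.mono_ac hS.absolutelyContinuous_map).enorm
  rw [← lintegral_map' h1 hT.continuous_π.measurable.aemeasurable, eLpNorm_one_eq_lintegral_enorm]
  refine (lintegral_mono' hS.map_le le_rfl).trans ?_
  rw [lintegral_smul_measure, smul_eq_mul]

/-- The difference of the traces is bounded by the integral of the weak gradient along normal
segments. -/
theorem IsTubeSurface.ae_enorm_sub_le (hS : IsTubeSurface Ω δ π ν c S) {c' : ℝ≥0}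
    (hΓ : IsTubeSurface Ω δ π ν c' (frontier Ω))
    (hT : IsNormalTube Ω L δ π ν) (hb : Bornology.IsBounded Ω) {a b : ℝ} (hb0 : 0 < b)
    (hba : b < a) (ha : a ≤ δ) (hSb : S ⊆ tube Ω b) {f : Euc (m + 1) → ℝ}
    {F F' : Euc (m + 1) → Euc (m + 1)}
    (hW : HasWeakGradient (tube Ω a) f F) (hF' : StronglyMeasurable F')
    (hFF' : F =ᵐ[volume.restrict (tube Ω a)] F') {g g₀ : Euc (m + 1) → ℝ}
    (hg : IsTraceOn (tube Ω a) S f F g) (hg₀ : IsTraceOn (tube Ω a) (frontier Ω) f F g₀) :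
    ∀ᵐ x ∂(μHE[m].restrict S), ‖g x - g₀ (π x)‖ₑ ≤ segIntegral π ν b (fun y => ‖F' y‖ₑ) x := by
  obtain ⟨hgi, u, hu, hconv, hug⟩ := id hg
  have ha0 : 0 < a := hb0.trans hba
  -- The two traces may come with different approximating sequences. The one for S also converges to
  -- g₀ on Γ, so a single sequence can be used.
  have hug₀ := hΓ.tendsto_trace hT hb ha0 ha (frontier_subset_tube Ω ha0) hW hg₀ hu hconv
  have hbδ : b ≤ δ := hba.le.trans ha
  set I := segIntegral π ν b (fun y => ‖F' y‖ₑ) with hI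
  have hIm : Measurable I := hT.measurable_segIntegral hF'.enorm
  have hdm : AEStronglyMeasurable (fun x => g x - g₀ (π x)) (μHE[m].restrict S) :=
    hgi.1.sub (hS.aestronglyMeasurable_comp hT hg₀.1.1)
  set Q := {x : Euc (m + 1) | |sgnDist Ω x| ≤ b} with hQdef
  have hQ : IsCompact Q := isCompact_abs_sgnDist_le hb hT.nonempty b
  have hQa : Q ⊆ tube Ω a := fun x (hx : |sgnDist Ω x| ≤ b) => lt_of_le_of_lt hx hba
  have hbQ : tube Ω b ⊆ Q := fun x hx => show |sgnDist Ω x| ≤ b from le_of_lt hx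
  set J : ℕ → Euc (m + 1) → ℝ≥0∞ := fun k =>
    segIntegral π ν b (fun y => ‖gradient (u k) y - F' y‖ₑ) with hJ
  have hgF : ∀ k, Measurable fun y => ‖gradient (u k) y - F' y‖ₑ := fun k =>
    ((continuous_gradient_of_contDiff (hu k)).stronglyMeasurable.sub hF').enorm
  have hJm : ∀ k, Measurable (J k) := fun k => hT.measurable_segIntegral (hgF k)
  set R : ℕ → Euc (m + 1) → ℝ≥0∞ := fun k x =>
    ‖u k x - g x‖ₑ + (J k x + ‖u k (π x) - g₀ (π x)‖ₑ) with hR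
  -- Truncated subtraction reduces the claim to the vanishing of the integral of the excess; R k
  -- collects the trace error on S, the gradient error on the segment and the trace error at π x.
  have hpt : ∀ k, ∀ x ∈ S, ‖g x - g₀ (π x)‖ₑ - I x ≤ R k x := by
    intro k x hx
    rw [tsub_le_iff_right]
    have h0 : (0 : ℝ) ∈ Ioo (-b) b := ⟨by linarith, hb0⟩
    have h1 := hT.enorm_sub_le_segIntegral (hu k) hbδ (hSb hx) h0
    rw [zero_smul, add_zero] at h1
    have h2 : segIntegral π ν b (fun y => ‖gradient (u k) y‖ₑ) x ≤ J k x + I x := by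
      have hΘ : Continuous fun s : ℝ => π x + s • ν x := by fun_prop
      have hm : Measurable fun s : ℝ => ‖F' (π x + s • ν x)‖ₑ := hF'.enorm.comp hΘ.measurable
      simp only [hJ, hI, segIntegral]
      rw [← lintegral_add_right _ hm]
      refine lintegral_mono fun s => ?_
      simp only
      refine le_trans (le_of_eq ?_) (enorm_add_le _ _)
      rw [sub_add_cancel]
    have h3 : g x - g₀ (π x) = -(u k x - g x) + ((u k x - u k (π x)) +
        (u k (π x) - g₀ (π x))) := by ring
    rw [h3]
    calc _ ≤ ‖-(u k x - g x)‖ₑ + (‖u k x - u k (π x)‖ₑ + ‖u k (π x) - g₀ (π x)‖ₑ) :=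
          (enorm_add_le _ _).trans (add_le_add le_rfl (enorm_add_le _ _))
      _ ≤ ‖u k x - g x‖ₑ + ((J k x + I x) + ‖u k (π x) - g₀ (π x)‖ₑ) := by
          rw [enorm_neg]; gcongr; exact h1.trans h2
      _ = R k x + I x := by simp only [hR]; ring
  have hRint : ∀ k, ∫⁻ x in S, R k x ∂μHE[m] ≤
      eLpNorm (fun x => u k x - g x) 1 (μHE[m].restrict S) +
      (c * w1pNorm Q 1 (fun x => u k x - f x) (fun x => gradient (u k) x - F x) +
        c * eLpNorm (fun x => u k x - g₀ x) 1 (μHE[m].restrict (frontier Ω))) := by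
    intro k
    have hm1 : AEMeasurable (fun x => ‖u k x - g x‖ₑ) (μHE[m].restrict S) :=
      ((hu k).continuous.aestronglyMeasurable.sub hgi.1).enorm
    have hm3 : AEStronglyMeasurable (fun x => u k x - g₀ x) (μHE[m].restrict (frontier Ω)) :=
      (hu k).continuous.aestronglyMeasurable.sub hg₀.1.1
    simp only [hR]
    rw [lintegral_add_left' hm1, lintegral_add_left (hJm k), eLpNorm_one_eq_lintegral_enorm]
    refine add_le_add le_rfl (add_le_add ?_ ?_)
    · refine (hS.lintegral_le b hbδ _ (hgF k)).trans ?_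
      gcongr
      refine le_trans ?_ ((w1pNorm_mono hbQ 1 _ _).trans le_rfl)
      rw [w1pNorm]
      refine le_trans ?_ le_add_self
      rw [eLpNorm_one_eq_lintegral_enorm]
      refine le_of_eq (lintegral_congr_ae ?_)
      filter_upwards [ae_restrict_of_ae_restrict_of_subset (tube_mono Ω hba.le) hFF'] with y hy
      rw [hy]
    · exact hS.lintegral_comp_le hT hm3
  have hlim : Tendsto (fun k => ∫⁻ x in S, R k x ∂μHE[m]) atTop (𝓝 0) := by
    have h1 := ENNReal.Tendsto.const_mul (a := (c : ℝ≥0∞)) (hconv Q hQ hQa)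
      (Or.inr ENNReal.coe_ne_top)
    have h2 := ENNReal.Tendsto.const_mul (a := (c : ℝ≥0∞)) hug₀ (Or.inr ENNReal.coe_ne_top)
    have h3 := hug.add (h1.add h2)
    simp only [mul_zero, add_zero] at h3
    exact tendsto_of_tendsto_of_tendsto_of_le_of_le tendsto_const_nhds h3 (fun _ => zero_le)
      hRint
  have hzero : ∫⁻ x in S, (‖g x - g₀ (π x)‖ₑ - I x) ∂μHE[m] = 0 := by
    refine le_antisymm (ge_of_tendsto' hlim fun k => ?_) zero_le
    exact setLIntegral_mono' hS.isCompact.measurableSet (hpt k)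
  have hae := (lintegral_eq_zero_iff' (hdm.enorm.sub hIm.aemeasurable)).1 hzero
  filter_upwards [hae] with x hx
  exact tsub_eq_zero_iff_le.1 hx

theorem volume_Ioo_neg_self (b : ℝ) : volume (Ioo (-b) b) = ENNReal.ofReal (2 * b) := by
  rw [Real.volume_Ioo]; congr 1; ring

/-- Integration along normal segments gains the power `1 - 1/p` of the length in `L^p`. -/
theorem IsTubeSurface.eLpNorm_segIntegral_le (hS : IsTubeSurface Ω δ π ν c S)
    (hT : IsNormalTube Ω L δ π ν) {b : ℝ} (hb : b ≤ δ)
    {F : Euc (m + 1) → Euc (m + 1)} (hF : StronglyMeasurable F) {p : ℝ≥0∞} (hp : 1 ≤ p)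
    {h : Euc (m + 1) → ℝ}
    (hle : ∀ᵐ x ∂(μHE[m].restrict S), ‖h x‖ₑ ≤ segIntegral π ν b (fun y => ‖F y‖ₑ) x) :
    eLpNorm h p (μHE[m].restrict S) ≤ ENNReal.ofReal (2 * b) ^ (1 - (p⁻¹).toReal) *
      (c : ℝ≥0∞) ^ (p⁻¹).toReal * eLpNorm F p (volume.restrict (tube Ω b)) := by
  have hp0 : p ≠ 0 := (zero_lt_one.trans_le hp).ne'
  have hΘ : ∀ x, Continuous fun s : ℝ => π x + s • ν x := fun x => by fun_prop
  rcases eq_or_ne p ⊤ with rfl | hpt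
  · simp only [ENNReal.inv_top, ENNReal.toReal_zero, sub_zero, ENNReal.rpow_one,
      ENNReal.rpow_zero, mul_one]
    set N := eLpNorm F ⊤ (volume.restrict (tube Ω b)) with hN
    -- The excess of |F| over its essential supremum has zero integral in the tube, hence along
    -- almost every normal segment. So the bound by N can be used on almost every segment.
    have hψm : Measurable fun y => ‖F y‖ₑ - N := hF.enorm.sub_const N
    have h1 : ∫⁻ x in tube Ω b, (‖F x‖ₑ - N) = 0 := by
      rw [lintegral_eq_zero_iff hψm]
      have h2 := enorm_ae_le_eLpNormEssSup F (volume.restrict (tube Ω b))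
      rw [← eLpNorm_exponent_top] at h2
      filter_upwards [h2] with x hx
      exact tsub_eq_zero_of_le hx
    have h3 := hS.lintegral_le b hb _ hψm
    rw [h1, mul_zero, nonpos_iff_eq_zero,
      lintegral_eq_zero_iff (hT.measurable_segIntegral hψm)] at h3
    rw [eLpNorm_exponent_top]
    refine eLpNormEssSup_le_of_ae_enorm_bound ?_
    filter_upwards [h3, hle] with x hx hx2
    refine hx2.trans ?_
    calc segIntegral π ν b (fun y => ‖F y‖ₑ) x
        ≤ ∫⁻ s in Ioo (-b) b, ((‖F (π x + s • ν x)‖ₑ - N) + N) :=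
          lintegral_mono fun s => le_tsub_add
      _ = segIntegral π ν b (fun y => ‖F y‖ₑ - N) x + N * volume (Ioo (-b) b) := by
          rw [lintegral_add_right _ measurable_const, lintegral_const, Measure.restrict_apply_univ]
          rfl
      _ = ENNReal.ofReal (2 * b) * N := by
          rw [hx, volume_Ioo_neg_self]; simp [mul_comm]
  · have hq0 : 0 < p.toReal := ENNReal.toReal_pos hp0 hpt
    set q := p.toReal with hq
    have hqi : (p⁻¹).toReal = 1 / q := by rw [ENNReal.toReal_inv, one_div]
    rw [hqi]
    set κ := ENNReal.ofReal (2 * b) ^ (1 - 1 / q) with hκ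
    have hψm : Measurable fun y => ‖F y‖ₑ ^ q := hF.enorm.pow_const q
    -- Hölder on a segment of length 2b; this is the source of the power 1 - 1/p.
    have hjensen : ∀ x, segIntegral π ν b (fun y => ‖F y‖ₑ) x ^ q ≤
        κ ^ q * segIntegral π ν b (fun y => ‖F y‖ₑ ^ q) x := by
      intro x
      have h1 := eLpNorm_le_eLpNorm_mul_rpow_measure_univ (μ := volume.restrict (Ioo (-b) b)) hp
        (f := fun s : ℝ => F (π x + s • ν x))
        (hF.comp_measurable (hΘ x).measurable).aestronglyMeasurable
      rw [eLpNorm_one_eq_lintegral_enorm, eLpNorm_eq_lintegral_rpow_enorm_toReal hp0 hpt,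
        Measure.restrict_apply_univ, volume_Ioo_neg_self, ENNReal.toReal_one, ← hq, div_one,
        ← hκ] at h1
      have h2 := ENNReal.rpow_le_rpow h1 hq0.le
      refine h2.trans (le_of_eq ?_)
      rw [ENNReal.mul_rpow_of_nonneg _ _ hq0.le, ← ENNReal.rpow_mul, one_div,
        inv_mul_cancel₀ hq0.ne', ENNReal.rpow_one, mul_comm]
      rfl
    rw [eLpNorm_eq_lintegral_rpow_enorm_toReal hp0 hpt,
      eLpNorm_eq_lintegral_rpow_enorm_toReal hp0 hpt, ← hq]
    have hmain : ∫⁻ x in S, ‖h x‖ₑ ^ q ∂μHE[m] ≤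
        κ ^ q * (c * ∫⁻ x in tube Ω b, ‖F x‖ₑ ^ q) := by
      calc _ ≤ ∫⁻ x in S, κ ^ q * segIntegral π ν b (fun y => ‖F y‖ₑ ^ q) x ∂μHE[m] := by
            refine lintegral_mono_ae ?_
            filter_upwards [hle] with x hx
            exact (ENNReal.rpow_le_rpow hx hq0.le).trans (hjensen x)
        _ = κ ^ q * ∫⁻ x in S, segIntegral π ν b (fun y => ‖F y‖ₑ ^ q) x ∂μHE[m] :=
            lintegral_const_mul _ (hT.measurable_segIntegral hψm)
        _ ≤ _ := by
            gcongr
            exact hS.lintegral_le b hb _ hψm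
    refine (ENNReal.rpow_le_rpow hmain (by positivity)).trans (le_of_eq ?_)
    have hqi0 : 0 ≤ 1 / q := by positivity
    rw [ENNReal.mul_rpow_of_nonneg _ _ hqi0, ENNReal.mul_rpow_of_nonneg _ _ hqi0,
      ← ENNReal.rpow_mul, mul_one_div_cancel hq0.ne', ENNReal.rpow_one, mul_assoc]

theorem toReal_inv_mem_Icc {p : ℝ≥0∞} (hp : 1 ≤ p) : (p⁻¹).toReal ∈ Icc (0 : ℝ) 1 := by
  refine ⟨ENNReal.toReal_nonneg, ?_⟩
  have h1 : p⁻¹ ≤ 1 := ENNReal.inv_le_one.2 hp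
  have := ENNReal.toReal_mono ENNReal.one_ne_top h1
  simpa using this

/-- For t = 1/p in [0, 1], 2^{1-t} ≤ 2 and c^t ≤ c + 1, so a single constant serves every p. -/
theorem const_mul_le {a b : ℝ} (hb0 : 0 < b) (hba : b ≤ a) (c : ℝ≥0) {t : ℝ}
    (ht : t ∈ Icc (0 : ℝ) 1) :
    ENNReal.ofReal (2 * b) ^ (1 - t) * (c : ℝ≥0∞) ^ t ≤
      ENNReal.ofReal (2 * (c + 1) * a ^ (1 - t)) := by
  obtain ⟨ht0, ht1⟩ := ht
  have h1 : ENNReal.ofReal (2 * b) ^ (1 - t) ≤ ENNReal.ofReal (2 * a ^ (1 - t)) := by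
    rw [ENNReal.ofReal_rpow_of_pos (by positivity)]
    refine ENNReal.ofReal_le_ofReal ?_
    rw [Real.mul_rpow (by norm_num) hb0.le]
    have h2 : (2 : ℝ) ^ (1 - t) ≤ 2 := by
      calc (2 : ℝ) ^ (1 - t) ≤ 2 ^ (1 : ℝ) :=
            Real.rpow_le_rpow_of_exponent_le (by norm_num) (by linarith)
        _ = 2 := Real.rpow_one 2
    have h3 : b ^ (1 - t) ≤ a ^ (1 - t) := Real.rpow_le_rpow hb0.le hba (by linarith)
    gcongr
  have h4 : (c : ℝ≥0∞) ^ t ≤ ENNReal.ofReal (c + 1) := by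
    have e : ENNReal.ofReal ((c : ℝ) + 1) = (c : ℝ≥0∞) + 1 := by
      rw [ENNReal.ofReal_add c.coe_nonneg zero_le_one, ENNReal.ofReal_coe_nnreal, ENNReal.ofReal_one]
    refine le_of_le_of_eq ?_ e.symm
    calc (c : ℝ≥0∞) ^ t ≤ ((c : ℝ≥0∞) + 1) ^ t := ENNReal.rpow_le_rpow le_self_add ht0
      _ ≤ ((c : ℝ≥0∞) + 1) ^ (1 : ℝ) := ENNReal.rpow_le_rpow_of_exponent_le le_add_self ht1
      _ = _ := ENNReal.rpow_one _
  refine (mul_le_mul' h1 h4).trans (le_of_eq ?_)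
  have ha : 0 ≤ a := hb0.le.trans hba
  rw [← ENNReal.ofReal_mul (by positivity)]
  congr 1; ring

theorem IsTubeSurface.eLpNorm_trace_sub_le (hS : IsTubeSurface Ω δ π ν c S) {c' : ℝ≥0}
    (hΓ : IsTubeSurface Ω δ π ν c' (frontier Ω))
    (hT : IsNormalTube Ω L δ π ν) (hb : Bornology.IsBounded Ω) {a : ℝ} (ha0 : 0 < a)
    (ha : a ≤ δ) (hSa : S ⊆ tube Ω a) {p : ℝ≥0∞} (hp : 1 ≤ p) {f : Euc (m + 1) → ℝ}
    {F : Euc (m + 1) → Euc (m + 1)} (hfF : MemW1p (tube Ω a) p f F) {g g₀ : Euc (m + 1) → ℝ}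
    (hg : IsTraceOn (tube Ω a) S f F g) (hg₀ : IsTraceOn (tube Ω a) (frontier Ω) f F g₀) :
    MemLp (fun x => g x - g₀ (π x)) p (μHE[m].restrict S) ∧
      eLpNorm (fun x => g x - g₀ (π x)) p (μHE[m].restrict S) ≤
        ENNReal.ofReal (2 * (c + 1) * a ^ (1 - (p⁻¹).toReal)) * w1pNorm (tube Ω a) p f F := by
  obtain ⟨hW, hfp, hFp⟩ := hfF
  obtain ⟨b, hb0, hba, hSb⟩ := exists_lt_subset_tube hS.isCompact ha0 hSa
  have hae := hS.ae_enorm_sub_le hΓ hT hb hb0 hba ha hSb hW hFp.1.stronglyMeasurable_mk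
    hFp.1.ae_eq_mk hg hg₀
  have h1 := hS.eLpNorm_segIntegral_le hT (hba.le.trans ha) hFp.1.stronglyMeasurable_mk hp hae
  have h2 : eLpNorm (hFp.1.mk F) p (volume.restrict (tube Ω b)) ≤ w1pNorm (tube Ω a) p f F := by
    refine (eLpNorm_mono_measure _ (Measure.restrict_mono (tube_mono Ω hba.le) le_rfl)).trans ?_
    rw [← eLpNorm_congr_ae hFp.1.ae_eq_mk, w1pNorm]
    exact le_add_self
  have h3 : eLpNorm (fun x => g x - g₀ (π x)) p (μHE[m].restrict S) ≤
      ENNReal.ofReal (2 * (c + 1) * a ^ (1 - (p⁻¹).toReal)) * w1pNorm (tube Ω a) p f F :=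
    h1.trans (mul_le_mul' (const_mul_le hb0 hba.le c (toReal_inv_mem_Icc hp)) h2)
  refine ⟨⟨hg.1.1.sub (hS.aestronglyMeasurable_comp hT hg₀.1.1), h3.trans_lt ?_⟩, h3⟩
  exact ENNReal.mul_lt_top ENNReal.ofReal_lt_top (ENNReal.add_lt_top.2 ⟨hfp.2, hFp.2⟩)

end Estimate

/-! ### Assembly of the theorem -/

theorem mainTheorem8 (m : ℕ) (hm : 1 ≤ m) (Ω : Set (Euc (m + 1))) (hΩ_open : IsOpen Ω)
    (hΩ_bounded : Bornology.IsBounded Ω) (hΩ_connected : IsConnected Ω) (𝒜 : C11Atlas Ω) :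
    ∃ δ : ℝ, 0 < δ ∧ ∃ π : Euc (m + 1) → Euc (m + 1),
      (∀ x ∈ tube Ω δ, IsOrthProj Ω x (π x) ∧ ∀ y, IsOrthProj Ω x y → y = π x) ∧
      ∃ K₀ : ℝ, 0 < K₀ ∧ ∃ C : ℝ≥0∞ → ℝ, (∀ p, 0 < C p) ∧
        ∀ σ : ℝ, 0 < σ → ∀ K : ℝ, 0 < K → ∃ h₁ : ℝ, 0 < h₁ ∧
          ∀ h : ℝ, 0 < h → h < h₁ → ∀ T : Triangulation m,
            T.MeshSizeLE h → T.ShapeRegular σ → T.BoundaryVerticesOn Ω → T.GraphCompatible 𝒜 →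
            T.discreteBoundary ⊆ tube Ω (K₀ * h ^ 2) ∧
            (T.discreteBoundary ⊆ tube Ω (K * h ^ 2) →
              ∀ δ₁ : ℝ, K * h ^ 2 ≤ δ₁ → δ₁ ≤ 2 * K * h ^ 2 →
                δ₁ < δ ∧
                ∀ (p : ℝ≥0∞) (f : Euc (m + 1) → ℝ) (F : Euc (m + 1) → Euc (m + 1)),
                  1 ≤ p → MemW1p (tube Ω δ₁) p f F →
                  (∃ g, IsTraceOn (tube Ω δ₁) T.discreteBoundary f F g) ∧
                  (∃ g₀, IsTraceOn (tube Ω δ₁) (frontier Ω) f F g₀) ∧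
                  ∀ g g₀ : Euc (m + 1) → ℝ,
                    IsTraceOn (tube Ω δ₁) T.discreteBoundary f F g →
                    IsTraceOn (tube Ω δ₁) (frontier Ω) f F g₀ →
                    MemLp (fun x => g x - g₀ (π x)) p (μHE[m].restrict T.discreteBoundary) ∧
                    eLpNorm (fun x => g x - g₀ (π x)) p
                        (μHE[m].restrict T.discreteBoundary) ≤
                      ENNReal.ofReal (C p * δ₁ ^ (1 - (p⁻¹).toReal)) *
                        w1pNorm (tube Ω δ₁) p f F) := by
  obtain ⟨C, hC0, hC⟩ := 𝒜.exists_second_order hΩ_bounded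
  have hsec : HasSecondOrderNormal Ω C := ⟨hC0, nonempty_frontier_of_isBounded hΩ_bounded
    hΩ_connected.nonempty, fun y hy => 𝒜.norm_outerNormal hy, hC⟩
  obtain ⟨π, ν, hT⟩ := hsec.exists_isNormalTube
  obtain ⟨Λ₀, hΛ₀⟩ := 𝒜.exists_isTangentialPatch_frontier
  obtain ⟨Λ, hΛ⟩ := 𝒜.exists_patches hΩ_bounded hT
  set δ := (12 * C)⁻¹ with hδ
  have hΓ : IsTubeSurface Ω δ π ν (surfaceConst m 𝒜.M Λ₀) (frontier Ω) :=
    isTubeSurface_of_patches hT (isCompact_frontier_of_isBounded hΩ_bounded)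
      (frontier_subset_tube Ω hT.δ_pos)
      (by rw [← inter_iUnion, inter_eq_left.2 𝒜.frontier_subset]) hΛ₀
  set c := surfaceConst m 𝒜.M Λ with hc
  -- K₀ = 3C comes from the expansion constant. The trace constant comes from the number and
  -- Lipschitz constant of the patches, is the same for all p, and is chosen before σ and K.
  refine ⟨δ, hT.δ_pos, π, fun x hx => ⟨hT.isOrthProj x hx, hT.isOrthProj_unique x hx⟩,
    3 * C, by positivity, fun _ => 2 * (c + 1), fun _ => by positivity,
    fun σ hσ K hK => ?_⟩
  obtain ⟨h₁, h₁pos, hh₁⟩ := hΛ σ hσ K hK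
  refine ⟨h₁, h₁pos, fun h hh hlt T hmesh hshape hvert hgraph =>
    ⟨T.discreteBoundary_subset_tube hsec hh hmesh hvert, fun htube δ₁ hδ₁ hδ₁' => ?_⟩⟩
  obtain ⟨hKδ, hpatch⟩ := hh₁ h hh hlt
  obtain ⟨P, hSP, hP⟩ := hpatch T hmesh hshape hvert hgraph htube
  have hδ₁δ : δ₁ < δ := lt_of_le_of_lt hδ₁' hKδ
  have hδ₁0 : 0 < δ₁ := lt_of_lt_of_le (by positivity) hδ₁
  have hSδ₁ : T.discreteBoundary ⊆ tube Ω δ₁ := htube.trans (tube_mono Ω hδ₁)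
  have hS : IsTubeSurface Ω δ π ν c T.discreteBoundary :=
    isTubeSurface_of_patches hT T.isCompact_discreteBoundary
      (hSδ₁.trans (tube_mono Ω hδ₁δ.le)) hSP hP
  refine ⟨hδ₁δ, fun p f F hp hfF => ⟨?_, ?_, fun g g₀ hg hg₀ => ?_⟩⟩
  · exact hS.exists_isTraceOn hT hΩ_bounded hδ₁0 hδ₁δ.le hSδ₁ hfF.1
  · exact hΓ.exists_isTraceOn hT hΩ_bounded hδ₁0 hδ₁δ.le (frontier_subset_tube Ω hδ₁0) hfF.1
  · exact hS.eLpNorm_trace_sub_le hΓ hT hΩ_bounded hδ₁0 hδ₁δ.le hSδ₁ hp hfF hg hg₀
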